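/- \textbf{Setting.} Let $X$ be a finite set of clocks. Atomic constraints are $x \lhd c$, $c \lhd x$ (non-diagonal, $c\in\mathbb N$) and $x-y\lhd d$ (diagonal, $d\in\mathbb Z$), with $x,y\in X$ and $\lhd\in\{<,\le\}$; a guard is a finite conjunction of atomic constraints. An update $up$ assigns to each clock $x$ either $x:=c$ ($c\in\mathbb N$) or $x:=y+d$ ($y\in X$, $d\in\mathbb Z$); for a valuation $v:X\to\mathbb R_{\ge0}$, $up(v)\in\mathbb R^X$ is the resulting vector. An \emph{updateable timed automaton} $\mathcal A$ has a finite state set $Q$, an initial state $q_0$, a finite set $T$ of transitions $(q,g,up,q')$, and a set $F\subseteq Q$ of accepting states. A delay $\delta\ge 0$ changes $(q,v)$ into $(q,v+\delta)$; a transition $(q,g,up,q')$ changes $(q,v)$ into $(q',up(v))$ if $v\models g$ and $up(v)\ge0$. A run is an alternating sequence of delays and transitions from $(q_0,\mathbf 0)$; it is accepting if its last state is in $F$. The reachability problem asks for the existence of an accepting run. \textbf{State-based guards.} For an atomic constraint $\varphi$, $wp(\varphi,up)$ is obtained by substituting $up(x)$ for each clock $x$ of $\varphi$ and moving all constants to one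 side; it consists of this constraint if the result is a diagonal constraint on two different clocks, or of the form $z\lhd e$ or $e\lhd z$ with $z\in X$ and $e\ge0$; otherwise $wp(\varphi,up)=\emptyset$. For a set $G$ of atomic constraints, $wp(G,up)=\bigcup_{\varphi\in G}wp(\varphi,up)$. The state-based guard equations for sets $\mathcal G(q)$ of atomic constraints are $$\mathcal G(q)=\bigcup_{(q,g,up,q_1)\in T}\Big(\mathrm{atoms}(g)\cup wp(\{x\ge0\mid x\in X\},up)\cup wp(\mathcal G(q_1),up)\Big),\qquad q\in Q,$$ and $(\mathcal G(q))_{q\in Q}$ denotes their least solution for coordinatewise inclusion. It is finite if every $\mathcal G(q)$ is. \textbf{Simulation.} For a finite set $G$ let $L_G(x)$ (resp. $U_G(x)$) be the largest $c$ such that some $c\lhd x$ (resp. $x\lhd c$) is in $G$, and $-\infty$ if there is none. When the least solution is finite, define $(q,v)\preceq^{LU}_{\mathcal A}(q,v')$ to mean, with $G=\mathcal G(q)$: for every clock $x$, $v'(x)<v(x)$ implies $L_G(x)<v'(x)$, and $v(x)<v'(x)$ implies $U_G(x)<v(x)$; and every diagonal constraint of $G$ satisfied by $v$ is satisfied by $v'$.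 For sets of valuations, $(q,Z)\preceq^{LU}_{\mathcal A}(q,Z')$ if for every $v\in Z$ there is $v'\in Z'$ with $(q,v)\preceq^{LU}_{\mathcal A}(q,v')$. \textbf{Zone graph enumeration.} Write $\overrightarrow{Z}=\{v+\delta\mid v\in Z,\delta\ge0\}$. The initial node is $(q_0,\overrightarrow{\{\mathbf 0\}})$; the successor of $(q,Z)$ under $t=(q,g,up,q_1)$ is $(q_1,Z_1)$ with $Z_1=\overrightarrow{\{up(v)\mid v\in Z,\ v\models g,\ up(v)\ge 0\}}$. If $q_0\in F$, answer ``accepting run''. Otherwise start with an empty list Passed and a list Waiting that holds the initial node, and repeat: if Waiting is empty, answer ``no accepting run''; else move some node $(q,Z)$ from Waiting to Passed and treat, in some order, the transitions $t$ from $q$: let $(q_1,Z_1)$ be the successor under $t$; if $Z_1=\emptyset$ ignore it; else if $q_1\in F$ answer ``accepting run''; else if some $(q_1,Z_1')$ in Passed or Waiting satisfies $(q_1,Z_1)\preceq^{LU}_{\mathcal A}(q_1,Z_1')$ ignore it; else add $(q_1,Z_1)$ to Waiting. \textbf{Theorem.} (1) It is decidable, given an updateable timed automaton $\mathcal A$,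 whether the state-based guard equations of $\mathcal A$ have a finite least solution. (2) If they do, then zone graph enumeration using $\preceq^{LU}_{\mathcal A}$ is a sound, complete and terminating procedure for the reachability problem of $\mathcal A$: whatever choices are made, it always comes to an end with an answer; it answers ``accepting run'' only if $\mathcal A$ has an accepting run, and ``no accepting run'' only if $\mathcal A$ has none. (3) The procedure is effective: there is a computable function that maps each updateable timed automaton whose state-based guard equations have a finite least solution to the answer of the enumeration on it (so that reachability is decidable for these automata). -/

import Mathlib

open scoped NNReal

namespace UTA

/-! ### Constraints, updates, automata -/

/-- The comparison symbols `<` and `≤`. -/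
inductive Cmp
  | lt
  | le

/-- The meaning of a comparison symbol on the reals. -/
def Cmp.holds : Cmp → ℝ → ℝ → Prop
  | .lt, a, b => a < b
  | .le, a, b => a ≤ b

/-- Atomic clock constraints: `upper x s c` is `x ◁ c`, `lower c s x` is `c ◁ x` (both with
`c : ℕ`), and `diag x y s d` is the diagonal constraint `x - y ◁ d` (with `d : ℤ`). -/
inductive Constraint (X : Type*)
  | upper (x : X) (s : Cmp) (c : ℕ)
  | lower (c : ℕ) (s : Cmp) (x : X)
  | diag (x y : X) (s : Cmp) (d : ℤ)

/-- Clock valuations. -/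
abbrev Valuation (X : Type*) := X → ℝ≥0

/-- `φ.sat v` is `v ⊨ φ`. -/
def Constraint.sat {X : Type*} : Constraint X → Valuation X → Prop
  | .upper x s c, v => s.holds (v x) c
  | .lower c s x, v => s.holds c (v x)
  | .diag x y s d, v => s.holds ((v x : ℝ) - (v y : ℝ)) d

/-- The valuation `v + δ`. -/
def delay {X : Type*} (v : Valuation X) (δ : ℝ≥0) : Valuation X := fun x => v x + δ

/-- Right-hand sides of atomic updates: `const c` is `x := c` (with `c : ℕ`), and `shift y d` is
`x := y + d` (with `d : ℤ`). -/
inductive AtomicUpdate (X : Type*)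
  | const (c : ℕ)
  | shift (y : X) (d : ℤ)

/-- An update gives an atomic update for each clock. -/
abbrev Update (X : Type*) := X → AtomicUpdate X

/-- The value of an atomic update at `v`, which may be negative. -/
def AtomicUpdate.eval {X : Type*} : AtomicUpdate X → Valuation X → ℝ
  | .const c, _ => c
  | .shift y d, v => (v y : ℝ) + d

/-- The real vector `up(v)`. -/
def applyUpdate {X : Type*} (up : Update X) (v : Valuation X) : X → ℝ := fun x => (up x).eval v

/-- A transition `(q, g, up, q')`; the guard is the conjunction of a finite list of atomic
constraints. -/
structure Transition (Q X : Type*) where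
  src : Q
  guard : List (Constraint X)
  update : Update X
  tgt : Q

/-- An updateable timed automaton with state set `Q` and clock set `X` (which are assumed to be
finite where automata are used). The finite sets of transitions and of accepting states are
presented as lists. -/
structure Automaton (Q X : Type*) where
  init : Q
  trans : List (Transition Q X)
  accepting : List Q

variable {Q X : Type*}

/-! ### Semantics -/

/-- The valuation `v` satisfies the guard of `t`. -/
def Transition.enabled (t : Transition Q X) (v : Valuation X) : Prop := ∀ φ ∈ t.guard, φ.sat v

/-- The action transition `(t.src, v) → (t.tgt, v')`: `v` satisfies the guard, `up(v) ≥ 0`, and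
`v' = up(v)`. -/
def Transition.Fires (t : Transition Q X) (v v' : Valuation X) : Prop :=
  t.enabled v ∧ (∀ x, 0 ≤ applyUpdate t.update v x) ∧ ∀ x, (v' x : ℝ) = applyUpdate t.update v x

/-- A delay followed by an action, between configurations. -/
def Automaton.DelayAction (A : Automaton Q X) (p p' : Q × Valuation X) : Prop :=
  ∃ δ : ℝ≥0, ∃ t ∈ A.trans, t.src = p.1 ∧ t.tgt = p'.1 ∧ t.Fires (delay p.2 δ) p'.2

/-- There is a run from `(q₀, 0)` (possibly of length `0`) whose last state is accepting. -/
def Automaton.HasAcceptingRun (A : Automaton Q X) : Prop :=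
  ∃ p : Q × Valuation X,
    Relation.ReflTransGen A.DelayAction (A.init, fun _ => 0) p ∧ p.1 ∈ A.accepting

/-! ### Weakest preconditions and the state-based guards -/

/-- The weakest precondition `wp(⊑_φ, up)` of an atomic constraint: substitute `up` into `φ` and
solve for the remaining clocks; the result is kept if it is a non-diagonal constraint with a
non-negative constant or a diagonal constraint on two different clocks. -/
def wp (up : Update X) : Constraint X → Set (Constraint X)
  | .upper x s c =>
    match up x with
    | .const _ => ∅
    | .shift y d => {ψ | ∃ k : ℕ, (k : ℤ) = c - d ∧ ψ = .upper y s k}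
  | .lower c s x =>
    match up x with
    | .const _ => ∅
    | .shift y d => {ψ | ∃ k : ℕ, (k : ℤ) = c - d ∧ ψ = .lower k s y}
  | .diag x y s c =>
    match up x, up y with
    | .const _, .const _ => ∅
    | .shift z d, .const e => {ψ | ∃ k : ℕ, (k : ℤ) = c + e - d ∧ ψ = .upper z s k}
    | .const e, .shift z d => {ψ | ∃ k : ℕ, (k : ℤ) = e - d - c ∧ ψ = .lower k s z}
    | .shift z₁ d₁, .shift z₂ d₂ => {ψ | z₁ ≠ z₂ ∧ ψ = .diag z₁ z₂ s (c - d₁ + d₂)}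

/-- `wp(⊑_G, up)` for a set `G` of constraints. -/
def wpSet (up : Update X) (G : Set (Constraint X)) : Set (Constraint X) := ⋃ φ ∈ G, wp up φ

/-- The constraints `x ≥ 0`, for all clocks `x`. -/
def nonnegConstraints (X : Type*) : Set (Constraint X) := Set.range (Constraint.lower 0 Cmp.le)

/-- The right-hand side of the state-based guard equations: the union, over the transitions
`(q, g, up, q₁)` from `q`, of the atomic constraints of `g`, of `wp(⊑_{x ≥ 0 | x ∈ X}, up)` and of
`wp(⊑_{G(q₁)}, up)`. -/
def Automaton.guardEqn (A : Automaton Q X) (G : Q → Set (Constraint X)) (q : Q) :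
    Set (Constraint X) :=
  ⋃ t ∈ {t | t ∈ A.trans ∧ t.src = q},
    ({φ | φ ∈ t.guard} ∪ wpSet t.update (nonnegConstraints X)) ∪ wpSet t.update (G t.tgt)

theorem wpSet_mono (up : Update X) {G G' : Set (Constraint X)} (h : G ⊆ G') :
    wpSet up G ⊆ wpSet up G' :=
  Set.biUnion_subset_biUnion_left h

theorem Automaton.guardEqn_monotone (A : Automaton Q X) : Monotone A.guardEqn := fun _ _ h _ =>
  Set.iUnion₂_mono fun t _ => Set.union_subset_union_right _ (wpSet_mono t.update (h t.tgt))

/-- The least solution `G(q)`, `q ∈ Q`, of the state-based guard equations, in the coordinatewise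
inclusion order. -/
def Automaton.stateGuards (A : Automaton Q X) : Q → Set (Constraint X) :=
  OrderHom.lfp (⟨A.guardEqn, A.guardEqn_monotone⟩ :
    (Q → Set (Constraint X)) →o (Q → Set (Constraint X)))

theorem Automaton.isLeast_stateGuards (A : Automaton Q X) :
    IsLeast {G : Q → Set (Constraint X) | ∀ q, G q = A.guardEqn G q} A.stateGuards := by
  have h := OrderHom.isLeast_lfp (⟨A.guardEqn, A.guardEqn_monotone⟩ :
    (Q → Set (Constraint X)) →o (Q → Set (Constraint X)))
  exact ⟨fun q => (congrFun h.1 q).symm, fun G hG => h.2 (funext fun q => (hG q).symm)⟩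

/-- The least solution of the state-based guard equations is finite. -/
def Automaton.FiniteGuards (A : Automaton Q X) : Prop := ∀ q, (A.stateGuards q).Finite

/-! ### The simulation -/

/-- `L_G(x)`: the largest `c` with a constraint `c ◁ x` in `G`, and `-∞` if there is none. It is
used for finite `G` only, where the supremum is the maximum. -/
noncomputable def lowerBd (G : Set (Constraint X)) (x : X) : EReal :=
  sSup {r | ∃ (c : ℕ) (s : Cmp), Constraint.lower c s x ∈ G ∧ r = ((c : ℝ) : EReal)}

/-- `U_G(x)`: the largest `c` with a constraint `x ◁ c` in `G`, and `-∞` if there is none. -/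
noncomputable def upperBd (G : Set (Constraint X)) (x : X) : EReal :=
  sSup {r | ∃ (c : ℕ) (s : Cmp), Constraint.upper x s c ∈ G ∧ r = ((c : ℝ) : EReal)}

/-- The relation `v ≼_LU v'` on valuations. -/
def LULe (L U : X → EReal) (v v' : Valuation X) : Prop :=
  ∀ x, (v' x < v x → L x < ((v' x : ℝ) : EReal)) ∧ (v x < v' x → U x < ((v x : ℝ) : EReal))

/-- The relation on valuations given by `G`: `v ≼_LU(G) v'`, and `v'` satisfies all the diagonal
constraints of `G` that `v` satisfies. -/
def GuardLULe (G : Set (Constraint X)) (v v' : Valuation X) : Prop :=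
  LULe (lowerBd G) (upperBd G) v v' ∧
    ∀ (x y : X) (s : Cmp) (d : ℤ), Constraint.diag x y s d ∈ G →
      (Constraint.diag x y s d).sat v → (Constraint.diag x y s d).sat v'

/-- The relation `(q, v) ≼^LU_A (q, v')` on configurations with the same state `q`. -/
def Automaton.SimLU (A : Automaton Q X) (q : Q) (v v' : Valuation X) : Prop :=
  GuardLULe (A.stateGuards q) v v'

/-- The extension of `≼^LU_A` to sets of valuations. -/
def Automaton.ZoneSimLU (A : Automaton Q X) (q : Q) (Z Z' : Set (Valuation X)) : Prop :=
  ∀ v ∈ Z, ∃ v' ∈ Z', A.SimLU q v v'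

/-! ### Zone graph enumeration -/

/-- Time elapse. -/
def elapse (Z : Set (Valuation X)) : Set (Valuation X) := {w | ∃ v ∈ Z, ∃ δ : ℝ≥0, w = delay v δ}

/-- The initial zone. -/
def initialZone (X : Type*) : Set (Valuation X) := elapse {fun _ => 0}

/-- The zone of the successor of a node under the transition `t`: intersect with the guard, apply
the update where it yields a valuation, let time elapse. -/
def Transition.post (t : Transition Q X) (Z : Set (Valuation X)) : Set (Valuation X) :=
  elapse {v' | ∃ v ∈ Z, t.Fires v v'}

/-- Nodes of the zone graph. Those generated below arise from the initial zone by successor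
operations. -/
abbrev Node (Q X : Type*) := Q × Set (Valuation X)

/-- Snapshots of the enumeration: either it is running, with its lists Passed and Waiting and with
the list of those (node, transition) pairs of the current round that remain to be treated, or it
has answered. -/
inductive Snapshot (Q X : Type*)
  | running (passed waiting : List (Node Q X)) (todo : List (Node Q X × Transition Q X))
  | answer (b : Bool)

/-- `ts` lists the transitions of `A` from `q`, each one once, in some order. -/
def Automaton.Outgoing (A : Automaton Q X) (q : Q) (ts : List (Transition Q X)) : Prop :=
  ts.Nodup ∧ ∀ t, t ∈ ts ↔ t ∈ A.trans ∧ t.src = q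

/-- One step of zone graph enumeration with pruning by `≼^LU_A`. The choice of the node that is
picked from Waiting and the order in which its transitions are treated are left open. -/
inductive Automaton.EnumStep (A : Automaton Q X) : Snapshot Q X → Snapshot Q X → Prop
  /-- Waiting is empty: there is no accepting run. -/
  | finish (P : List (Node Q X)) : A.EnumStep (.running P [] []) (.answer false)
  /-- Pick a node, move it from Waiting to Passed, and start treating its transitions. -/
  | pick (P W₁ W₂ : List (Node Q X)) (n : Node Q X) (ts : List (Transition Q X))
      (hts : A.Outgoing n.1 ts) :
      A.EnumStep (.running P (W₁ ++ n :: W₂) [])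
        (.running (n :: P) (W₁ ++ W₂) (ts.map fun t => (n, t)))
  /-- The successor has an empty zone. -/
  | dead (P W : List (Node Q X)) (n : Node Q X) (t : Transition Q X)
      (rest : List (Node Q X × Transition Q X)) (hZ : t.post n.2 = ∅) :
      A.EnumStep (.running P W ((n, t) :: rest)) (.running P W rest)
  /-- The successor is accepting: there is an accepting run. -/
  | accept (P W : List (Node Q X)) (n : Node Q X) (t : Transition Q X)
      (rest : List (Node Q X × Transition Q X)) (hZ : t.post n.2 ≠ ∅)
      (hacc : t.tgt ∈ A.accepting) :
      A.EnumStep (.running P W ((n, t) :: rest)) (.answer true)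
  /-- The successor is simulated by a node in Passed or Waiting: ignore it. -/
  | prune (P W : List (Node Q X)) (n : Node Q X) (t : Transition Q X)
      (rest : List (Node Q X × Transition Q X)) (hZ : t.post n.2 ≠ ∅)
      (hacc : t.tgt ∉ A.accepting)
      (hcov : ∃ Z', ((t.tgt, Z') ∈ P ∨ (t.tgt, Z') ∈ W) ∧ A.ZoneSimLU t.tgt (t.post n.2) Z') :
      A.EnumStep (.running P W ((n, t) :: rest)) (.running P W rest)
  /-- Otherwise add the successor to Waiting. -/
  | add (P W : List (Node Q X)) (n : Node Q X) (t : Transition Q X)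
      (rest : List (Node Q X × Transition Q X)) (hZ : t.post n.2 ≠ ∅)
      (hacc : t.tgt ∉ A.accepting)
      (hcov : ¬ ∃ Z', ((t.tgt, Z') ∈ P ∨ (t.tgt, Z') ∈ W) ∧ A.ZoneSimLU t.tgt (t.post n.2) Z') :
      A.EnumStep (.running P W ((n, t) :: rest))
        (.running P ((t.tgt, t.post n.2) :: W) rest)

open Classical in
/-- The start of the enumeration. If the initial state is accepting, the answer is immediate. -/
noncomputable def Automaton.enumStart (A : Automaton Q X) : Snapshot Q X :=
  if A.init ∈ A.accepting then .answer true else .running [] [(A.init, initialZone X)] []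

/-- The snapshot `c` occurs in some execution of zone graph enumeration on `A`. -/
def Automaton.EnumReaches (A : Automaton Q X) (c : Snapshot Q X) : Prop :=
  Relation.ReflTransGen A.EnumStep A.enumStart c

/-- If an execution answers that there is an accepting run, there is one. -/
def Automaton.EnumSound (A : Automaton Q X) : Prop :=
  A.EnumReaches (.answer true) → A.HasAcceptingRun

/-- If there is an accepting run, no execution answers that there is none. -/
def Automaton.EnumComplete (A : Automaton Q X) : Prop :=
  A.HasAcceptingRun → ¬ A.EnumReaches (.answer false)

/-- Every execution comes to an end, and it does so only with an answer. -/
def Automaton.EnumTerminates (A : Automaton Q X) : Prop :=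
  (¬ ∃ s : ℕ → Snapshot Q X, s 0 = A.enumStart ∧ ∀ i, A.EnumStep (s i) (s (i + 1))) ∧
    ∀ c, A.EnumReaches c → (∃ b, c = .answer b) ∨ ∃ c', A.EnumStep c c'

/-! ### Automata as inputs of algorithms -/

def Cmp.code : Cmp → Bool
  | .lt => true
  | .le => false

/-- An integer as the pair of its positive and negative parts. -/
def intCode (d : ℤ) : ℕ × ℕ := (d.toNat, (-d).toNat)

abbrev ConstraintCode := (ℕ × Bool × ℕ) ⊕ (ℕ × Bool × ℕ) ⊕ (ℕ × ℕ × Bool × (ℕ × ℕ))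

def Constraint.code {m : ℕ} : Constraint (Fin m) → ConstraintCode
  | .upper x s c => .inl (x, s.code, c)
  | .lower c s x => .inr (.inl (c, s.code, x))
  | .diag x y s d => .inr (.inr (x, y, s.code, intCode d))

abbrev AtomicUpdateCode := ℕ ⊕ (ℕ × (ℕ × ℕ))

def AtomicUpdate.code {m : ℕ} : AtomicUpdate (Fin m) → AtomicUpdateCode
  | .const c => .inl c
  | .shift y d => .inr (y, intCode d)

abbrev TransitionCode := ℕ × List ConstraintCode × List AtomicUpdateCode × ℕ

def Transition.code {n m : ℕ} (t : Transition (Fin n) (Fin m)) : TransitionCode :=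
  (t.src, t.guard.map Constraint.code, List.ofFn fun x => (t.update x).code, t.tgt)

/-- Codes of automata: the numbers of states and of clocks, the initial state, the list of
transitions, the list of accepting states. -/
abbrev AutomatonCode := ℕ × ℕ × ℕ × List TransitionCode × List ℕ

def Automaton.code {n m : ℕ} (A : Automaton (Fin n) (Fin m)) : AutomatonCode :=
  (n, m, A.init, A.trans.map Transition.code, A.accepting.map fun q => (q : ℕ))

end UTA

/-! Three ideas carry the theorem: a simulation argument, a finite abstraction by colours, and
decision by certificates.

The relation `≼^LU` is a simulation because the guard equations are closed under weakest
preconditions. Finiteness of the guard sets turns the suprema in the LU condition into a condition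
on each constraint (`guardLULe_iff`). That condition survives delays, and it survives an action
because it holds for all weakest preconditions of the target's guards (`simLU_fires`). Hence a node
simulated by a listed node can be dropped, which gives completeness. Soundness is an invariant:
zones contain only configurations that are reachable up to a delay.

For termination, let `M` bound the constants of all guards. The colour of a valuation records its
difference constraints with constants up to `M`, so there are finitely many colours. A valuation of
the same colour can be moved inside its region to one that simulates the given one
(`ColorEq.exists_transfers`). Zones of the enumeration are unions of regions, so a zone is simulated
by every region-closed zone that shows the same colours. Each node that is added therefore brings a
new pair of a state and a set of colours.

Finiteness of the guards is decided by certificates on both sides. A finite list closed under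
generation shows finiteness. If there are infinitely many guards, König's lemma gives an infinite
chain without repetitions, on which two constraints differ only by a shift of the constant in an
admissible direction. Conversely, such a shift can be pumped.

The last part does not execute the enumeration. Its answer is determined by the existence of an
accepting run, so it suffices to decide that. An accepting run has a region-equivalent copy on
rational grids whose denominator doubles at each step. The absence of one is certified by a finite
set of grid configurations that represents the successors of its members up to colour. A search
through all numbers for either kind of certificate is computable. -/

namespace UTA
variable {Q X : Type*}

/-! ### Region equivalence -/

/-- Two real vectors satisfy the same integral difference constraints. -/
def RegEq {ι : Type*} (v w : ι → ℝ) : Prop := ∀ i j (d : ℤ), v i - v j < d ↔ w i - w j < d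

namespace RegEq

variable {ι : Type*} {v w : ι → ℝ}

theorem refl (v : ι → ℝ) : RegEq v v := fun _ _ _ => Iff.rfl

theorem symm (h : RegEq v w) : RegEq w v := fun i j d => (h i j d).symm

theorem le_iff (h : RegEq v w) (i j : ι) (d : ℤ) : v i - v j ≤ d ↔ w i - w j ≤ d := by
  have := h j i (-d)
  push_cast at this
  constructor <;> intro h1 <;> by_contra h2
  · have := this.2 (by linarith); linarith
  · have := this.1 (by linarith); linarith

theorem holds_iff (h : RegEq v w) (s : Cmp) (i j : ι) (d : ℤ) :
    s.holds (v i - v j) d ↔ s.holds (w i - w j) d := by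
  cases s
  · exact h i j d
  · exact h.le_iff i j d

theorem eq_iff (h : RegEq v w) (i j : ι) (d : ℤ) : v i - v j = d ↔ w i - w j = d := by
  rw [le_antisymm_iff, le_antisymm_iff, h.le_iff, and_congr_right_iff]
  exact fun _ => not_lt.symm.trans ((not_congr (h i j d)).trans not_lt)

/-- A region equivalence extends to one more coordinate; the new coordinate can be taken half-way
between two points of the grid that contains the old ones. -/
theorem exists_extend_one [Finite ι] [Nonempty ι] (h : RegEq v w) (r : ℝ) :
    ∃ r' : ℝ, (∀ i (d : ℤ), r - v i < d ↔ r' - w i < d) ∧ (∀ i (d : ℤ), v i - r < d ↔ w i - r' < d) ∧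
      ∀ K : AddSubgroup ℝ, (∀ i, w i ∈ K) → (1 : ℝ) ∈ K → 2 * r' ∈ K := by
  have hint : ∀ (K : AddSubgroup ℝ), (1 : ℝ) ∈ K → ∀ d : ℤ, (d : ℝ) ∈ K := fun K hK d => by
    simpa using K.zsmul_mem hK d
  by_cases hr : ∃ i, ∃ d : ℤ, r = v i + d
  -- An integral distance from an old coordinate must be preserved, so the new coordinate is forced.
  · obtain ⟨i, d, rfl⟩ := hr
    refine ⟨w i + d, fun j e => ?_, fun j e => ?_, fun K hw h1 => ?_⟩
    · have := h i j (e - d)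
      push_cast at this
      constructor <;> intro h1
      · linarith [this.1 (by linarith)]
      · linarith [this.2 (by linarith)]
    · have := h j i (e + d)
      push_cast at this
      constructor <;> intro h1
      · linarith [this.1 (by linarith)]
      · linarith [this.2 (by linarith)]
    · have := K.add_mem (hw i) (hint K h1 d)
      rw [two_mul]
      exact K.add_mem this this
  · push Not at hr
    -- Shifting each old coordinate by the integer `f i` puts it in the open window of length one
    -- below `r`. The shifted `w i` then differ pairwise by less than one, so there is room for `r'`
    -- above the largest and below the smallest plus one; it is the midpoint of that gap.
    set f : ι → ℤ := fun i => ⌊r - v i⌋ with hf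
    have h1 : ∀ i, v i + f i < r := fun i =>
      lt_of_le_of_ne (by linarith [Int.floor_le (r - v i)]) (hr i (f i)).symm
    have h2 : ∀ i, r < v i + f i + 1 := fun i => by linarith [Int.lt_floor_add_one (r - v i)]
    have h3 : ∀ i j, w i + f i < w j + f j + 1 := fun i j => by
      have := (h i j (f j + 1 - f i)).1 (by push_cast; linarith [h1 i, h2 j])
      push_cast at this
      linarith
    obtain ⟨a, ha⟩ := Finite.exists_max fun i => w i + f i
    obtain ⟨b, hb⟩ := Finite.exists_min fun i => w i + f i
    set r' := ((w a + f a) + (w b + f b + 1)) / 2 with hr'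
    have h4 : ∀ i, w i + f i < r' := fun i => by linarith [ha i, h3 a b]
    have h5 : ∀ i, r' < w i + f i + 1 := fun i => by linarith [hb i, h3 a b]
    -- Comparisons of a non-integral number with integers depend only on its floor.
    have key : ∀ {x : ℝ} {n d : ℤ}, (n : ℝ) < x → x < n + 1 → (x < d ↔ n < d) := by
      intro x n d hx hx'
      constructor
      · intro h; exact_mod_cast hx.trans h
      · intro h
        have : ((n + 1 : ℤ) : ℝ) ≤ d := by exact_mod_cast h
        push_cast at this
        linarith
    refine ⟨r', fun i d => ?_, fun i d => ?_, fun K hw hK => ?_⟩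
    · rw [key (n := f i) (by linarith [h1 i]) (by linarith [h2 i]),
        key (n := f i) (by linarith [h4 i]) (by linarith [h5 i])]
    · rw [key (n := -f i - 1) (by push_cast; linarith [h2 i]) (by push_cast; linarith [h1 i]),
        key (n := -f i - 1) (by push_cast; linarith [h5 i]) (by push_cast; linarith [h4 i])]
    · have : 2 * r' = (w a + f a) + ((w b + f b) + 1) := by rw [hr']; ring
      rw [this]
      exact K.add_mem (K.add_mem (hw a) (hint K hK _))
        (K.add_mem (K.add_mem (hw b) (hint K hK _)) hK)

/-- Induction on the finite type of new coordinates, placing one at a time relative to those already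
placed. -/
theorem exists_extend [Finite ι] [Nonempty ι] (h : RegEq v w) (κ : Type*) [Finite κ] (u : κ → ℝ) :
    ∃ u' : κ → ℝ, RegEq (Sum.elim v u) (Sum.elim w u') := by
  revert u
  induction κ using Finite.induction_empty_option with
  | @of_equiv α β e ih =>
    intro u
    obtain ⟨u', hu'⟩ := ih (u ∘ e)
    refine ⟨u' ∘ e.symm, fun i j d => ?_⟩
    have := hu' (Sum.map id e.symm i) (Sum.map id e.symm j) d
    rcases i with i | i <;> rcases j with j | j <;> simpa using this
  | h_empty =>
    intro u
    refine ⟨PEmpty.elim, fun i j d => ?_⟩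
    rcases i with i | i
    · rcases j with j | j
      · exact h i j d
      · exact j.elim
    · exact i.elim
  | @h_option α _ ih =>
    intro u
    obtain ⟨u', hu'⟩ := ih (u ∘ some)
    obtain ⟨r', h1, h2, -⟩ := hu'.exists_extend_one (u none)
    refine ⟨fun o => o.elim r' u', fun i j d => ?_⟩
    rcases i with i | _ | i <;> rcases j with j | _ | j
    · exact h i j d
    · exact h2 (.inl i) d
    · exact hu' (.inl i) (.inr j) d
    · exact h1 (.inl j) d
    · simp
    · exact h1 (.inr j) d
    · exact hu' (.inr i) (.inl j) d
    · exact h2 (.inr i) d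
    · exact hu' (.inr i) (.inr j) d

end RegEq

/-! ### Valuations as points with a reference coordinate -/

/-- A valuation with an additional clock `none` whose value is `0`. -/
def point (v : Valuation X) : Option X → ℝ
  | none => 0
  | some x => v x

@[simp] theorem point_none (v : Valuation X) : point v none = 0 := rfl
@[simp] theorem point_some (v : Valuation X) (x : X) : point v (some x) = v x := rfl

theorem exists_valuation_coe {f : X → ℝ} (hf : ∀ x, 0 ≤ f x) :
    ∃ v : Valuation X, ∀ x, (v x : ℝ) = f x :=
  ⟨fun x => ⟨f x, hf x⟩, fun _ => rfl⟩

theorem point_nonneg (v : Valuation X) (i : Option X) : 0 ≤ point v i := by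
  cases i <;> simp

/-- Difference constraints `i - j ◁ d`; `none` stands for `0`. -/
abbrev Diff (X : Type*) := Option X × Option X × Cmp × ℤ

/-- A constraint as a difference constraint. -/
def Constraint.diff : Constraint X → Diff X
  | .upper x s c => (some x, none, s, c)
  | .lower c s x => (none, some x, s, -c)
  | .diag x y s d => (some x, some y, s, d)

theorem Constraint.sat_iff (φ : Constraint X) (v : Valuation X) :
    φ.sat v ↔ φ.diff.2.2.1.holds (point v φ.diff.1 - point v φ.diff.2.1) φ.diff.2.2.2 := by
  rcases φ with ⟨x, s, c⟩ | ⟨c, s, x⟩ | ⟨x, y, s, d⟩ <;> cases s <;>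
    simp [sat, diff, Cmp.holds]

theorem RegEq.sat_iff {v w : Valuation X} (h : RegEq (point v) (point w)) (φ : Constraint X) :
    φ.sat v ↔ φ.sat w := by
  rw [φ.sat_iff, φ.sat_iff]
  exact h.holds_iff _ _ _ _

/-- The clock, or `none`, and the increment of an atomic update. -/
def AtomicUpdate.source : AtomicUpdate X → Option X × ℤ
  | .const c => (none, c)
  | .shift y d => (some y, d)

/-- The source of each clock, with `none` kept fixed. -/
def updateSource (up : Update X) : Option X → Option X × ℤ
  | none => (none, 0)
  | some x => (up x).source

theorem AtomicUpdate.eval_eq (a : AtomicUpdate X) (v : Valuation X) :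
    a.eval v = point v a.source.1 + a.source.2 := by
  cases a <;> simp [eval, source]

theorem Transition.Fires.point_eq {t : Transition Q X} {v v' : Valuation X} (h : t.Fires v v')
    (i : Option X) :
    point v' i = point v (updateSource t.update i).1 + (updateSource t.update i).2 := by
  cases i with
  | none => simp [updateSource]
  | some x => rw [point_some, h.2.2 x, applyUpdate, AtomicUpdate.eval_eq]; rfl

/-- An update replaces every difference by a difference of old coordinates plus an integer, with
`none` standing for the constant 0. Such comparisons are exactly what region equivalence preserves,
and non-negativity of the result is one of them. -/
theorem RegEq.fires {t : Transition Q X} {v w v' : Valuation X} (h : RegEq (point v) (point w))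
    (hf : t.Fires v v') : ∃ w', t.Fires w w' ∧ RegEq (point v') (point w') := by
  have hn : ∀ x, 0 ≤ applyUpdate t.update w x := fun x => by
    have h1 := hf.2.1 x
    rw [applyUpdate, AtomicUpdate.eval_eq] at h1 ⊢
    have h2 := (h.le_iff none (t.update x).source.1 (t.update x).source.2).1
      (by simp only [point_none]; linarith)
    simp only [point_none] at h2
    linarith
  have hw : t.Fires w fun x => ⟨_, hn x⟩ :=
    ⟨fun φ hφ => (h.sat_iff φ).1 (hf.1 φ hφ), hn, fun x => rfl⟩
  refine ⟨_, hw, fun i j d => ?_⟩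
  rw [hf.point_eq, hf.point_eq, hw.point_eq, hw.point_eq]
  have := h (updateSource t.update i).1 (updateSource t.update j).1
    (d - (updateSource t.update i).2 + (updateSource t.update j).2)
  push_cast at this
  constructor <;> intro h'
  · linarith [this.1 (by linarith)]
  · linarith [this.2 (by linarith)]

@[simp] theorem delay_apply (v : Valuation X) (δ : ℝ≥0) (x : X) : delay v δ x = v x + δ := rfl

theorem delay_delay (v : Valuation X) (δ ε : ℝ≥0) : delay (delay v δ) ε = delay v (δ + ε) := by
  funext x; simp [add_assoc]

@[simp] theorem delay_zero (v : Valuation X) : delay v 0 = v := by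
  funext x; simp

/-- Region equivalent valuations have region equivalent delays. -/
theorem RegEq.delay [Finite X] {v w : Valuation X} (h : RegEq (point v) (point w)) (δ : ℝ≥0) :
    ∃ δ' : ℝ≥0, RegEq (point (delay v δ)) (point (delay w δ')) ∧
      (∀ n : ℕ, (δ : ℝ) ≤ n → (δ' : ℝ) ≤ n) ∧
      ∀ K : AddSubgroup ℝ, (∀ x, (w x : ℝ) ∈ K) → (1 : ℝ) ∈ K → 2 * (δ' : ℝ) ∈ K := by
  -- Delaying by `δ` has the same effect on differences as moving the reference point from 0 to
  -- `-δ`, so the delay is found as one more coordinate.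
  obtain ⟨r, h1, h2, h3⟩ := h.exists_extend_one (-(δ : ℝ))
  have hr : 0 ≤ -r := by
    have := (h2 none 0)
    simp only [point_none, Int.cast_zero] at this
    by_contra hc
    have := this.2 (by linarith)
    linarith [δ.2]
  obtain ⟨ρ, hρ⟩ : ∃ ρ : ℝ≥0, (ρ : ℝ) = -r := ⟨⟨-r, hr⟩, rfl⟩
  obtain rfl : r = -(ρ : ℝ) := by linarith
  refine ⟨ρ, fun i j d => ?_, fun n hn => ?_, fun K hw hK => ?_⟩
  · rcases i with _ | i <;> rcases j with _ | j
    · simp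
    · have := h1 (some j) d
      simp only [point_some] at this
      simp only [point_some, point_none, delay_apply, NNReal.coe_add]
      convert this using 2 <;> ring
    · have := h2 (some i) d
      simp only [point_some] at this
      simp only [point_some, point_none, delay_apply, NNReal.coe_add]
      convert this using 2 <;> ring
    · have := h (some i) (some j) d
      simpa using this
  · have := h1 none (-n)
    simp only [point_none] at this
    push_cast at this
    by_contra hc
    simp only [not_le] at hc
    linarith [this.2 (by linarith)]
  · have := h3 K (fun i => by cases i with
      | none => exact K.zero_mem
      | some x => exact hw x) hK
    simpa using K.neg_mem this

/-- The region equivalence can be traced back through a delay. -/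
theorem RegEq.undelay [Finite X] {v w : Valuation X} {δ : ℝ≥0}
    (h : RegEq (point (UTA.delay v δ)) (point w)) :
    ∃ w' : Valuation X, ∃ δ' : ℝ≥0, w = UTA.delay w' δ' ∧ RegEq (point v) (point w') := by
  -- Now the old reference point is the new coordinate: seen from the delayed valuation, it lies at
  -- `δ`.
  obtain ⟨r, h1, h2, -⟩ := h.exists_extend_one (δ : ℝ)
  have hr : 0 ≤ r := by
    have := h1 none 0
    simp only [point_none, Int.cast_zero, sub_zero] at this
    by_contra hc
    have := this.2 (by linarith)
    linarith [δ.2]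
  have hx : ∀ x, 0 ≤ (w x : ℝ) - r := fun x => by
    have := h2 (some x) 0
    simp only [point_some, Int.cast_zero, delay_apply, NNReal.coe_add] at this
    by_contra hc
    have := this.2 (by linarith)
    linarith [(v x).2]
  obtain ⟨ρ, rfl⟩ : ∃ ρ : ℝ≥0, (ρ : ℝ) = r := ⟨⟨r, hr⟩, rfl⟩
  obtain ⟨w', hw'⟩ := exists_valuation_coe hx
  refine ⟨w', ρ, ?_, fun i j d => ?_⟩
  · funext x
    apply NNReal.coe_injective
    simp [hw']
  · rcases i with _ | i <;> rcases j with _ | j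
    · simp
    · have := h1 (some j) d
      simp only [point_some, delay_apply, NNReal.coe_add] at this
      simp only [point_some, point_none, hw']
      convert this using 2 <;> ring
    · have := h2 (some i) d
      simp only [point_some, delay_apply, NNReal.coe_add] at this
      simp only [point_some, point_none, hw']
      convert this using 2 <;> ring
    · have := h (some i) (some j) d
      simpa [hw'] using this

/-- Extension of a region equivalence by a valuation. -/
theorem RegEq.exists_valuation {ι : Type*} [Finite X] [Finite ι] {p p' : ι → ℝ} (h : RegEq p p')
    (o : ι) (ho : p o = 0) (ho' : p' o = 0) (v : Valuation X) :
    ∃ w : Valuation X, RegEq (point v) (point w) ∧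
      ∀ (i : ι) (x : X) (d : ℤ), p i - v x = d ↔ p' i - w x = d := by
  have : Nonempty ι := ⟨o⟩
  obtain ⟨u, hu⟩ := h.exists_extend X fun x => (v x : ℝ)
  have hx : ∀ x, 0 ≤ u x := fun x => by
    have := (hu.le_iff (.inl o) (.inr x) 0).1 (by simp [ho])
    simpa [ho'] using this
  obtain ⟨w, hw⟩ := exists_valuation_coe hx
  refine ⟨w, fun i j d => ?_, fun i x d => hw x ▸ hu.eq_iff (.inl i) (.inr x) d⟩
  have := hu (i.elim (.inl o) .inr) (j.elim (.inl o) .inr) d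
  rcases i with _ | i <;> rcases j with _ | j <;> simp_all

/-- The region equivalence can be traced back through a transition. -/
theorem RegEq.unfire [Finite X] {t : Transition Q X} {v v' w' : Valuation X} (hf : t.Fires v v')
    (h : RegEq (point v') (point w')) : ∃ w, t.Fires w w' ∧ RegEq (point v) (point w) := by
  -- The predecessor `v` is adjoined to `v'`, so that the equations `v' x = v y + d` of the update
  -- are integral equalities between coordinates and carry over to `w'` and `w`.
  obtain ⟨w, hw, he⟩ := h.exists_valuation none rfl rfl v
  have hu : ∀ x, (w' x : ℝ) = applyUpdate t.update w x := fun x => by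
    have h1 := hf.2.2 x
    rw [applyUpdate, AtomicUpdate.eval_eq] at h1 ⊢
    rcases ho : (t.update x).source with ⟨_ | y, d⟩ <;> rw [ho] at h1
    · have := (h.eq_iff (some x) none d).1 (by simp only [point_some, point_none] at h1 ⊢; linarith)
      simp only [point_some, point_none] at this ⊢
      linarith
    · have := (he (some x) y d).1 (by simp only [point_some] at h1 ⊢; linarith)
      simp only [point_some] at this ⊢
      linarith
  exact ⟨w, ⟨fun φ hφ => (hw.sat_iff φ).1 (hf.1 φ hφ), fun x => hu x ▸ (w' x).2, hu⟩, hw⟩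

/-! ### Zones as unions of regions -/

/-- Sets of valuations that are closed under region equivalence. -/
def RegClosed (Z : Set (Valuation X)) : Prop :=
  ∀ v ∈ Z, ∀ w, RegEq (point v) (point w) → w ∈ Z

theorem RegClosed.elapse [Finite X] {Z : Set (Valuation X)} (h : RegClosed Z) :
    RegClosed (elapse Z) := by
  rintro _ ⟨v, hv, δ, rfl⟩ w hw
  obtain ⟨w', δ', rfl, h'⟩ := hw.undelay
  exact ⟨w', h v hv w' h', δ', rfl⟩

theorem RegClosed.post [Finite X] (t : Transition Q X) {Z : Set (Valuation X)}
    (h : RegClosed Z) : RegClosed (t.post Z) := by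
  refine RegClosed.elapse ?_
  rintro v' ⟨v, hv, hf⟩ w' hw'
  obtain ⟨w, hw, h'⟩ := RegEq.unfire hf hw'
  exact ⟨w, h v hv w h', hw⟩

theorem regClosed_singleton_zero : RegClosed ({fun _ => 0} : Set (Valuation X)) := by
  rintro _ rfl w hw
  funext x
  have := (hw.eq_iff (some x) none 0).1 (by simp)
  simpa using this

theorem regClosed_initialZone [Finite X] : RegClosed (initialZone X) :=
  regClosed_singleton_zero.elapse

/-! ### Acceptance within a number of steps -/

/-- An accepting state is reached from `(q, v)` by `k` delays and actions. -/
def Automaton.AccIn (A : Automaton Q X) : ℕ → Q → Valuation X → Prop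
  | 0, q, _ => q ∈ A.accepting
  | k + 1, q, v => ∃ δ, ∃ t ∈ A.trans, t.src = q ∧ ∃ v', t.Fires (delay v δ) v' ∧ A.AccIn k t.tgt v'

theorem Automaton.exists_accIn_iff (A : Automaton Q X) (p : Q × Valuation X) :
    (∃ k, A.AccIn k p.1 p.2) ↔ ∃ p', Relation.ReflTransGen A.DelayAction p p' ∧ p'.1 ∈ A.accepting := by
  constructor
  · rintro ⟨k, hk⟩
    induction k generalizing p with
    | zero => exact ⟨p, .refl, hk⟩
    | succ k ih =>
      obtain ⟨δ, t, ht, hs, v', hf, ha⟩ := hk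
      obtain ⟨p', hp', hacc⟩ := ih (t.tgt, v') ha
      exact ⟨p', .head ⟨δ, t, ht, hs, rfl, hf⟩ hp', hacc⟩
  · rintro ⟨p', hp, hacc⟩
    induction hp using Relation.ReflTransGen.head_induction_on with
    | refl => exact ⟨0, hacc⟩
    | head h _ ih =>
      obtain ⟨δ, t, ht, hs, htgt, hf⟩ := h
      obtain ⟨k, hk⟩ := ih
      exact ⟨k + 1, δ, t, ht, hs, _, hf, htgt ▸ hk⟩

theorem Automaton.hasAcceptingRun_iff (A : Automaton Q X) :
    A.HasAcceptingRun ↔ ∃ k, A.AccIn k A.init fun _ => 0 :=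
  (A.exists_accIn_iff (A.init, fun _ => 0)).symm

/-- Region equivalence is a time-abstract bisimulation: each delay is matched by a possibly
different delay, each action by the same action. -/
theorem Automaton.AccIn.regEq [Finite X] {A : Automaton Q X} {k : ℕ} {q : Q} {v w : Valuation X}
    (h : A.AccIn k q v) (hvw : RegEq (point v) (point w)) : A.AccIn k q w := by
  induction k generalizing q v w with
  | zero => exact h
  | succ k ih =>
    obtain ⟨δ, t, ht, hs, v', hf, ha⟩ := h
    obtain ⟨δ', hδ, -⟩ := hvw.delay δ
    obtain ⟨w', hw', he⟩ := hδ.fires hf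
    exact ⟨δ', t, ht, hs, w', hw', ih ha he⟩

end UTA

namespace UTA
variable {Q X : Type*}

/-! ### Weakest preconditions of difference constraints -/

/-- Substitution of an update into a difference constraint. -/
def substDiff (up : Update X) (e : Diff X) : Diff X :=
  ((updateSource up e.1).1, (updateSource up e.2.1).1, e.2.2.1,
    e.2.2.2 - (updateSource up e.1).2 + (updateSource up e.2.1).2)

/-- One description replaces all cases of `wp`: substitution on differences with `none` for 0. The
sign conditions of `wp` are hidden in the existence of `ψ`, as a non-diagonal constraint has a
natural constant. -/
theorem mem_wp_iff (up : Update X) (φ ψ : Constraint X) :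
    ψ ∈ wp up φ ↔ ψ.diff = substDiff up φ.diff ∧ ψ.diff.1 ≠ ψ.diff.2.1 := by
  rcases φ with ⟨x, s, c⟩ | ⟨c, s, x⟩ | ⟨x, y, s, d⟩
  · rcases hx : up x with e | ⟨z, e⟩ <;>
      simp only [wp, hx, Constraint.diff, substDiff, updateSource, AtomicUpdate.source] <;>
      rcases ψ with ⟨x', s', c'⟩ | ⟨c', s', x'⟩ | ⟨x', y', s', d'⟩ <;> simp
    grind
  · rcases hx : up x with e | ⟨z, e⟩ <;>
      simp only [wp, hx, Constraint.diff, substDiff, updateSource, AtomicUpdate.source] <;>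
      rcases ψ with ⟨x', s', c'⟩ | ⟨c', s', x'⟩ | ⟨x', y', s', d'⟩ <;> simp
    grind
  · rcases hx : up x with e | ⟨z, e⟩ <;> rcases hy : up y with e' | ⟨z', e'⟩ <;>
      simp only [wp, hx, hy, Constraint.diff, substDiff, updateSource, AtomicUpdate.source] <;>
      rcases ψ with ⟨x', s', c'⟩ | ⟨c', s', x'⟩ | ⟨x', y', s', d'⟩ <;> simp
    · grind
    · grind
    · grind

/-- Difference constraints on two different clocks, or on a clock and a non-negative constant. -/
def Diff.Proper (e : Diff X) : Prop :=
  e.1 ≠ e.2.1 ∧ (e.2.1 = none → 0 ≤ e.2.2.2) ∧ (e.1 = none → e.2.2.2 ≤ 0)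

theorem Constraint.diff_injective : Function.Injective (Constraint.diff (X := X)) := by
  rintro (_ | _ | _) (_ | _ | _) <;> simp [diff]
  all_goals grind

theorem Diff.proper_iff (e : Diff X) :
    e.Proper ↔ e.1 ≠ e.2.1 ∧ ∃ φ : Constraint X, φ.diff = e := by
  constructor
  · rintro ⟨h, h1, h2⟩
    refine ⟨h, ?_⟩
    obtain ⟨_ | x, _ | y, s, d⟩ := e
    · exact absurd rfl h
    · exact ⟨.lower (-d).toNat s y, by have := h2 rfl; simp [Constraint.diff] at *; omega⟩
    · exact ⟨.upper x s d.toNat, by have := h1 rfl; simp [Constraint.diff] at *; omega⟩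
    · exact ⟨.diag x y s d, rfl⟩
  · rintro ⟨h, φ, rfl⟩
    refine ⟨h, ?_⟩
    rcases φ with _ | _ | _ <;> simp [Constraint.diff]

/-! ### The simulation -/

/-- The condition that a single constraint contributes to the relation on valuations. -/
def Constraint.Transfers : Constraint X → Valuation X → Valuation X → Prop
  | .upper x _ c, v, w => v x < w x → (c : ℝ) < v x
  | .lower c _ x, v, w => w x < v x → (c : ℝ) < w x
  | .diag x y s d, v, w => (diag x y s d).sat v → (diag x y s d).sat w

/-- A finite non-empty set attains its supremum, and the supremum of the empty set is `⊥`, which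
lies below every real. An infinite set could have supremum exactly `r`; this is where finiteness of
the guards enters. -/
theorem sSup_coe_lt_iff {S : Set EReal} (hS : S.Finite) (r : ℝ) :
    sSup S < (r : EReal) ↔ ∀ a ∈ S, a < (r : EReal) := by
  rcases S.eq_empty_or_nonempty with rfl | hne
  · simp
  · exact hS.csSup_lt_iff hne

theorem lowerBd_lt_iff {G : Set (Constraint X)} (hG : G.Finite) (x : X) (r : ℝ) :
    lowerBd G x < (r : EReal) ↔ ∀ c s, Constraint.lower c s x ∈ G → (c : ℝ) < r := by
  have hfin : {r | ∃ (c : ℕ) (s : Cmp), Constraint.lower c s x ∈ G ∧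
      r = ((c : ℝ) : EReal)}.Finite := by
    refine (hG.image fun φ => ((-φ.diff.2.2.2 : ℝ) : EReal)).subset ?_
    rintro _ ⟨c, s, h, rfl⟩
    exact ⟨_, h, by simp [Constraint.diff]⟩
  rw [lowerBd, sSup_coe_lt_iff hfin]
  constructor
  · intro h c s hc
    exact EReal.coe_lt_coe_iff.1 (h _ ⟨c, s, hc, rfl⟩)
  · rintro h _ ⟨c, s, hc, rfl⟩
    exact EReal.coe_lt_coe_iff.2 (h c s hc)

theorem upperBd_lt_iff {G : Set (Constraint X)} (hG : G.Finite) (x : X) (r : ℝ) :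
    upperBd G x < (r : EReal) ↔ ∀ c s, Constraint.upper x s c ∈ G → (c : ℝ) < r := by
  have hfin : {r | ∃ (c : ℕ) (s : Cmp), Constraint.upper x s c ∈ G ∧
      r = ((c : ℝ) : EReal)}.Finite := by
    refine (hG.image fun φ => ((φ.diff.2.2.2 : ℝ) : EReal)).subset ?_
    rintro _ ⟨c, s, h, rfl⟩
    exact ⟨_, h, by simp [Constraint.diff]⟩
  rw [upperBd, sSup_coe_lt_iff hfin]
  constructor
  · intro h c s hc
    exact EReal.coe_lt_coe_iff.1 (h _ ⟨c, s, hc, rfl⟩)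
  · rintro h _ ⟨c, s, hc, rfl⟩
    exact EReal.coe_lt_coe_iff.2 (h c s hc)

theorem guardLULe_iff {G : Set (Constraint X)} (hG : G.Finite) (v w : Valuation X) :
    GuardLULe G v w ↔ ∀ φ ∈ G, φ.Transfers v w := by
  constructor
  · rintro ⟨h, hd⟩ φ hφ
    rcases φ with ⟨x, s, c⟩ | ⟨c, s, x⟩ | ⟨x, y, s, d⟩
    · exact fun hx => (upperBd_lt_iff hG x _).1 ((h x).2 hx) c s hφ
    · exact fun hx => (lowerBd_lt_iff hG x _).1 ((h x).1 hx) c s hφ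
    · exact hd x y s d hφ
  · intro h
    refine ⟨fun x => ⟨fun hx => ?_, fun hx => ?_⟩, fun x y s d hφ => h _ hφ⟩
    · exact (lowerBd_lt_iff hG x _).2 fun c s hc => h _ hc hx
    · exact (upperBd_lt_iff hG x _).2 fun c s hc => h _ hc hx

/-- For a non-diagonal constraint, a change of the clock in the harmless direction keeps it true. A
change in the other direction is allowed only beyond the constant: an upper bound was then already
violated by `v`, and a lower bound is still respected by `w`. -/
theorem Constraint.Transfers.sat {φ : Constraint X} {v w : Valuation X} (h : φ.Transfers v w)
    (hv : φ.sat v) : φ.sat w := by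
  rcases φ with ⟨x, s, c⟩ | ⟨c, s, x⟩ | ⟨x, y, s, d⟩
  · rcases le_or_gt (w x) (v x) with hx | hx
    · have : (w x : ℝ) ≤ v x := hx
      cases s <;> simp only [Constraint.sat, Cmp.holds] at hv ⊢ <;> linarith
    · have := h hx
      cases s <;> simp only [Constraint.sat, Cmp.holds] at hv ⊢ <;> linarith
  · rcases le_or_gt (v x) (w x) with hx | hx
    · have : (v x : ℝ) ≤ w x := hx
      cases s <;> simp only [Constraint.sat, Cmp.holds] at hv ⊢ <;> linarith
    · have := h hx
      cases s <;> simp only [Constraint.sat, Cmp.holds] at hv ⊢ <;> linarith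
  · exact h hv

/-- A common delay preserves differences and the order between `v x` and `w x`, and it only raises
the values that must exceed constants. -/
theorem Constraint.Transfers.delay {φ : Constraint X} {v w : Valuation X} (h : φ.Transfers v w)
    (δ : ℝ≥0) : φ.Transfers (delay v δ) (delay w δ) := by
  rcases φ with ⟨x, s, c⟩ | ⟨c, s, x⟩ | ⟨x, y, s, d⟩
  · intro hx
    have := h (by simpa using hx)
    simp only [delay_apply, NNReal.coe_add]
    linarith [δ.2]
  · intro hx
    have := h (by simpa using hx)
    simp only [delay_apply, NNReal.coe_add]
    linarith [δ.2]
  · intro hx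
    have := h
    simp only [Transfers, Constraint.sat, delay_apply, NNReal.coe_add, add_sub_add_right_eq_sub] at this hx ⊢
    exact this hx

/-- Non-strict satisfaction of proper weakest preconditions gives the constraint after the update. -/
theorem transfers_of_wp {up : Update X} {φ : Constraint X} {v w v' w' : Valuation X}
    (hv : ∀ x, (v' x : ℝ) = applyUpdate up v x) (hw : ∀ x, (w' x : ℝ) = applyUpdate up w x)
    (h : ∀ ψ ∈ wp up φ, ψ.Transfers v w) : φ.Transfers v' w' := by
  rcases φ with ⟨x, s, c⟩ | ⟨c, s, x⟩ | ⟨x, y, s, d⟩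
  · intro hx
    have hx : (v' x : ℝ) < w' x := hx
    rw [hv, hw] at hx
    rw [hv]
    rcases hu : up x with e | ⟨z, e⟩ <;> simp only [applyUpdate, AtomicUpdate.eval, hu] at hx ⊢
    · exact absurd hx (lt_irrefl _)
    -- `wp` drops the constraint when `c - e` is negative; the required bound then follows from the
    -- non-negativity of the clock.
    · rcases le_or_gt 0 ((c : ℤ) - e) with he | he
      · obtain ⟨k, hk⟩ := Int.eq_ofNat_of_zero_le he
        have := h (.upper z s k) (by simp only [wp, hu]; exact ⟨k, hk.symm, rfl⟩)
          (NNReal.coe_lt_coe.1 (by linarith))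
        have hk' : (c : ℝ) - e = k := by exact_mod_cast hk
        linarith
      · have : (c : ℝ) - e < 0 := by exact_mod_cast he
        linarith [(v z).2]
  · intro hx
    have hx : (w' x : ℝ) < v' x := hx
    rw [hv, hw] at hx
    rw [hw]
    rcases hu : up x with e | ⟨z, e⟩ <;> simp only [applyUpdate, AtomicUpdate.eval, hu] at hx ⊢
    · exact absurd hx (lt_irrefl _)
    · rcases le_or_gt 0 ((c : ℤ) - e) with he | he
      · obtain ⟨k, hk⟩ := Int.eq_ofNat_of_zero_le he
        have := h (.lower k s z) (by simp only [wp, hu]; exact ⟨k, hk.symm, rfl⟩)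
          (NNReal.coe_lt_coe.1 (by linarith))
        have hk' : (c : ℝ) - e = k := by exact_mod_cast hk
        linarith
      · have : (c : ℝ) - e < 0 := by exact_mod_cast he
        linarith [(w z).2]
  · simp only [Constraint.Transfers, Constraint.sat, hv, hw, applyUpdate]
    rcases hux : up x with e | ⟨z, e⟩ <;> rcases huy : up y with e' | ⟨z', e'⟩ <;>
      simp only [AtomicUpdate.eval]
    · exact id
    · intro hs
      rcases le_or_gt 0 ((e : ℤ) - e' - d) with he | he
      · obtain ⟨k, hk⟩ := Int.eq_ofNat_of_zero_le he
        have h1 := (h (.lower k s z') (by simp only [wp, hux, huy]; exact ⟨k, hk.symm, rfl⟩)).sat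
        have hk' : (e : ℝ) - e' - d = k := by exact_mod_cast hk
        cases s <;> simp only [Constraint.sat, Cmp.holds, ← hk'] at h1 hs ⊢ <;>
          linarith [h1 (by linarith)]
      · have : (e : ℝ) - e' - d < 0 := by exact_mod_cast he
        cases s <;> simp only [Cmp.holds] <;> linarith [(w z').2]
    · intro hs
      -- With a negative constant the substituted constraint is an upper bound that `v` cannot
      -- satisfy. In the mirrored case above it was a lower bound that `w` satisfies automatically.
      rcases le_or_gt 0 ((d : ℤ) + e' - e) with he | he
      · obtain ⟨k, hk⟩ := Int.eq_ofNat_of_zero_le he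
        have h1 := (h (.upper z s k) (by simp only [wp, hux, huy]; exact ⟨k, hk.symm, rfl⟩)).sat
        have hk' : (d : ℝ) + e' - e = k := by exact_mod_cast hk
        cases s <;> simp only [Constraint.sat, Cmp.holds, ← hk'] at h1 hs ⊢ <;>
          linarith [h1 (by linarith)]
      · have : (d : ℝ) + e' - e < 0 := by exact_mod_cast he
        cases s <;> simp only [Cmp.holds] at hs ⊢ <;> linarith [(v z).2]
    · intro hs
      -- If both clocks are copied from the same one, their difference is a constant of the update,
      -- so the constraint has the same truth value for both valuations.
      by_cases hz : z = z'
      · subst hz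
        cases s <;> simp only [Cmp.holds] at hs ⊢ <;> linarith
      · have h1 := (h (.diag z z' s (d - e + e'))
          (by simp only [wp, hux, huy]; exact ⟨hz, rfl⟩)).sat
        cases s <;> simp only [Constraint.sat, Cmp.holds] at h1 hs ⊢ <;> push_cast at h1 <;>
          linarith [h1 (by linarith)]

/-! ### The simulation on configurations -/

section Automaton

variable {A : Automaton Q X}

theorem Automaton.stateGuards_eq (A : Automaton Q X) (q : Q) :
    A.stateGuards q = A.guardEqn A.stateGuards q :=
  A.isLeast_stateGuards.1 q

theorem Automaton.guard_mem_stateGuards {t : Transition Q X} (ht : t ∈ A.trans) {φ : Constraint X}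
    (hφ : φ ∈ t.guard) : φ ∈ A.stateGuards t.src := by
  rw [A.stateGuards_eq]
  exact Set.mem_iUnion₂.2 ⟨t, ⟨ht, rfl⟩, .inl (.inl hφ)⟩

theorem Automaton.wp_nonneg_mem_stateGuards {t : Transition Q X} (ht : t ∈ A.trans) {x : X}
    {ψ : Constraint X} (hψ : ψ ∈ wp t.update (.lower 0 .le x)) : ψ ∈ A.stateGuards t.src := by
  rw [A.stateGuards_eq]
  exact Set.mem_iUnion₂.2 ⟨t, ⟨ht, rfl⟩, .inl (.inr (Set.mem_iUnion₂.2 ⟨_, ⟨x, rfl⟩, hψ⟩))⟩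

theorem Automaton.wp_mem_stateGuards {t : Transition Q X} (ht : t ∈ A.trans) {φ ψ : Constraint X}
    (hφ : φ ∈ A.stateGuards t.tgt) (hψ : ψ ∈ wp t.update φ) : ψ ∈ A.stateGuards t.src := by
  rw [A.stateGuards_eq]
  exact Set.mem_iUnion₂.2 ⟨t, ⟨ht, rfl⟩, .inr (Set.mem_iUnion₂.2 ⟨φ, hφ, hψ⟩)⟩

theorem Automaton.FiniteGuards.simLU_iff (hA : A.FiniteGuards) (q : Q) (v w : Valuation X) :
    A.SimLU q v w ↔ ∀ φ ∈ A.stateGuards q, φ.Transfers v w :=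
  guardLULe_iff (hA q) v w

theorem Automaton.FiniteGuards.simLU_delay (hA : A.FiniteGuards) {q : Q} {v w : Valuation X}
    (h : A.SimLU q v w) (δ : ℝ≥0) : A.SimLU q (delay v δ) (delay w δ) := by
  rw [hA.simLU_iff] at h ⊢
  exact fun φ hφ => (h φ hφ).delay δ

/-- Each of the three parts of the guard equation has its use: the atoms of the guard keep the
transition enabled, the preconditions of `x ≥ 0` keep the updated vector non-negative, and the
preconditions of the target's guards relate the results. -/
theorem Automaton.FiniteGuards.simLU_fires (hA : A.FiniteGuards) {t : Transition Q X}
    (ht : t ∈ A.trans) {v w v' : Valuation X} (h : A.SimLU t.src v w) (hf : t.Fires v v') :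
    ∃ w', t.Fires w w' ∧ A.SimLU t.tgt v' w' := by
  rw [hA.simLU_iff] at h
  have hn : ∀ x, 0 ≤ applyUpdate t.update w x := fun x => by
    have h1 := hf.2.1 x
    rcases hu : t.update x with e | ⟨z, e⟩ <;> simp only [applyUpdate, AtomicUpdate.eval, hu] at h1 ⊢
    · exact h1
    · rcases le_or_gt 0 (-e) with he | he
      · obtain ⟨k, hk⟩ := Int.eq_ofNat_of_zero_le he
        have h2 := (h (.lower k .le z) (A.wp_nonneg_mem_stateGuards (x := x) ht
          (by simp only [wp, hu]; exact ⟨k, by simpa using hk.symm, rfl⟩))).sat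
        have hk' : -(e : ℝ) = k := by exact_mod_cast hk
        simp only [Constraint.sat, Cmp.holds] at h2
        linarith [h2 (by linarith)]
      · have : -(e : ℝ) < 0 := by exact_mod_cast he
        linarith [(w z).2]
  obtain ⟨w', hw'⟩ := exists_valuation_coe hn
  refine ⟨w', ⟨fun φ hφ => (h φ (A.guard_mem_stateGuards ht hφ)).sat (hf.1 φ hφ), hn, hw'⟩, ?_⟩
  rw [hA.simLU_iff]
  exact fun φ hφ => transfers_of_wp hf.2.2 hw' fun ψ hψ => h ψ (A.wp_mem_stateGuards ht hφ hψ)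

theorem Automaton.AccIn.simLU (hA : A.FiniteGuards) {k : ℕ} {q : Q} {v w : Valuation X}
    (hk : A.AccIn k q v) (h : A.SimLU q v w) : A.AccIn k q w := by
  induction k generalizing q v w with
  | zero => exact hk
  | succ k ih =>
    obtain ⟨δ, t, ht, rfl, v', hf, ha⟩ := hk
    obtain ⟨w', hw', hs⟩ := hA.simLU_fires ht (hA.simLU_delay h δ) hf
    exact ⟨δ, t, ht, rfl, w', hw', ih ha hs⟩

end Automaton

/-! ### Colours -/

/-- Two valuations satisfy the same difference constraints with constants up to `M`. -/
def ColorEq (M : ℕ) (v w : Valuation X) : Prop :=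
  ∀ i j (d : ℤ), |d| ≤ M → (point v i - point v j < d ↔ point w i - point w j < d)

/-- The colour of a valuation: the difference constraints with constants up to `M` it satisfies. -/
def color (M : ℕ) (v : Valuation X) : Set (Option X × Option X × Set.Icc (-M : ℤ) M) :=
  {p | point v p.1 - point v p.2.1 < (p.2.2 : ℤ)}

theorem color_eq_iff {M : ℕ} {v w : Valuation X} : color M v = color M w ↔ ColorEq M v w := by
  constructor
  · intro h i j d hd
    exact Set.ext_iff.1 h (i, j, ⟨d, abs_le.1 hd⟩)
  · intro h
    ext ⟨i, j, d, hd⟩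
    exact h i j d (abs_le.2 hd)

/-- A valuation of the same colour can be moved within its region so that it agrees with the given
one on the constraints with constants up to `M`. -/
theorem ColorEq.exists_transfers [Finite X] {M : ℕ} {v w : Valuation X} (h : ColorEq M v w) :
    ∃ w', RegEq (point w') (point w) ∧
      ∀ φ : Constraint X, |φ.diff.2.2.2| ≤ M → φ.Transfers v w' := by
  have hM : |-(M : ℤ)| ≤ M := by simp
  have hb : ∀ i, point v i ≤ M ↔ point w i ≤ M := fun i => by
    have := h none i (-M) hM
    simp only [point_none, Int.cast_neg, Int.cast_natCast, zero_sub, neg_lt_neg_iff] at this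
    exact not_lt.symm.trans ((not_congr this).trans not_lt)
  -- The clocks with value at most `M`, together with the reference, are the same for `v` and `w`.
  -- Their differences lie between `-M` and `M`, so equality of colours already is region
  -- equivalence on them. Moving these clocks to their values in `v` and extending to the others
  -- gives `w'`.
  let B := {i : Option X // point v i ≤ M}
  let o : B := ⟨none, by simp⟩
  have hB : RegEq (fun i : B => point w i) fun i : B => point v i := by
    rintro ⟨i, hi⟩ ⟨j, hj⟩ d
    rcases le_or_gt |d| (M : ℤ) with hd | hd
    · exact (h i j d hd).symm
    · have hi' := (hb i).1 hi
      have hj' := (hb j).1 hj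
      have := point_nonneg v i
      have := point_nonneg w i
      have := point_nonneg v j
      have := point_nonneg w j
      rcases lt_abs.1 hd with hd | hd
      · have : (M : ℝ) < d := by exact_mod_cast hd
        constructor <;> intro _ <;> simp only <;> linarith
      · have : (M : ℝ) < -d := by exact_mod_cast hd
        constructor <;> intro _ <;> simp only at * <;> linarith
  obtain ⟨w', hw', he⟩ := hB.exists_valuation o rfl rfl w
  have heq : ∀ x, (v x : ℝ) ≤ M → w' x = v x := fun x hx => by
    have := (he ⟨some x, hx⟩ x 0).1 (by simp)
    apply NNReal.coe_injective
    simp only [point_some, Int.cast_zero] at this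
    linarith
  refine ⟨w', hw'.symm, fun φ hφ => ?_⟩
  rcases φ with ⟨x, s, c⟩ | ⟨c, s, x⟩ | ⟨x, y, s, d⟩
  · intro hx
    have hc : (c : ℝ) ≤ M := by simpa [Constraint.diff] using hφ
    by_contra hv
    rw [heq x (by linarith)] at hx
    exact lt_irrefl _ hx
  · intro hx
    have hc : (c : ℝ) ≤ M := by simpa [Constraint.diff] using hφ
    rcases le_or_gt (v x : ℝ) M with hv | hv
    · rw [heq x hv] at hx
      exact absurd hx (lt_irrefl _)
    · have h1 : ¬ (w x : ℝ) ≤ M := fun hw => absurd ((hb (some x)).2 hw) (not_le.2 hv)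
      have h2 := hw'.le_iff (some x) none M
      simp only [point_some, point_none, sub_zero, Int.cast_natCast] at h2
      rw [h2, not_le] at h1
      linarith
  · intro hs
    rw [← RegEq.sat_iff hw']
    have h1 := h (some x) (some y) d hφ
    have h2 := h (some y) (some x) (-d) (by simpa [Constraint.diff] using hφ)
    simp only [point_some, Int.cast_neg] at h1 h2
    cases s <;> simp only [Constraint.sat, Cmp.holds] at hs ⊢
    · exact h1.1 hs
    · by_contra hc
      linarith [h2.2 (by linarith)]

/-! ### Colours bounded by the constants of the guards -/

section Bounded

variable {A : Automaton Q X}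

/-- `M` bounds the constants of the state-based guards. -/
def Automaton.GuardBound (A : Automaton Q X) (M : ℕ) : Prop :=
  ∀ q, ∀ φ ∈ A.stateGuards q, |φ.diff.2.2.2| ≤ M

theorem Automaton.FiniteGuards.exists_guardBound [Finite Q] (hA : A.FiniteGuards) :
    ∃ M, A.GuardBound M := by
  have hfin : (⋃ q, (fun φ : Constraint X => φ.diff.2.2.2.natAbs) '' A.stateGuards q).Finite :=
    Set.finite_iUnion fun q => (hA q).image _
  obtain ⟨M, hM⟩ := hfin.bddAbove
  refine ⟨M, fun q φ hφ => ?_⟩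
  have := hM (Set.mem_iUnion.2 ⟨q, φ, hφ, rfl⟩)
  rw [Int.abs_eq_natAbs]
  exact_mod_cast this

theorem ColorEq.exists_simLU [Finite X] {M : ℕ} (hA : A.FiniteGuards) (hM : A.GuardBound M)
    {v w : Valuation X} (h : ColorEq M v w) (q : Q) :
    ∃ w', RegEq (point w') (point w) ∧ A.SimLU q v w' := by
  obtain ⟨w', hw', ht⟩ := h.exists_transfers
  exact ⟨w', hw', (hA.simLU_iff q v w').2 fun φ hφ => ht φ (hM q φ hφ)⟩

/-- The valuation `w` is reached from `v` in two moves: up the simulation to `w'`, then inside the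
region of `w'`. -/
theorem Automaton.AccIn.colorEq [Finite X] {M : ℕ} (hA : A.FiniteGuards) (hM : A.GuardBound M)
    {k : ℕ} {q : Q} {v w : Valuation X} (hk : A.AccIn k q v) (h : ColorEq M v w) :
    A.AccIn k q w := by
  obtain ⟨w', hw', hs⟩ := h.exists_simLU hA hM q
  exact (hk.simLU hA hs).regEq hw'

/-- Region-closed sets whose colours occur in a second such set are simulated by it. -/
theorem Automaton.FiniteGuards.zoneSimLU_of_color [Finite X] {M : ℕ} (hA : A.FiniteGuards)
    (hM : A.GuardBound M) {Z Z' : Set (Valuation X)} (hZ' : RegClosed Z')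
    (h : color M '' Z ⊆ color M '' Z') (q : Q) : A.ZoneSimLU q Z Z' := by
  intro v hv
  obtain ⟨w, hw, hc⟩ := h ⟨v, hv, rfl⟩
  obtain ⟨w', hw', hs⟩ := (color_eq_iff.1 hc.symm).exists_simLU hA hM q
  exact ⟨w', hZ' w hw w' hw'.symm, hs⟩

end Bounded

end UTA

namespace UTA
variable {Q X : Type*}

/-! ### Correctness of the enumeration -/

section Enumeration

variable {A : Automaton Q X}

/-- The treatment of the transition `t` from the node `n` has left nothing to be done. -/
def Automaton.Treated (A : Automaton Q X) (N : Set (Node Q X)) (n : Node Q X)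
    (t : Transition Q X) : Prop :=
  t.post n.2 = ∅ ∨ t.tgt ∉ A.accepting ∧ ∃ Z', (t.tgt, Z') ∈ N ∧ A.ZoneSimLU t.tgt (t.post n.2) Z'

/-- The node consists of configurations that are reachable, up to a delay. -/
def Automaton.ReachableNode (A : Automaton Q X) (n : Node Q X) : Prop :=
  ∀ v ∈ n.2, ∃ u δ, v = delay u δ ∧ Relation.ReflTransGen A.DelayAction (A.init, fun _ => 0) (n.1, u)

/-- The invariant of nodes. -/
structure Automaton.GoodNode (A : Automaton Q X) (n : Node Q X) : Prop where
  notMem : n.1 ∉ A.accepting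
  delay_mem : ∀ v ∈ n.2, ∀ δ, delay v δ ∈ n.2
  regClosed : RegClosed n.2
  reachable : A.ReachableNode n

/-- The invariant of the enumeration. -/
def Automaton.Invariant (A : Automaton Q X) : Snapshot Q X → Prop
  | .running P W todo =>
    (∀ n, n ∈ P ∨ n ∈ W → A.GoodNode n) ∧ ((A.init, initialZone X) ∈ P ∨ (A.init, initialZone X) ∈ W) ∧
      (∀ p ∈ todo, p.1 ∈ P ∧ p.2 ∈ A.trans ∧ p.2.src = p.1.1) ∧
      ∀ n ∈ P, ∀ t ∈ A.trans, t.src = n.1 → (n, t) ∈ todo ∨ A.Treated {n | n ∈ P ∨ n ∈ W} n t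
  | .answer true => A.HasAcceptingRun
  | .answer false => ¬ A.HasAcceptingRun

theorem Automaton.Treated.mono {N N' : Set (Node Q X)} (h : N ⊆ N') {n : Node Q X}
    {t : Transition Q X} (ht : A.Treated N n t) : A.Treated N' n t :=
  ht.imp_right fun ⟨ha, Z', hZ', hs⟩ => ⟨ha, Z', h hZ', hs⟩

theorem ZoneSimLU.refl (q : Q) (Z : Set (Valuation X)) : A.ZoneSimLU q Z Z := fun v hv =>
  ⟨v, hv, fun _ => ⟨fun h => absurd h (lt_irrefl _), fun h => absurd h (lt_irrefl _)⟩,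
    fun _ _ _ _ _ h => h⟩

theorem delay_mem_elapse {Z : Set (Valuation X)} {v : Valuation X} (hv : v ∈ elapse Z) (δ : ℝ≥0) :
    delay v δ ∈ elapse Z := by
  obtain ⟨u, hu, ε, rfl⟩ := hv
  exact ⟨u, hu, ε + δ, delay_delay u ε δ⟩

theorem subset_elapse (Z : Set (Valuation X)) : Z ⊆ elapse Z := fun v hv =>
  ⟨v, hv, 0, (delay_zero v).symm⟩

theorem Automaton.GoodNode.fires {n : Node Q X} (hn : A.GoodNode n) {t : Transition Q X}
    (ht : t ∈ A.trans) (hs : t.src = n.1) {v v' : Valuation X} (hv : v ∈ n.2) (hf : t.Fires v v') :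
    Relation.ReflTransGen A.DelayAction (A.init, fun _ => 0) (t.tgt, v') := by
  obtain ⟨u, δ, rfl, hu⟩ := hn.reachable v hv
  exact hu.tail ⟨δ, t, ht, hs, rfl, hf⟩

theorem Automaton.GoodNode.post [Finite X] {n : Node Q X} (hn : A.GoodNode n) {t : Transition Q X}
    (ht : t ∈ A.trans) (hs : t.src = n.1) (hacc : t.tgt ∉ A.accepting) :
    A.GoodNode (t.tgt, t.post n.2) where
  notMem := hacc
  delay_mem _ hv δ := delay_mem_elapse hv δ
  regClosed := hn.regClosed.post t
  reachable := by
    rintro _ ⟨v', ⟨v, hv, hf⟩, δ, rfl⟩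
    exact ⟨v', δ, rfl, hn.fires ht hs hv hf⟩

theorem Automaton.goodNode_init [Finite X] (h : A.init ∉ A.accepting) :
    A.GoodNode (A.init, initialZone X) where
  notMem := h
  delay_mem _ hv δ := delay_mem_elapse hv δ
  regClosed := regClosed_initialZone
  reachable := by
    rintro _ ⟨v, rfl, δ, rfl⟩
    exact ⟨_, δ, rfl, .refl⟩

/-- If all the passed nodes are treated, then no accepting run starts in one of them. -/
theorem not_accIn_of_treated (hA : A.FiniteGuards) {P : List (Node Q X)}
    (hP : ∀ n ∈ P, A.GoodNode n)
    (h : ∀ n ∈ P, ∀ t ∈ A.trans, t.src = n.1 → A.Treated {n | n ∈ P} n t) (k : ℕ) :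
    ∀ n ∈ P, ∀ v ∈ n.2, ¬ A.AccIn k n.1 v := by
  induction k with
  | zero => exact fun n hn v _ => (hP n hn).notMem
  | succ k ih =>
    rintro n hn v hv ⟨δ, t, ht, hs, v', hf, hk⟩
    -- Zones of nodes are closed under delays, so the delay before the action stays in the zone.
    have hv' : v' ∈ t.post n.2 := subset_elapse _ ⟨_, (hP n hn).delay_mem v hv δ, hf⟩
    rcases h n hn t ht hs with he | ⟨-, Z', hZ', hsim⟩
    · rw [he] at hv'
      exact hv'
    · obtain ⟨w, hw, hvw⟩ := hsim v' hv'
      exact ih _ hZ' w hw (hk.simLU hA hvw)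

/-- When Waiting is empty at the end of a round, every passed node is fully treated and the initial
node is among them, so no accepting run exists. When an accepting successor is non-empty,
reachability of the points of the node yields a run. The other steps only settle one pair or move a
node between the lists. -/
theorem Automaton.Invariant.step [Finite X] (hA : A.FiniteGuards) {c c' : Snapshot Q X}
    (hc : A.Invariant c) (h : A.EnumStep c c') : A.Invariant c' := by
  cases h with
  | finish P =>
    obtain ⟨h1, h2, -, h4⟩ := hc
    simp only [List.not_mem_nil, or_false, false_or] at h1 h2 h4
    intro hrun
    obtain ⟨k, hk⟩ := A.hasAcceptingRun_iff.1 hrun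
    exact not_accIn_of_treated hA h1 h4 k _ h2 _ (subset_elapse _ rfl) hk
  | pick P W₁ W₂ n ts hts =>
    obtain ⟨h1, h2, -, h4⟩ := hc
    have hsub : ∀ n' : Node Q X, n' ∈ n :: P ∨ n' ∈ W₁ ++ W₂ ↔ n' ∈ P ∨ n' ∈ W₁ ++ n :: W₂ := by
      intro n'
      simp only [List.mem_cons, List.mem_append]
      tauto
    refine ⟨fun n' hn' => h1 n' ((hsub n').1 hn'), (hsub _).2 h2, ?_, ?_⟩
    · intro p hp
      obtain ⟨t, ht, rfl⟩ := List.mem_map.1 hp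
      exact ⟨List.mem_cons_self, (hts.2 t).1 ht⟩
    · intro n' hn' t ht hs
      rcases List.mem_cons.1 hn' with rfl | hn'
      · exact .inl (List.mem_map.2 ⟨t, (hts.2 t).2 ⟨ht, hs⟩, rfl⟩)
      · rcases h4 n' hn' t ht hs with h | h
        · simp at h
        · exact .inr (h.mono fun n' hn' => (hsub n').2 hn')
  | dead P W n t rest hZ =>
    obtain ⟨h1, h2, h3, h4⟩ := hc
    refine ⟨h1, h2, fun p hp => h3 p (List.mem_cons_of_mem _ hp), fun n' hn' t' ht' hs' => ?_⟩
    rcases h4 n' hn' t' ht' hs' with h | h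
    · rcases List.mem_cons.1 h with h | h
      · obtain ⟨rfl, rfl⟩ := Prod.mk.inj h
        exact .inr (.inl hZ)
      · exact .inl h
    · exact .inr h
  | accept P W n t rest hZ hacc =>
    obtain ⟨h1, h2, h3, h4⟩ := hc
    obtain ⟨hn, ht, hs⟩ := h3 (n, t) List.mem_cons_self
    obtain ⟨_, v', ⟨v, hv, hf⟩, -⟩ := Set.nonempty_iff_ne_empty.2 hZ
    exact ⟨_, (h1 n (.inl hn)).fires ht hs hv hf, hacc⟩
  | prune P W n t rest hZ hacc hcov =>
    obtain ⟨h1, h2, h3, h4⟩ := hc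
    refine ⟨h1, h2, fun p hp => h3 p (List.mem_cons_of_mem _ hp), fun n' hn' t' ht' hs' => ?_⟩
    rcases h4 n' hn' t' ht' hs' with h | h
    · rcases List.mem_cons.1 h with h | h
      · obtain ⟨rfl, rfl⟩ := Prod.mk.inj h
        exact .inr (.inr ⟨hacc, hcov⟩)
      · exact .inl h
    · exact .inr h
  | add P W n t rest hZ hacc hcov =>
    obtain ⟨h1, h2, h3, h4⟩ := hc
    obtain ⟨hn, ht, hs⟩ := h3 (n, t) List.mem_cons_self
    refine ⟨?_, h2.imp_right (List.mem_cons_of_mem _),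
      fun p hp => h3 p (List.mem_cons_of_mem _ hp), fun n' hn' t' ht' hs' => ?_⟩
    · rintro n' (hn' | hn')
      · exact h1 n' (.inl hn')
      · rcases List.mem_cons.1 hn' with rfl | hn'
        · exact (h1 n (.inl hn)).post ht hs hacc
        · exact h1 n' (.inr hn')
    · rcases h4 n' hn' t' ht' hs' with h | h
      · rcases List.mem_cons.1 h with h | h
        · obtain ⟨rfl, rfl⟩ := Prod.mk.inj h
          exact .inr (.inr ⟨hacc, _, .inr List.mem_cons_self, ZoneSimLU.refl _ _⟩)
        · exact .inl h
      · exact .inr (h.mono fun n' hn' => hn'.imp_right (List.mem_cons_of_mem _))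

theorem Automaton.invariant_enumStart [Finite X] (A : Automaton Q X) : A.Invariant A.enumStart := by
  rw [Automaton.enumStart]
  split_ifs with h
  · exact ⟨_, .refl, h⟩
  · refine ⟨?_, .inr List.mem_cons_self, by simp, by simp⟩
    rintro n (hn | hn)
    · simp at hn
    · rw [List.mem_singleton.1 hn]
      exact A.goodNode_init h

theorem Automaton.EnumReaches.invariant [Finite X] (hA : A.FiniteGuards) {c : Snapshot Q X}
    (h : A.EnumReaches c) : A.Invariant c := by
  induction h with
  | refl => exact A.invariant_enumStart
  | tail _ hstep ih => exact ih.step hA hstep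

/-! ### Termination -/

/-- The state of a node and the colours of its zone. -/
def nodeColor (M : ℕ) (n : Node Q X) :
    Q × Set (Set (Option X × Option X × Set.Icc (-M : ℤ) M)) :=
  (n.1, color M '' n.2)

/-- The measure that decreases along the enumeration. -/
noncomputable def enumMeasure (M : ℕ) : Snapshot Q X → ℕ ×ₗ ℕ ×ₗ ℕ
  | .running P W todo => toLex ((nodeColor M '' {n | n ∈ P ∨ n ∈ W})ᶜ.ncard,
      toLex (W.length, todo.length + 1))
  | .answer _ => toLex (0, toLex (0, 0))

theorem enumMeasure_lt [Finite Q] [Finite X] (hA : A.FiniteGuards) {M : ℕ} (hM : A.GuardBound M)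
    {c c' : Snapshot Q X} (hc : A.Invariant c) (h : A.EnumStep c c') :
    enumMeasure M c' < enumMeasure M c := by
  have key : ∀ {a a' b b' d d' : ℕ}, a' < a ∨ a' = a ∧ (b' < b ∨ b' = b ∧ d' < d) →
      (toLex (a', toLex (b', d')) : ℕ ×ₗ ℕ ×ₗ ℕ) < toLex (a, toLex (b, d)) := by
    intro a a' b b' d d' h
    simp only [Prod.Lex.toLex_lt_toLex]
    exact h
  cases h with
  -- The `+ 1` in the last component makes an answer smaller even if the other components vanish.
  | finish P => exact key (by simp; omega)
  | pick P W₁ W₂ n ts hts =>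
    refine key (.inr ⟨?_, .inl (by simp)⟩)
    congr 4
    ext n'
    simp only [List.mem_cons, List.mem_append]
    tauto
  | dead P W n t rest hZ => exact key (by simp)
  | accept P W n t rest hZ hacc => exact key (by simp; omega)
  | prune P W n t rest hZ hacc hcov => exact key (by simp)
  | add P W n t rest hZ hacc hcov =>
    -- If a listed node had the same state and the same colours, it would simulate the new one,
    -- which would have been pruned. So a new value of `nodeColor` appears and the finite complement
    -- shrinks.
    refine key (.inl ?_)
    obtain ⟨h1, -, h3, -⟩ := hc
    refine Set.ncard_lt_ncard ?_ (Set.toFinite _)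
    refine compl_lt_compl_iff_lt.2 (Set.ssubset_iff_of_subset ?_ |>.2
      ⟨nodeColor M (t.tgt, t.post n.2), ⟨_, .inr List.mem_cons_self, rfl⟩, ?_⟩)
    · exact Set.image_mono fun n' hn' => hn'.imp_right (List.mem_cons_of_mem _)
    · rintro ⟨⟨q, Z'⟩, hn', he⟩
      obtain ⟨rfl, hcol⟩ := Prod.mk.inj he
      exact hcov ⟨Z', hn', hA.zoneSimLU_of_color hM (h1 _ hn').regClosed hcol.ge _⟩

theorem Automaton.exists_outgoing (A : Automaton Q X) (q : Q) : ∃ ts, A.Outgoing q ts := by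
  classical
  refine ⟨(A.trans.filter fun t => t.src = q).dedup, List.nodup_dedup _, fun t => ?_⟩
  simp

theorem Automaton.exists_enumStep (A : Automaton Q X) (c : Snapshot Q X) :
    (∃ b, c = .answer b) ∨ ∃ c', A.EnumStep c c' := by
  rcases c with ⟨P, W, todo⟩ | b
  · right
    rcases todo with _ | ⟨⟨n, t⟩, rest⟩
    · rcases W with _ | ⟨n, W⟩
      · exact ⟨_, .finish P⟩
      · obtain ⟨ts, hts⟩ := A.exists_outgoing n.1
        exact ⟨_, .pick P [] W n ts hts⟩
    · by_cases hZ : t.post n.2 = ∅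
      · exact ⟨_, .dead P W n t rest hZ⟩
      by_cases hacc : t.tgt ∈ A.accepting
      · exact ⟨_, .accept P W n t rest hZ hacc⟩
      by_cases hcov : ∃ Z', ((t.tgt, Z') ∈ P ∨ (t.tgt, Z') ∈ W) ∧
          A.ZoneSimLU t.tgt (t.post n.2) Z'
      · exact ⟨_, .prune P W n t rest hZ hacc hcov⟩
      · exact ⟨_, .add P W n t rest hZ hacc hcov⟩
  · exact .inl ⟨b, rfl⟩

theorem Automaton.FiniteGuards.enumTerminates [Finite Q] [Finite X] (hA : A.FiniteGuards) :
    A.EnumTerminates := by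
  refine ⟨?_, fun c _ => A.exists_enumStep c⟩
  rintro ⟨s, h0, hs⟩
  obtain ⟨M, hM⟩ := hA.exists_guardBound
  have hinv : ∀ i, A.Invariant (s i) := fun i => by
    induction i with
    | zero => exact h0 ▸ A.invariant_enumStart
    | succ i ih => exact ih.step hA (hs i)
  exact not_strictAnti_of_wellFoundedLT (fun i => enumMeasure M (s i))
    (strictAnti_nat_of_succ_lt fun i => enumMeasure_lt hA hM (hinv i) (hs i))

theorem Automaton.FiniteGuards.enumSound [Finite X] (hA : A.FiniteGuards) : A.EnumSound :=
  fun h => Automaton.EnumReaches.invariant hA h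

theorem Automaton.FiniteGuards.enumComplete [Finite X] (hA : A.FiniteGuards) : A.EnumComplete :=
  fun hrun h => Automaton.EnumReaches.invariant hA h hrun

/-- Otherwise every reachable snapshot has a successor, and iterating a choice of successors
contradicts termination. -/
theorem Automaton.FiniteGuards.exists_enumReaches_answer [Finite Q] [Finite X]
    (hA : A.FiniteGuards) : ∃ b, A.EnumReaches (.answer b) := by
  by_contra! hno
  have hex : ∀ c : {c // A.EnumReaches c}, ∃ c' : {c // A.EnumReaches c}, A.EnumStep c c' := by
    rintro ⟨c, hc⟩
    rcases A.exists_enumStep c with ⟨b, rfl⟩ | ⟨c', h⟩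
    · exact absurd hc (hno b)
    · exact ⟨⟨c', hc.tail h⟩, h⟩
  choose f hf using hex
  have h0 : A.EnumReaches A.enumStart := Relation.ReflTransGen.refl
  refine hA.enumTerminates.1 ⟨fun i => (f^[i] ⟨_, h0⟩).1, rfl, fun i => ?_⟩
  simp only [Function.iterate_succ_apply']
  exact hf _

/-- Some answer is reached, and soundness and completeness leave only one possible value for it. Any
decision of the existence of accepting runs therefore computes the answer of the enumeration. -/
theorem Automaton.FiniteGuards.enumReaches_answer [Finite Q] [Finite X] (hA : A.FiniteGuards)
    {b : Bool} (hb : b = true ↔ A.HasAcceptingRun) : A.EnumReaches (.answer b) := by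
  obtain ⟨b', hb'⟩ := hA.exists_enumReaches_answer
  have : b' = true ↔ A.HasAcceptingRun := by
    cases b'
    · simpa using fun h => hA.enumComplete h hb'
    · simpa using hA.enumSound hb'
  rwa [Bool.eq_iff_iff.2 (hb.trans this.symm)]

end Enumeration

end UTA

namespace UTA
variable {Q X : Type*}

/-! ### Finiteness of the state-based guards -/

open Relation

/-- König's lemma: a finitely branching relation that reaches infinitely many elements from a finite
set has an infinite chain without repetitions. -/
theorem exists_injective_chain {α : Type*} {r : α → α → Prop} {B : Set α} (hB : B.Finite)
    (hr : ∀ a, {b | r a b}.Finite) (hinf : {a | ∃ b ∈ B, ReflTransGen r b a}.Infinite) :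
    ∃ f : ℕ → α, Function.Injective f ∧ f 0 ∈ B ∧ ∀ n, r (f n) (f (n + 1)) := by
  classical
  -- `L n` holds the elements reached in exactly `n` steps, and `lev` is the least such `n`. The
  -- steps `r'` raise the level by one, so they still reach everything, and chains along them cannot
  -- repeat an element.
  let L : ℕ → Set α := fun n => Nat.rec B (fun _ S => {a | ∃ b ∈ S, r b a}) n
  have hL : ∀ n a, a ∈ L (n + 1) ↔ ∃ b ∈ L n, r b a := fun n a => Iff.rfl
  let lev : α → ℕ := fun a => sInf {n | a ∈ L n}
  let r' : α → α → Prop := fun b a => r a b ∧ lev b = lev a + 1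
  have hfin : ∀ a, Acc r' a → {b | ReflTransGen (fun a b => r' b a) a b}.Finite := by
    intro a ha
    induction ha with
    | intro a _ ih =>
      have hsub : {b | r' b a}.Finite := (hr a).subset fun b hb => hb.1
      refine ((hsub.biUnion fun b hb => ih b hb).union (Set.finite_singleton a)).subset ?_
      intro b hb
      rcases hb.cases_head with rfl | ⟨c, hc, hcb⟩
      · exact .inr rfl
      · exact .inl (Set.mem_iUnion₂.2 ⟨c, hc, hcb⟩)
  have hcov : ∀ n a, a ∈ L n → lev a = n → ∃ b ∈ B, ReflTransGen (fun a b => r' b a) b a := by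
    intro n
    induction n with
    | zero => exact fun a ha _ => ⟨a, ha, .refl⟩
    | succ n ih =>
      intro a ha hlev
      obtain ⟨b, hb, hba⟩ := (hL n a).1 ha
      have h1 : lev b ≤ n := Nat.sInf_le hb
      have h2 : lev a ≤ lev b + 1 := Nat.sInf_le ((hL _ a).2 ⟨b, Nat.sInf_mem (s := {n | b ∈ L n}) ⟨n, hb⟩, hba⟩)
      obtain ⟨c, hc, hcb⟩ := ih b hb (by omega)
      exact ⟨c, hc, hcb.tail ⟨hba, by omega⟩⟩
  by_cases hacc : ∀ b ∈ B, Acc r' b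
  · refine absurd ((hB.biUnion fun b hb => hfin b (hacc b hb)).subset ?_) hinf
    rintro a ⟨b, hb, hba⟩
    have hne : ∃ n, a ∈ L n := by
      induction hba with
      | refl => exact ⟨0, hb⟩
      | tail _ h ih =>
        obtain ⟨n, hn⟩ := ih
        exact ⟨n + 1, (hL _ _).2 ⟨_, hn, h⟩⟩
    obtain ⟨c, hc, hca⟩ := hcov (lev a) a (Nat.sInf_mem hne) rfl
    exact Set.mem_iUnion₂.2 ⟨c, hc, hca⟩
  · push Not at hacc
    obtain ⟨b, hb, hacc⟩ := hacc
    obtain ⟨f, hf0, hf⟩ := not_acc_iff_exists_descending_chain.1 hacc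
    have hlev : ∀ n, lev (f n) = lev b + n := fun n => by
      induction n with
      | zero => rw [hf0]; rfl
      | succ n ih => rw [(hf n).2, ih]; rfl
    refine ⟨f, fun m n hmn => ?_, hf0 ▸ hb, fun n => (hf n).1⟩
    have := congrArg lev hmn
    rw [hlev, hlev] at this
    omega

theorem Cmp.code_injective : Function.Injective Cmp.code := by
  rintro (_ | _) (_ | _) h <;> simp_all [Cmp.code]

instance : Finite Cmp := Finite.of_injective _ Cmp.code_injective

/-! ### Guards as items propagated along transitions -/

section Items

/-- The constraints that a transition contributes directly to the guards of its source. -/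
def Transition.Contributes (t : Transition Q X) (e : Diff X) : Prop :=
  (∃ φ ∈ t.guard, φ.diff = e) ∨
    ∃ x, e = substDiff t.update (none, some x, .le, 0) ∧ e.Proper

/-- The guards at a state, as difference constraints, from which the state-based guards are
generated. -/
def Automaton.BaseItem (A : Automaton Q X) (e : Q × Diff X) : Prop :=
  ∃ t ∈ A.trans, t.src = e.1 ∧ t.Contributes e.2

/-- A single propagation of a guard along a transition. -/
def Automaton.ItemStep (A : Automaton Q X) (e e' : Q × Diff X) : Prop :=
  ∃ t ∈ A.trans, t.tgt = e.1 ∧ t.src = e'.1 ∧ e'.2 = substDiff t.update e.2 ∧ e'.2.Proper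

/-- The guards that are generated. -/
def Automaton.items (A : Automaton Q X) : Set (Q × Diff X) :=
  {e | ∃ b, A.BaseItem b ∧ ReflTransGen A.ItemStep b e}

variable {A : Automaton Q X}

theorem Automaton.mem_items_of_base {b : Q × Diff X} (h : A.BaseItem b) : b ∈ A.items :=
  ⟨b, h, .refl⟩

theorem Automaton.mem_items_of_step {e e' : Q × Diff X} (h : e ∈ A.items) (hs : A.ItemStep e e') :
    e' ∈ A.items := by
  obtain ⟨b, hb, hbe⟩ := h
  exact ⟨b, hb, hbe.tail hs⟩

/-- Generated items are guards by induction on the generation. Conversely, the constraints whose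
items are generated satisfy the guard equations up to inclusion, so they contain the least solution.
-/
theorem Automaton.mem_items_iff (A : Automaton Q X) (e : Q × Diff X) :
    e ∈ A.items ↔ ∃ φ ∈ A.stateGuards e.1, φ.diff = e.2 := by
  constructor
  · rintro ⟨b, ⟨t, ht, hs, hb⟩, hbe⟩
    induction hbe with
    | refl =>
      rcases hb with ⟨φ, hφ, he⟩ | ⟨x, he, hp⟩
      · exact ⟨φ, hs ▸ A.guard_mem_stateGuards ht hφ, he⟩
      · obtain ⟨hne, ψ, hψ⟩ := (Diff.proper_iff _).1 hp
        refine ⟨ψ, hs ▸ A.wp_nonneg_mem_stateGuards (x := x) ht ((mem_wp_iff _ _ _).2 ?_), hψ⟩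
        rw [hψ]
        exact ⟨by simpa [Constraint.diff] using he, hne⟩
    | tail _ h ih =>
      obtain ⟨φ, hφ, he⟩ := ih
      obtain ⟨t, ht, htgt, hsrc, hsub, hp⟩ := h
      obtain ⟨hne, ψ, hψ⟩ := (Diff.proper_iff _).1 hp
      refine ⟨ψ, hsrc ▸ A.wp_mem_stateGuards ht (htgt ▸ hφ) ((mem_wp_iff _ _ _).2 ?_), hψ⟩
      rw [hψ, he]
      exact ⟨hsub, hne⟩
  · have hle : A.stateGuards ≤ fun q => {φ | (q, φ.diff) ∈ A.items} := by
      refine OrderHom.lfp_le _ fun q φ hφ => ?_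
      obtain ⟨t, ⟨ht, rfl⟩, (hφ | hφ) | hφ⟩ := Set.mem_iUnion₂.1 hφ
      · exact Automaton.mem_items_of_base ⟨t, ht, rfl, .inl ⟨φ, hφ, rfl⟩⟩
      · obtain ⟨_, ⟨x, rfl⟩, hφ⟩ := Set.mem_iUnion₂.1 hφ
        obtain ⟨h1, h2⟩ := (mem_wp_iff _ _ _).1 hφ
        exact Automaton.mem_items_of_base ⟨t, ht, rfl, .inr ⟨x, by simpa [Constraint.diff] using h1,
          (Diff.proper_iff _).2 ⟨h2, φ, rfl⟩⟩⟩
      · obtain ⟨ψ, hψ, hφ⟩ := Set.mem_iUnion₂.1 hφ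
        obtain ⟨h1, h2⟩ := (mem_wp_iff _ _ _).1 hφ
        exact Automaton.mem_items_of_step hψ
          ⟨t, ht, rfl, rfl, h1, (Diff.proper_iff _).2 ⟨h2, φ, rfl⟩⟩
    rintro ⟨φ, hφ, he⟩
    have h : (e.1, φ.diff) ∈ A.items := hle e.1 hφ
    rwa [he] at h

theorem Automaton.finiteGuards_iff_items [Finite Q] (A : Automaton Q X) :
    A.FiniteGuards ↔ A.items.Finite := by
  constructor
  · intro h
    refine (Set.finite_iUnion fun q => (h q).image fun φ => (q, φ.diff)).subset fun e he => ?_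
    obtain ⟨φ, hφ, h⟩ := (A.mem_items_iff e).1 he
    exact Set.mem_iUnion.2 ⟨e.1, φ, hφ, Prod.ext rfl h⟩
  · intro h q
    refine Set.Finite.of_finite_image (f := fun φ => (q, φ.diff)) (h.subset ?_) ?_
    · rintro _ ⟨φ, hφ, rfl⟩
      exact (A.mem_items_iff _).2 ⟨φ, hφ, rfl⟩
    · intro φ _ ψ _ h
      exact Constraint.diff_injective (Prod.mk.inj h).2

/-! ### Pumping of shifted guards -/

/-- The second item is the first one with a constant that is shifted in an admissible direction. -/
def Grows (e e' : Q × Diff X) : Prop :=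
  e'.1 = e.1 ∧ e'.2.1 = e.2.1 ∧ e'.2.2.1 = e.2.2.1 ∧ e'.2.2.2.1 = e.2.2.2.1 ∧
    e'.2.2.2.2 ≠ e.2.2.2.2 ∧ (e.2.2.1 = none → e.2.2.2.2 ≤ e'.2.2.2.2) ∧
      (e.2.1 = none → e'.2.2.2.2 ≤ e.2.2.2.2)

/-- The item with its constant increased by `δ`. -/
def shiftItem (e : Q × Diff X) (δ : ℤ) : Q × Diff X :=
  (e.1, e.2.1, e.2.2.1, e.2.2.2.1, e.2.2.2.2 + δ)

/-- The shifts that keep an item proper. -/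
def ShiftOk (e : Q × Diff X) (δ : ℤ) : Prop := (e.2.2.1 = none → 0 ≤ δ) ∧ (e.2.1 = none → δ ≤ 0)

/-- Substitution keeps `none` and can only turn clocks into `none`, so restrictions on shifts can
only increase along a step. -/
theorem ShiftOk.of_step {e e' : Q × Diff X} {δ : ℤ} (h : A.ItemStep e e') (hδ : ShiftOk e' δ) :
    ShiftOk e δ := by
  obtain ⟨t, -, -, -, h, -⟩ := h
  exact ⟨fun he => hδ.1 (by rw [h]; simp [substDiff, he, updateSource]),
    fun he => hδ.2 (by rw [h]; simp [substDiff, he, updateSource])⟩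

theorem itemStep_shift {e e' : Q × Diff X} {δ : ℤ} (h : A.ItemStep e e') (hδ : ShiftOk e' δ) :
    A.ItemStep (shiftItem e δ) (shiftItem e' δ) := by
  obtain ⟨t, ht, h1, h2, h3, h4, h5, h6⟩ := h
  refine ⟨t, ht, h1, h2, ?_, h4, fun hn => ?_, fun hn => ?_⟩
  · simp only [shiftItem, h3, substDiff, Prod.mk.injEq, true_and]
    ring
  · have := h5 hn
    have := hδ.1 hn
    simp only [shiftItem]
    omega
  · have := h6 hn
    have := hδ.2 hn
    simp only [shiftItem]
    omega

theorem reflTransGen_shift {e e' : Q × Diff X} {δ : ℤ} (h : ReflTransGen A.ItemStep e e')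
    (hδ : ShiftOk e' δ) : ReflTransGen A.ItemStep (shiftItem e δ) (shiftItem e' δ) := by
  induction h with
  | refl => exact .refl
  | tail _ h ih => exact (ih (hδ.of_step h)).tail (itemStep_shift h hδ)

/-- The path from `e` to its copy shifted by `δ` can itself be shifted by `n * δ`, because all signs
stay admissible. Concatenating the shifted paths gives all multiples of `δ`. -/
theorem items_infinite_of_grows {e e' : Q × Diff X} (he : e ∈ A.items)
    (h : ReflTransGen A.ItemStep e e') (hg : Grows e e') : A.items.Infinite := by
  obtain ⟨h1, h2, h3, h4, h5, h6, h7⟩ := hg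
  set δ := e'.2.2.2.2 - e.2.2.2.2 with hδ
  have he' : e' = shiftItem e δ := by
    obtain ⟨q', i', j', s', d'⟩ := e'
    simp only at h1 h2 h3 h4
    simp [shiftItem, h1, h2, h3, h4, hδ]
  have hiter : ∀ n : ℕ, ReflTransGen A.ItemStep e (shiftItem e (n * δ)) := fun n => by
    induction n with
    | zero => simpa [shiftItem] using .refl
    | succ n ih =>
      have hok : ShiftOk e' (n * δ) := by
        constructor
        · intro hn
          have := h6 (h3 ▸ hn)
          exact mul_nonneg (by positivity) (by omega)
        · intro hn
          have := h7 (h2 ▸ hn)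
          exact mul_nonpos_of_nonneg_of_nonpos (by positivity) (by omega)
      have h8 := reflTransGen_shift h hok
      have h9 : shiftItem e' (n * δ) = shiftItem e ((n + 1 : ℕ) * δ) := by
        rw [he']
        simp only [shiftItem, Prod.mk.injEq, true_and]
        push_cast
        ring
      exact ih.trans (h9 ▸ h8)
  obtain ⟨b, hb, hbe⟩ := he
  refine Set.infinite_of_injective_forall_mem (f := fun n : ℕ => shiftItem e (n * δ)) ?_
    fun n => ⟨b, hb, hbe.trans (hiter n)⟩
  intro m n hmn
  have : (m : ℤ) * δ = n * δ := by simpa [shiftItem] using hmn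
  exact_mod_cast mul_right_cancel₀ (show δ ≠ 0 by omega) this

theorem Automaton.finite_baseItem [Finite X] (A : Automaton Q X) :
    {e | A.BaseItem e}.Finite := by
  have h1 : {t | t ∈ A.trans}.Finite := List.finite_toSet _
  refine (h1.biUnion (t := fun t => (fun φ => (t.src, Constraint.diff φ)) '' {φ | φ ∈ t.guard} ∪
    Set.range fun x => (t.src, substDiff t.update (none, some x, .le, 0))) fun t _ =>
      ((List.finite_toSet _).image _).union (Set.finite_range _)).subset ?_
  rintro ⟨q, e⟩ ⟨t, ht, rfl, ⟨φ, hφ, rfl⟩ | ⟨x, rfl, -⟩⟩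
  · exact Set.mem_iUnion₂.2 ⟨t, ht, .inl ⟨φ, hφ, rfl⟩⟩
  · exact Set.mem_iUnion₂.2 ⟨t, ht, .inr ⟨x, rfl⟩⟩

theorem Automaton.finite_itemStep (A : Automaton Q X) (e : Q × Diff X) :
    {e' | A.ItemStep e e'}.Finite := by
  have h1 : {t | t ∈ A.trans}.Finite := List.finite_toSet _
  refine (h1.image fun t => (t.src, substDiff t.update e.2)).subset ?_
  rintro ⟨q, e'⟩ ⟨t, ht, -, rfl, rfl, -⟩
  exact ⟨t, ht, rfl⟩

/-- If there are infinitely many state-based guards, then one of them generates a shifted copy of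
itself. -/
theorem exists_grows_of_infinite [Finite Q] [Finite X] (h : A.items.Infinite) :
    ∃ b e e', A.BaseItem b ∧ ReflTransGen A.ItemStep b e ∧ ReflTransGen A.ItemStep e e' ∧
      Grows e e' := by
  obtain ⟨f, hinj, h0, hf⟩ := exists_injective_chain A.finite_baseItem A.finite_itemStep h
  have hreach : ∀ m n, m ≤ n → ReflTransGen A.ItemStep (f m) (f n) := fun m n hmn => by
    induction n, hmn using Nat.le_induction with
    | base => exact .refl
    | succ n _ ih => exact ih.tail (hf n)
  let shape : Q × Diff X → Q × Option X × Option X × Cmp := fun e => (e.1, e.2.1, e.2.2.1, e.2.2.2.1)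
  -- For a non-diagonal constraint, `size` is its natural constant, so an increase of `size` is a
  -- shift in the admissible direction. Diagonal constraints may be shifted either way.
  let size : Q × Diff X → ℕ := fun e => match e.2.2.1, e.2.1 with
    | none, _ => e.2.2.2.2.toNat
    | _, none => (-e.2.2.2.2).toNat
    | _, _ => 0
  -- There are finitely many shapes, so one recurs infinitely often. An occurrence of least size is
  -- followed by a later one that is at least as large and different.
  obtain ⟨y, hy⟩ := Finite.exists_infinite_fiber fun n => shape (f n)
  have hS : {n | shape (f n) = y}.Infinite := Set.infinite_coe_iff.1 hy
  obtain ⟨m, hm, hmin⟩ := exists_minimalFor_of_wellFoundedLT (· ∈ {n | shape (f n) = y})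
    (fun n => size (f n)) hS.nonempty
  obtain ⟨n, hn, hmn⟩ := hS.exists_gt m
  refine ⟨f 0, f m, f n, h0, hreach 0 m (Nat.zero_le _), hreach m n hmn.le, ?_⟩
  have hne : f n ≠ f m := fun h => hmn.ne' (hinj h)
  have hle : size (f m) ≤ size (f n) := (le_total (size (f m)) (size (f n))).elim id fun h =>
    hmin hn h
  have hshape : shape (f n) = shape (f m) := Eq.trans hn hm.symm
  obtain ⟨φ, -, hφ⟩ := (A.mem_items_iff (f m)).1 ⟨f 0, h0, hreach 0 m (Nat.zero_le _)⟩
  obtain ⟨ψ, -, hψ⟩ := (A.mem_items_iff (f n)).1 ⟨f 0, h0, hreach 0 n (Nat.zero_le _)⟩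
  generalize f m = e at *
  generalize f n = e' at *
  obtain ⟨q, i, j, s, d⟩ := e
  obtain ⟨q', i', j', s', d'⟩ := e'
  simp only [shape, Prod.mk.injEq] at hshape
  obtain ⟨rfl, rfl, rfl, rfl⟩ := hshape
  refine ⟨rfl, rfl, rfl, rfl, fun h => hne (by simp_all), ?_, ?_⟩
  · rintro rfl
    simp only [size] at hle
    change d ≤ d'
    rcases φ with _ | _ | _ <;> rcases ψ with _ | _ | _ <;> simp [Constraint.diff] at hφ hψ
    omega
  · rintro rfl
    rcases φ with _ | _ | _ <;> rcases ψ with _ | _ | _ <;> simp [Constraint.diff] at hφ hψ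
    obtain ⟨rfl, -, -⟩ := hφ
    simp only [size] at hle
    change d' ≤ d
    omega

theorem Automaton.not_finiteGuards_iff [Finite Q] [Finite X] (A : Automaton Q X) :
    ¬ A.FiniteGuards ↔ ∃ b e e', A.BaseItem b ∧ ReflTransGen A.ItemStep b e ∧
      ReflTransGen A.ItemStep e e' ∧ Grows e e' := by
  rw [A.finiteGuards_iff_items]
  constructor
  · exact exists_grows_of_infinite
  · rintro ⟨b, e, e', hb, hbe, hee', hg⟩
    exact items_infinite_of_grows ⟨b, hb, hbe⟩ hee' hg

end Items

end UTA

/-! ### Primitive recursive functions, compositionally -/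

attribute [fun_prop] Primrec
attribute [fun_prop] Primrec.id Primrec.const Primrec.comp Primrec.fst Primrec.snd Primrec.pair

namespace Primrec

variable {α β γ σ : Type*} [Primcodable α] [Primcodable β] [Primcodable γ] [Primcodable σ]

@[fun_prop] theorem app_fst {f : α → β × γ} (hf : Primrec f) : Primrec fun a => (f a).1 :=
  fst.comp hf

@[fun_prop] theorem app_snd {f : α → β × γ} (hf : Primrec f) : Primrec fun a => (f a).2 :=
  snd.comp hf

@[fun_prop] theorem app_add {f g : α → ℕ} (hf : Primrec f) (hg : Primrec g) :
    Primrec fun a => f a + g a := nat_add.comp hf hg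

@[fun_prop] theorem app_sub {f g : α → ℕ} (hf : Primrec f) (hg : Primrec g) :
    Primrec fun a => f a - g a := nat_sub.comp hf hg

@[fun_prop] theorem app_mul {f g : α → ℕ} (hf : Primrec f) (hg : Primrec g) :
    Primrec fun a => f a * g a := nat_mul.comp hf hg

@[fun_prop] theorem app_div {f g : α → ℕ} (hf : Primrec f) (hg : Primrec g) :
    Primrec fun a => f a / g a := nat_div.comp hf hg

@[fun_prop] theorem app_mod {f g : α → ℕ} (hf : Primrec f) (hg : Primrec g) :
    Primrec fun a => f a % g a := nat_mod.comp hf hg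

@[fun_prop] theorem app_and {f g : α → Bool} (hf : Primrec f) (hg : Primrec g) :
    Primrec fun a => f a && g a := Primrec.and.comp hf hg

@[fun_prop] theorem app_or {f g : α → Bool} (hf : Primrec f) (hg : Primrec g) :
    Primrec fun a => f a || g a := Primrec.or.comp hf hg

@[fun_prop] theorem app_not {f : α → Bool} (hf : Primrec f) : Primrec fun a => !f a :=
  Primrec.not.comp hf

@[fun_prop] theorem app_cond {c : α → Bool} {f g : α → σ} (hc : Primrec c) (hf : Primrec f)
    (hg : Primrec g) : Primrec fun a => _root_.cond (c a) (f a) (g a) := cond hc hf hg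

@[fun_prop] theorem app_decide_eq [DecidableEq β] {f g : α → β} (hf : Primrec f) (hg : Primrec g) :
    Primrec fun a => decide (f a = g a) :=
  primrecPred_iff_primrec_decide.1 (Primrec.eq.comp hf hg)

@[fun_prop] theorem app_decide_lt {f g : α → ℕ} (hf : Primrec f) (hg : Primrec g) :
    Primrec fun a => decide (f a < g a) :=
  primrecPred_iff_primrec_decide.1 (nat_lt.comp hf hg)

@[fun_prop] theorem app_decide_le {f g : α → ℕ} (hf : Primrec f) (hg : Primrec g) :
    Primrec fun a => decide (f a ≤ g a) :=
  primrecPred_iff_primrec_decide.1 (nat_le.comp hf hg)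

@[fun_prop] theorem app_some {f : α → β} (hf : Primrec f) : Primrec fun a => some (f a) :=
  option_some.comp hf

@[fun_prop] theorem app_option_bind {f : α → Option β} {g : α → β → Option σ} (hf : Primrec f)
    (hg : Primrec fun p : α × β => g p.1 p.2) : Primrec fun a => (f a).bind (g a) :=
  option_bind hf hg

@[fun_prop] theorem app_option_map {f : α → Option β} {g : α → β → σ} (hf : Primrec f)
    (hg : Primrec fun p : α × β => g p.1 p.2) : Primrec fun a => (f a).map (g a) :=
  option_map hf hg

@[fun_prop] theorem app_option_getD {f : α → Option β} {g : α → β} (hf : Primrec f)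
    (hg : Primrec g) : Primrec fun a => (f a).getD (g a) :=
  option_getD.comp hf hg

@[fun_prop] theorem app_decode {f : α → ℕ} (hf : Primrec f) :
    Primrec fun a => (Encodable.decode (f a) : Option β) := Primrec.decode.comp hf

@[fun_prop] theorem app_getElem? {f : α → List β} {g : α → ℕ} (hf : Primrec f) (hg : Primrec g) :
    Primrec fun a => (f a)[g a]? := list_getElem?.comp hf hg

@[fun_prop] theorem app_list_getD {f : α → List β} {g : α → ℕ} {h : α → β} (hf : Primrec f)
    (hg : Primrec g) (hh : Primrec h) : Primrec fun a => (f a).getD (g a) (h a) := by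
  simpa only [List.getD_eq_getElem?_getD] using app_option_getD (app_getElem? hf hg) hh

@[fun_prop] theorem app_cons {f : α → β} {g : α → List β} (hf : Primrec f) (hg : Primrec g) :
    Primrec fun a => f a :: g a := list_cons.comp hf hg

@[fun_prop] theorem app_map {f : α → List β} {g : α → β → γ} (hf : Primrec f)
    (hg : Primrec fun p : α × β => g p.1 p.2) : Primrec fun a => (f a).map (g a) :=
  list_map hf hg

@[fun_prop] theorem app_range {f : α → ℕ} (hf : Primrec f) : Primrec fun a => List.range (f a) :=
  list_range.comp hf

@[fun_prop] theorem app_length {f : α → List β} (hf : Primrec f) :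
    Primrec fun a => (f a).length := list_length.comp hf

@[fun_prop] theorem app_all {f : α → List β} {g : α → β → Bool} (hf : Primrec f)
    (hg : Primrec fun p : α × β => g p.1 p.2) : Primrec fun a => (f a).all (g a) := by
  have h : PrimrecPred fun l : List Bool => ∀ b ∈ l, b = true :=
    PrimrecPred.forall_mem_list (Primrec.eq.comp .id (.const true))
  refine (primrecPred_iff_primrec_decide.1 (h.comp (app_map hf hg))).of_eq fun a => ?_
  rw [Bool.eq_iff_iff]
  simp

@[fun_prop] theorem app_any {f : α → List β} {g : α → β → Bool} (hf : Primrec f)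
    (hg : Primrec fun p : α × β => g p.1 p.2) : Primrec fun a => (f a).any (g a) := by
  have := app_not (app_all (g := fun a b => !g a b) hf (app_not hg))
  simpa only [List.not_all_eq_any_not, Bool.not_not] using this

@[fun_prop] theorem app_foldl {f : α → List β} {g : α → σ} {h : α → σ → β → σ} (hf : Primrec f)
    (hg : Primrec g) (hh : Primrec fun p : α × σ × β => h p.1 p.2.1 p.2.2) :
    Primrec fun a => (f a).foldl (h a) (g a) :=
  list_foldl (h := fun a p => h a p.1 p.2) hf hg hh

@[fun_prop] theorem app_sum_elim {f : α → β ⊕ γ} {g : α → β → σ} {h : α → γ → σ} (hf : Primrec f)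
    (hg : Primrec fun p : α × β => g p.1 p.2) (hh : Primrec fun p : α × γ => h p.1 p.2) :
    Primrec fun a => Sum.elim (g a) (h a) (f a) :=
  (sumCasesOn hf hg hh).of_eq fun a => by cases f a <;> rfl

/-! Integers. -/

theorem encode_ofNat (n : ℕ) : Encodable.encode (n : ℤ) = 2 * n := rfl

theorem encode_negSucc (n : ℕ) : Encodable.encode (Int.negSucc n) = 2 * n + 1 := rfl

@[fun_prop] theorem app_natCast {f : α → ℕ} (hf : Primrec f) : Primrec fun a => (f a : ℤ) := by
  refine encode_iff.1 ?_
  simp only [encode_ofNat]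
  fun_prop

@[fun_prop] theorem app_negSucc {f : α → ℕ} (hf : Primrec f) :
    Primrec fun a => Int.negSucc (f a) := by
  refine encode_iff.1 ?_
  simp only [encode_negSucc]
  fun_prop

@[fun_prop] theorem app_encode {f : α → β} (hf : Primrec f) :
    Primrec fun a => Encodable.encode (f a) := Primrec.encode.comp hf

-- The parity of the code of an integer is its sign, so arithmetic on integers reduces to natural
-- numbers.
@[fun_prop] theorem app_toNat {f : α → ℤ} (hf : Primrec f) : Primrec fun a => (f a).toNat := by
  have : Primrec fun a => bif decide (Encodable.encode (f a) % 2 = 0) then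
      Encodable.encode (f a) / 2 else 0 := by fun_prop
  refine this.of_eq fun a => ?_
  rcases f a with n | n
  · simp [encode_ofNat]
  · simp [encode_negSucc]

theorem app_neg_toNat {f : α → ℤ} (hf : Primrec f) : Primrec fun a => (-f a).toNat := by
  have : Primrec fun a => bif decide (Encodable.encode (f a) % 2 = 0) then
      0 else Encodable.encode (f a) / 2 + 1 := by fun_prop
  refine this.of_eq fun a => ?_
  rcases f a with n | n
  · simp [encode_ofNat]
  · have : (2 * n + 1) / 2 = n := by omega
    simp [encode_negSucc, this, Int.neg_negSucc]

theorem app_natCast_sub {f g : α → ℕ} (hf : Primrec f) (hg : Primrec g) :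
    Primrec fun a => (f a : ℤ) - (g a : ℤ) := by
  have : Primrec fun a => bif decide (g a ≤ f a) then ((f a - g a : ℕ) : ℤ) else
      Int.negSucc (g a - f a - 1) := by fun_prop
  refine this.of_eq fun a => ?_
  by_cases h : g a ≤ f a
  · simp [h]
  · simp only [h, decide_false, cond_false, Int.negSucc_eq]
    omega

@[fun_prop] theorem app_int_add {f g : α → ℤ} (hf : Primrec f) (hg : Primrec g) :
    Primrec fun a => f a + g a := by
  have h1 := app_neg_toNat hf
  have h2 := app_neg_toNat hg
  refine (app_natCast_sub (f := fun a => (f a).toNat + (g a).toNat)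
    (g := fun a => (-f a).toNat + (-g a).toNat) (by fun_prop) (by fun_prop)).of_eq fun a => ?_
  push_cast
  omega

@[fun_prop] theorem app_int_neg {f : α → ℤ} (hf : Primrec f) : Primrec fun a => -f a := by
  refine (app_natCast_sub (app_neg_toNat hf) (app_toNat hf)).of_eq fun a => ?_
  omega

@[fun_prop] theorem app_int_sub {f g : α → ℤ} (hf : Primrec f) (hg : Primrec g) :
    Primrec fun a => f a - g a := by
  simpa only [sub_eq_add_neg] using app_int_add hf (app_int_neg hg)

@[fun_prop] theorem app_int_mul_natCast {f : α → ℤ} {g : α → ℕ} (hf : Primrec f) (hg : Primrec g) :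
    Primrec fun a => f a * (g a : ℤ) := by
  have h1 := app_neg_toNat hf
  refine (app_natCast_sub (f := fun a => (f a).toNat * g a) (g := fun a => (-f a).toNat * g a)
    (by fun_prop) (by fun_prop)).of_eq fun a => ?_
  push_cast
  rw [← sub_mul]
  congr 1
  omega

@[fun_prop] theorem app_decide_int_le {f g : α → ℤ} (hf : Primrec f) (hg : Primrec g) :
    Primrec fun a => decide (f a ≤ g a) := by
  have h1 := app_neg_toNat (app_int_sub hg hf)
  have : Primrec fun a => decide ((-(g a - f a)).toNat = 0) := by fun_prop
  refine this.of_eq fun a => ?_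
  congr 1
  exact propext (by omega)

@[fun_prop] theorem app_decide_int_lt {f g : α → ℤ} (hf : Primrec f) (hg : Primrec g) :
    Primrec fun a => decide (f a < g a) := by
  have : Primrec fun a => !decide (g a ≤ f a) := by fun_prop
  refine this.of_eq fun a => ?_
  rw [← decide_not, decide_eq_decide, not_le]

end Primrec

/-! ### Decision by certificates -/

/-- A property that has decidable certificates, as has its negation, on a decidable domain is
decidable on that domain. -/
theorem exists_computable_of_certificates {α β γ : Type*} [Primcodable α] [Primcodable β]
    [Primcodable γ] {V : α → Bool} {T : α → Prop} {p : α → β → Bool} {n : α → γ → Bool}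
    (hV : Computable V) (hp : Primrec fun x : α × β => p x.1 x.2)
    (hn : Primrec fun x : α × γ => n x.1 x.2)
    (hpT : ∀ a, V a = true → (T a ↔ ∃ b, p a b = true))
    (hnT : ∀ a, V a = true → (¬ T a ↔ ∃ b, n a b = true)) :
    ∃ f : α → Bool, Computable f ∧ ∀ a, V a = true → (f a = true ↔ T a) := by
  -- Each number is tried as the code of a certificate of either kind. Inputs outside the domain are
  -- answered at once, so that the search is total.
  let g : α → ℕ → Option Bool := fun a k =>
    bif !V a then some false else
      bif ((Encodable.decode k : Option β).map (p a)).getD false then some true else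
        bif ((Encodable.decode k : Option γ).map (n a)).getD false then some false else none
  have hg : Computable₂ g := by
    refine Computable.cond (Primrec.not.to_comp.comp (hV.comp Computable.fst)) (.const _) ?_
    have : Primrec fun x : α × ℕ =>
        bif ((Encodable.decode x.2 : Option β).map (p x.1)).getD false then some true else
          bif ((Encodable.decode x.2 : Option γ).map (n x.1)).getD false then some false
            else none := by
      have h1 : Primrec fun x : (α × ℕ) × β => p x.1.1 x.2 :=
        hp.comp (by fun_prop : Primrec fun x : (α × ℕ) × β => (x.1.1, x.2))
      have h2 : Primrec fun x : (α × ℕ) × γ => n x.1.1 x.2 :=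
        hn.comp (by fun_prop : Primrec fun x : (α × ℕ) × γ => (x.1.1, x.2))
      fun_prop
    exact this.to_comp
  have hspec : ∀ a k b, g a k = some b → V a = true → (b = true ↔ T a) := by
    intro a k b h hVa
    simp only [g, hVa, Bool.not_true, cond_false] at h
    rcases hb : ((Encodable.decode k : Option β).map (p a)).getD false with _ | _ <;>
      rw [hb] at h
    · rcases hc : ((Encodable.decode k : Option γ).map (n a)).getD false with _ | _ <;>
        rw [hc] at h
      · simp at h
      · obtain rfl : b = false := by simpa using h.symm
        rcases hd : (Encodable.decode k : Option γ) with _ | c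
        · simp [hd] at hc
        · simpa using (hnT a hVa).2 ⟨c, by simpa [hd] using hc⟩
    · obtain rfl : b = true := by simpa using h.symm
      rcases hd : (Encodable.decode k : Option β) with _ | c
      · simp [hd] at hb
      · simpa using (hpT a hVa).2 ⟨c, by simpa [hd] using hb⟩
  have hdom : ∀ a, (Nat.rfindOpt (g a)).Dom := by
    intro a
    rw [Nat.rfindOpt_dom]
    by_cases hVa : V a = true
    · by_cases hT : T a
      · obtain ⟨b, hb⟩ := (hpT a hVa).1 hT
        exact ⟨Encodable.encode b, true, by simp [g, hVa, hb]⟩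
      · obtain ⟨b, hb⟩ := (hnT a hVa).1 hT
        -- The same number may also decode to something accepted by the first test. For the halting
        -- of the search this does not matter.
        cases h : ((Encodable.decode (Encodable.encode b) : Option β).map (p a)).getD false with
        | true => exact ⟨Encodable.encode b, true, by simp only [g, hVa, h]; rfl⟩
        | false => exact ⟨Encodable.encode b, false, by simp only [g, hVa, h]; simp [hb]⟩
    · exact ⟨0, false, by simp [g, hVa]⟩
  refine ⟨fun a => (Nat.rfindOpt (g a)).get (hdom a),
    Partrec.of_eq_tot (Partrec.rfindOpt hg) fun a => Part.get_mem _, fun a hVa => ?_⟩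
  obtain ⟨k, hk⟩ := Nat.rfindOpt_spec (Part.get_mem (hdom a))
  exact hspec a k _ hk hVa

/-! ### Iterated partial steps -/

/-- The result of a sequence of partial steps with the given labels. -/
def walk {σ β : Type*} (f : σ → β → Option σ) (s : σ) (l : List β) : Option σ :=
  l.foldl (fun o b => o.bind fun s => f s b) (some s)

theorem foldl_bind_none {σ β : Type*} (f : σ → β → Option σ) (l : List β) :
    l.foldl (fun o b => o.bind fun s => f s b) none = none := by
  induction l with
  | nil => rfl
  | cons b l ih => exact ih

theorem walk_cons {σ β : Type*} (f : σ → β → Option σ) (s : σ) (b : β) (l : List β) :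
    walk f s (b :: l) = (f s b).bind fun s' => walk f s' l := by
  rcases h : f s b with _ | s'
  · simp only [walk, List.foldl_cons, Option.bind_some, h, Option.bind_none, foldl_bind_none]
  · simp only [walk, List.foldl_cons, Option.bind_some, h]

theorem exists_walk_iff {σ β : Type*} (f : σ → β → Option σ) (s s' : σ) :
    (∃ l, walk f s l = some s') ↔ Relation.ReflTransGen (fun a b => ∃ x, f a x = some b) s s' := by
  constructor
  · rintro ⟨l, hl⟩
    induction l generalizing s with
    | nil => obtain rfl := Option.some.inj hl; exact .refl
    | cons b l ih =>
      rw [walk_cons] at hl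
      obtain ⟨t, ht, hl⟩ := Option.bind_eq_some_iff.1 hl
      exact .head ⟨b, ht⟩ (ih t hl)
  · intro h
    induction h using Relation.ReflTransGen.head_induction_on with
    | refl => exact ⟨[], rfl⟩
    | head h _ ih =>
      obtain ⟨b, hb⟩ := h
      obtain ⟨l, hl⟩ := ih
      exact ⟨b :: l, by rw [walk_cons, hb]; exact hl⟩

@[fun_prop]
theorem Primrec.app_walk {α β σ : Type*} [Primcodable α] [Primcodable β] [Primcodable σ]
    {f : α → σ → β → Option σ} {s : α → σ} {l : α → List β}
    (hf : Primrec fun p : α × σ × β => f p.1 p.2.1 p.2.2) (hs : Primrec s) (hl : Primrec l) :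
    Primrec fun a => walk (f a) (s a) (l a) := by
  have h : Primrec fun x : (α × Option σ × β) × σ => f x.1.1 x.2 x.1.2.2 :=
    hf.comp (by fun_prop : Primrec fun x : (α × Option σ × β) × σ => (x.1.1, x.2, x.1.2.2))
  unfold walk
  fun_prop

/-- By hypothesis a step from a coded element ends in a coded element, so the coded paths are the
images of the actual ones. -/
theorem reflTransGen_map_iff {α β : Type*} {r : α → α → Prop} {s : β → β → Prop} {φ : α → β}
    (h : ∀ a y, s (φ a) y ↔ ∃ a', r a a' ∧ φ a' = y) (a : α) (y : β) :
    Relation.ReflTransGen s (φ a) y ↔ ∃ a', Relation.ReflTransGen r a a' ∧ φ a' = y := by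
  constructor
  · intro hy
    induction hy with
    | refl => exact ⟨a, .refl, rfl⟩
    | tail _ hstep ih =>
      obtain ⟨b, hb, rfl⟩ := ih
      obtain ⟨c, hc, rfl⟩ := (h _ _).1 hstep
      exact ⟨c, hb.tail hc, rfl⟩
  · rintro ⟨a', ha', rfl⟩
    exact ha'.lift φ fun b c hbc => (h b _).2 ⟨c, hbc, rfl⟩

namespace UTA
variable {Q X : Type*}

/-! ### Codes of automata -/

section Codes

theorem exists_map_eq {α β : Type*} {f : α → β} {l : List β} (h : ∀ b ∈ l, ∃ a, f a = b) :
    ∃ L : List α, L.map f = l := by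
  have : l ∈ Set.range (List.map f) := by
    rw [Set.range_list_map]
    exact h
  exact this

/-- The codes of constraints on `m` clocks. -/
def validConstraint (m : ℕ) : ConstraintCode → Bool :=
  Sum.elim (fun p => decide (p.1 < m)) (Sum.elim (fun p => decide (p.2.2 < m)) fun p =>
    decide (p.1 < m) && (decide (p.2.1 < m) &&
      (decide (p.2.2.2.1 = 0) || decide (p.2.2.2.2 = 0))))

/-- The codes of atomic updates for `m` clocks. -/
def validUpdate (m : ℕ) : AtomicUpdateCode → Bool :=
  Sum.elim (fun _ => true) fun p => decide (p.1 < m) && (decide (p.2.1 = 0) || decide (p.2.2 = 0))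

/-- The codes of transitions for `n` states and `m` clocks. -/
def validTransition (n m : ℕ) (t : TransitionCode) : Bool :=
  decide (t.1 < n) && (decide (t.2.2.2 < n) && (t.2.1.all (fun φ => validConstraint m φ) &&
    (decide (t.2.2.1.length = m) && t.2.2.1.all fun u => validUpdate m u)))

/-- The codes of automata. -/
def validCode (c : AutomatonCode) : Bool :=
  decide (c.2.2.1 < c.1) && (c.2.2.2.1.all (fun t => validTransition c.1 c.2.1 t) &&
    c.2.2.2.2.all fun q => decide (q < c.1))

@[fun_prop] theorem primrec_validConstraint {α : Type*} [Primcodable α] {f : α → ℕ}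
    {g : α → ConstraintCode} (hf : Primrec f) (hg : Primrec g) :
    Primrec fun a => validConstraint (f a) (g a) := by
  unfold validConstraint
  fun_prop

@[fun_prop] theorem primrec_validUpdate {α : Type*} [Primcodable α] {f : α → ℕ}
    {g : α → AtomicUpdateCode} (hf : Primrec f) (hg : Primrec g) :
    Primrec fun a => validUpdate (f a) (g a) := by
  unfold validUpdate
  fun_prop

@[fun_prop] theorem primrec_validTransition {α : Type*} [Primcodable α] {f g : α → ℕ}
    {h : α → TransitionCode} (hf : Primrec f) (hg : Primrec g) (hh : Primrec h) :
    Primrec fun a => validTransition (f a) (g a) (h a) := by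
  unfold validTransition
  fun_prop

@[fun_prop] theorem primrec_validCode {α : Type*} [Primcodable α] {f : α → AutomatonCode}
    (hf : Primrec f) : Primrec fun a => validCode (f a) := by
  unfold validCode
  fun_prop

theorem exists_intCode {a b : ℕ} (h : a = 0 ∨ b = 0) : intCode ((a : ℤ) - b) = (a, b) := by
  simp only [intCode, Prod.mk.injEq]
  omega

theorem intCode_eq_zero (d : ℤ) : (intCode d).1 = 0 ∨ (intCode d).2 = 0 := by
  simp only [intCode]
  omega

theorem intCode_sub (d : ℤ) : ((intCode d).1 : ℤ) - (intCode d).2 = d := by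
  simp only [intCode]
  omega

theorem Cmp.exists_code_eq (b : Bool) : ∃ s : Cmp, s.code = b := by
  cases b
  · exact ⟨.le, rfl⟩
  · exact ⟨.lt, rfl⟩

theorem validConstraint_iff {m : ℕ} (c : ConstraintCode) :
    validConstraint m c = true ↔ ∃ φ : Constraint (Fin m), φ.code = c := by
  constructor
  · intro h
    rcases c with ⟨x, b, c⟩ | ⟨c, b, x⟩ | ⟨x, y, b, p⟩ <;> obtain ⟨s, rfl⟩ := Cmp.exists_code_eq b <;>
      simp [validConstraint] at h
    · exact ⟨.upper ⟨x, h⟩ s c, rfl⟩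
    · exact ⟨.lower c s ⟨x, h⟩, rfl⟩
    · obtain ⟨hx, hy, hp⟩ := h
      exact ⟨.diag ⟨x, hx⟩ ⟨y, hy⟩ s (p.1 - p.2), by simp [Constraint.code, exists_intCode hp]⟩
  · rintro ⟨φ, rfl⟩
    rcases φ with ⟨x, s, c⟩ | ⟨c, s, x⟩ | ⟨x, y, s, d⟩ <;>
      simp [validConstraint, Constraint.code, intCode_eq_zero]

theorem validUpdate_iff {m : ℕ} (c : AtomicUpdateCode) :
    validUpdate m c = true ↔ ∃ a : AtomicUpdate (Fin m), a.code = c := by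
  constructor
  · intro h
    rcases c with c | ⟨y, p⟩ <;> simp [validUpdate] at h
    · exact ⟨.const c, rfl⟩
    · exact ⟨.shift ⟨y, h.1⟩ (p.1 - p.2), by simp [AtomicUpdate.code, exists_intCode h.2]⟩
  · rintro ⟨a, rfl⟩
    rcases a with c | ⟨y, d⟩ <;> simp [validUpdate, AtomicUpdate.code, intCode_eq_zero]

theorem validTransition_iff {n m : ℕ} (c : TransitionCode) :
    validTransition n m c = true ↔ ∃ t : Transition (Fin n) (Fin m), t.code = c := by
  obtain ⟨q, g, u, q'⟩ := c
  constructor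
  · intro h
    simp only [validTransition, Bool.and_eq_true, decide_eq_true_eq, List.all_eq_true,
      validConstraint_iff, validUpdate_iff] at h
    obtain ⟨hq, hq', hg, rfl, hu⟩ := h
    obtain ⟨g, rfl⟩ := exists_map_eq hg
    choose up hup using fun x : Fin u.length => hu _ (List.getElem_mem x.2)
    refine ⟨⟨⟨q, hq⟩, g, up, ⟨q', hq'⟩⟩, ?_⟩
    simp [Transition.code, hup]
  · rintro ⟨t, h⟩
    simp only [Transition.code, Prod.mk.injEq] at h
    obtain ⟨rfl, rfl, rfl, rfl⟩ := h
    simp [validTransition, validConstraint_iff, validUpdate_iff]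

/-- The list of accepting states in `Automaton.code` unfolds to a monadic bind of singletons; this
is its normal form as a map. -/
theorem Automaton.code_eq {n m : ℕ} (A : Automaton (Fin n) (Fin m)) :
    A.code = (n, m, (A.init : ℕ), A.trans.map Transition.code, A.accepting.map Fin.val) := by
  have (l : List (Fin n)) : l.flatMap (fun q => [Fin.val q]) = l.map Fin.val :=
    List.flatMap_pure_eq_map _ l
  simp only [code, List.map_id', List.bind_eq_flatMap, List.pure_def, this]

theorem validCode_iff (c : AutomatonCode) :
    validCode c = true ↔ ∃ (n m : ℕ) (A : Automaton (Fin n) (Fin m)), A.code = c := by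
  obtain ⟨n, m, q, ts, acc⟩ := c
  constructor
  · intro h
    simp only [validCode, Bool.and_eq_true, decide_eq_true_eq, List.all_eq_true,
      validTransition_iff] at h
    obtain ⟨hq, ht, ha⟩ := h
    obtain ⟨ts, rfl⟩ := exists_map_eq ht
    obtain ⟨acc, rfl⟩ :=
      exists_map_eq (f := Fin.val (n := n)) (l := acc) fun a h => ⟨⟨a, ha a h⟩, rfl⟩
    exact ⟨n, m, ⟨⟨q, hq⟩, ts, acc⟩, Automaton.code_eq _⟩
  · rintro ⟨n', m', A, h⟩
    simp only [Automaton.code_eq, Prod.mk.injEq] at h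
    obtain ⟨rfl, rfl, rfl, rfl, rfl⟩ := h
    simp [validCode, validTransition_iff]

/-! ### Difference constraints as codes -/

abbrev DiffCode := ℕ × ℕ × Bool × ℤ

/-- The number of a clock; the number of `none` is `0`. -/
def clockCode {m : ℕ} : Option (Fin m) → ℕ
  | none => 0
  | some x => x + 1

theorem clockCode_injective {m : ℕ} : Function.Injective (clockCode (m := m)) := by
  rintro (_ | x) (_ | y) h <;> simp_all [clockCode, Fin.ext_iff]

@[simp] theorem clockCode_eq_zero {m : ℕ} (i : Option (Fin m)) : clockCode i = 0 ↔ i = none := by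
  cases i <;> simp [clockCode]

theorem clockCode_le {m : ℕ} (i : Option (Fin m)) : clockCode i < m + 1 := by
  cases i <;> simp [clockCode]

theorem exists_clockCode {m k : ℕ} (hk : k < m + 1) : ∃ i : Option (Fin m), clockCode i = k := by
  cases k with
  | zero => exact ⟨none, rfl⟩
  | succ k => exact ⟨some ⟨k, by omega⟩, rfl⟩

def Diff.code {m : ℕ} (e : Diff (Fin m)) : DiffCode :=
  (clockCode e.1, clockCode e.2.1, e.2.2.1.code, e.2.2.2)

theorem Diff.code_injective {m : ℕ} : Function.Injective (Diff.code (m := m)) := by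
  rintro ⟨i, j, s, d⟩ ⟨i', j', s', d'⟩ h
  simp only [Diff.code, Prod.mk.injEq, clockCode_injective.eq_iff, Cmp.code_injective.eq_iff] at h
  simp [h]

/-- The difference constraint of a coded constraint. -/
def constraintDiff : ConstraintCode → DiffCode :=
  Sum.elim (fun p => (p.1 + 1, 0, p.2.1, (p.2.2 : ℤ)))
    (Sum.elim (fun p => (0, p.2.2 + 1, p.2.1, -(p.1 : ℤ)))
      fun p => (p.1 + 1, p.2.1 + 1, p.2.2.1, (p.2.2.2.1 : ℤ) - (p.2.2.2.2 : ℤ)))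

@[fun_prop] theorem primrec_constraintDiff : Primrec constraintDiff := by
  unfold constraintDiff
  fun_prop

theorem constraintDiff_code {m : ℕ} (φ : Constraint (Fin m)) :
    constraintDiff φ.code = Diff.code φ.diff := by
  rcases φ with ⟨x, s, c⟩ | ⟨c, s, x⟩ | ⟨x, y, s, d⟩ <;>
    simp [constraintDiff, Constraint.code, Diff.code, Constraint.diff, clockCode, intCode_sub]

/-- The source of a coded atomic update. -/
def updateCodeSource : AtomicUpdateCode → ℕ × ℤ :=
  Sum.elim (fun c => (0, (c : ℤ))) fun p => (p.1 + 1, (p.2.1 : ℤ) - (p.2.2 : ℤ))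

@[fun_prop] theorem primrec_updateCodeSource : Primrec updateCodeSource := by
  unfold updateCodeSource
  fun_prop

theorem updateCodeSource_code {m : ℕ} (a : AtomicUpdate (Fin m)) :
    updateCodeSource a.code = (clockCode a.source.1, a.source.2) := by
  rcases a with c | ⟨y, d⟩ <;>
    simp [updateCodeSource, AtomicUpdate.code, AtomicUpdate.source, clockCode, intCode_sub]

/-- The source of the clock number `i` under a coded update. -/
def sourceCode (u : List AtomicUpdateCode) (i : ℕ) : ℕ × ℤ :=
  ((0, 0) :: u.map updateCodeSource).getD i (0, 0)

@[fun_prop] theorem primrec_sourceCode {α : Type*} [Primcodable α] {f : α → List AtomicUpdateCode}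
    {g : α → ℕ} (hf : Primrec f) (hg : Primrec g) : Primrec fun a => sourceCode (f a) (g a) := by
  unfold sourceCode
  fun_prop

theorem sourceCode_code {m : ℕ} (up : Update (Fin m)) (i : Option (Fin m)) :
    sourceCode (List.ofFn fun x => (up x).code) (clockCode i) =
      (clockCode (updateSource up i).1, (updateSource up i).2) := by
  cases i with
  | none => rfl
  | some x => simp [sourceCode, clockCode, updateSource, updateCodeSource_code]

/-- Substitution of a coded update. -/
def substCode (u : List AtomicUpdateCode) (e : DiffCode) : DiffCode :=
  ((sourceCode u e.1).1, (sourceCode u e.2.1).1, e.2.2.1,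
    e.2.2.2 - (sourceCode u e.1).2 + (sourceCode u e.2.1).2)

@[fun_prop] theorem primrec_substCode {α : Type*} [Primcodable α] {f : α → List AtomicUpdateCode}
    {g : α → DiffCode} (hf : Primrec f) (hg : Primrec g) :
    Primrec fun a => substCode (f a) (g a) := by
  unfold substCode
  fun_prop

theorem substCode_code {m : ℕ} (up : Update (Fin m)) (e : Diff (Fin m)) :
    substCode (List.ofFn fun x => (up x).code) e.code = Diff.code (substDiff up e) := by
  simp only [substCode, Diff.code, sourceCode_code, substDiff]

def properCode (e : DiffCode) : Bool :=
  !decide (e.1 = e.2.1) && ((!decide (e.2.1 = 0) || decide (0 ≤ e.2.2.2)) &&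
    (!decide (e.1 = 0) || decide (e.2.2.2 ≤ 0)))

@[fun_prop] theorem primrec_properCode : Primrec properCode := by
  unfold properCode
  fun_prop

theorem properCode_code {m : ℕ} (e : Diff (Fin m)) : properCode e.code = true ↔ e.Proper := by
  simp only [properCode, Bool.and_eq_true, Bool.or_eq_true, Bool.not_eq_true',
    decide_eq_false_iff_not, decide_eq_true_eq, ← imp_iff_not_or]
  simp only [Diff.code, Diff.Proper, clockCode_injective.eq_iff, clockCode_eq_zero, ne_eq]

/-! ### Deciding whether the state-based guards are finite -/

abbrev ItemCode := ℕ × DiffCode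

def itemCode {n m : ℕ} (e : Fin n × Diff (Fin m)) : ItemCode := (e.1, Diff.code e.2)

theorem itemCode_injective {n m : ℕ} : Function.Injective (itemCode (n := n) (m := m)) := by
  rintro ⟨q, e⟩ ⟨q', e'⟩ h
  simp only [itemCode, Prod.mk.injEq, Diff.code_injective.eq_iff, Fin.val_inj] at h
  simp [h]

/-- The result of the substitution into `x ≥ 0`, for the clock number `x`. -/
def nonnegCode (t : TransitionCode) (x : ℕ) : DiffCode := substCode t.2.2.1 (0, x + 1, false, 0)

@[fun_prop] theorem primrec_nonnegCode {α : Type*} [Primcodable α] {f : α → TransitionCode}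
    {g : α → ℕ} (hf : Primrec f) (hg : Primrec g) : Primrec fun a => nonnegCode (f a) (g a) := by
  unfold nonnegCode
  fun_prop

theorem nonnegCode_code {n m : ℕ} (t : Transition (Fin n) (Fin m)) (x : Fin m) :
    nonnegCode t.code x = Diff.code (substDiff t.update (none, some x, .le, 0)) :=
  substCode_code t.update (none, some x, .le, 0)

/-- Membership of an item in a list. -/
def memCode (S : List ItemCode) (e : ItemCode) : Bool := S.any fun e' => decide (e' = e)

theorem memCode_iff (S : List ItemCode) (e : ItemCode) : memCode S e = true ↔ e ∈ S := by
  simp [memCode]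

@[fun_prop] theorem primrec_memCode {α : Type*} [Primcodable α] {f : α → List ItemCode}
    {g : α → ItemCode} (hf : Primrec f) (hg : Primrec g) : Primrec fun a => memCode (f a) (g a) := by
  unfold memCode
  fun_prop

/-- The list of items contains the guards that are generated. -/
def closedCode (c : AutomatonCode) (S : List ItemCode) : Bool :=
  c.2.2.2.1.all fun t =>
    (t.2.1.all fun φ => memCode S (t.1, constraintDiff φ)) &&
      (((List.range c.2.1).all fun x =>
        !properCode (nonnegCode t x) || memCode S (t.1, nonnegCode t x)) &&
      S.all fun e => !decide (t.2.2.2 = e.1) || (!properCode (substCode t.2.2.1 e.2) ||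
        memCode S (t.1, substCode t.2.2.1 e.2)))

@[fun_prop] theorem primrec_closedCode {α : Type*} [Primcodable α] {f : α → AutomatonCode}
    {g : α → List ItemCode} (hf : Primrec f) (hg : Primrec g) :
    Primrec fun a => closedCode (f a) (g a) := by
  unfold closedCode
  fun_prop

end Codes

end UTA

namespace UTA
variable {Q X : Type*}

/-! ### Certificates for finite and for infinite guards -/

section FiniteGuards

open Relation

variable {n m : ℕ} (A : Automaton (Fin n) (Fin m))

@[simp] theorem Automaton.code_numClocks : A.code.2.1 = m := rfl

@[simp] theorem Automaton.code_init : A.code.2.2.1 = A.init := rfl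

@[simp] theorem Automaton.code_trans : A.code.2.2.2.1 = A.trans.map Transition.code := rfl

@[simp] theorem Automaton.code_accepting : A.code.2.2.2.2 = A.accepting.map Fin.val :=
  congrArg (fun c => c.2.2.2.2) A.code_eq

@[simp] theorem Transition.code_src (t : Transition (Fin n) (Fin m)) : t.code.1 = t.src := rfl

@[simp] theorem Transition.code_guard (t : Transition (Fin n) (Fin m)) :
    t.code.2.1 = t.guard.map Constraint.code := rfl

@[simp] theorem Transition.code_update (t : Transition (Fin n) (Fin m)) :
    t.code.2.2.1 = List.ofFn fun x => (t.update x).code := rfl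

@[simp] theorem Transition.code_tgt (t : Transition (Fin n) (Fin m)) : t.code.2.2.2 = t.tgt := rfl

variable {A}

theorem closedCode_iff (S : List ItemCode) : closedCode A.code S = true ↔ ∀ t ∈ A.trans,
    (∀ φ ∈ t.guard, itemCode (t.src, φ.diff) ∈ S) ∧
    (∀ x, (substDiff t.update (none, some x, .le, 0)).Proper →
      itemCode (t.src, substDiff t.update (none, some x, .le, 0)) ∈ S) ∧
    ∀ e ∈ S, (t.tgt : ℕ) = e.1 → properCode (substCode t.code.2.2.1 e.2) = true →
      ((t.src : ℕ), substCode t.code.2.2.1 e.2) ∈ S := by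
  have hx : ∀ p : ℕ → Prop, (∀ x < m, p x) ↔ ∀ x : Fin m, p x := fun p =>
    ⟨fun h x => h x x.2, fun h x hx => h ⟨x, hx⟩⟩
  simp only [closedCode, Automaton.code_trans, List.all_map, List.all_eq_true, Function.comp,
    Bool.and_eq_true, Transition.code_guard, Automaton.code_numClocks, List.mem_range,
    Bool.or_eq_true, Bool.not_eq_true', ← Bool.not_eq_true, memCode_iff, hx, nonnegCode_code,
    properCode_code, constraintDiff_code, ← imp_iff_not_or,
    decide_eq_true_eq]
  rfl

theorem substCode_transition (t : Transition (Fin n) (Fin m)) (e : Diff (Fin m)) :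
    substCode t.code.2.2.1 (Diff.code e) = Diff.code (substDiff t.update e) :=
  substCode_code _ _

theorem cond_eq_some_iff {α : Type*} {b : Bool} {a y : α} :
    (bif b then some a else none) = some y ↔ b = true ∧ a = y := by
  cases b <;> simp

/-- Propagation of an item along the transition number `k`. -/
def itemStepCode (c : AutomatonCode) (e : ItemCode) (k : ℕ) : Option ItemCode :=
  (c.2.2.2.1[k]?).bind fun t =>
    bif decide (t.2.2.2 = e.1) && properCode (substCode t.2.2.1 e.2) then
      some (t.1, substCode t.2.2.1 e.2) else none

@[fun_prop] theorem primrec_itemStepCode {α : Type*} [Primcodable α] {f : α → AutomatonCode}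
    {g : α → ItemCode} {h : α → ℕ} (hf : Primrec f) (hg : Primrec g) (hh : Primrec h) :
    Primrec fun a => itemStepCode (f a) (g a) (h a) := by
  unfold itemStepCode
  fun_prop

theorem itemStepCode_eq_some_iff {c : AutomatonCode} {e y : ItemCode} {k : ℕ} :
    itemStepCode c e k = some y ↔ ∃ t, c.2.2.2.1[k]? = some t ∧
      (t.2.2.2 = e.1 ∧ properCode (substCode t.2.2.1 e.2) = true) ∧
        (t.1, substCode t.2.2.1 e.2) = y := by
  simp only [itemStepCode, Option.bind_eq_some_iff, cond_eq_some_iff, Bool.and_eq_true,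
    decide_eq_true_eq]

theorem itemStepCode_iff (e : Fin n × Diff (Fin m)) (y : ItemCode) :
    (∃ k, itemStepCode A.code (itemCode e) k = some y) ↔
      ∃ e', A.ItemStep e e' ∧ itemCode e' = y := by
  simp only [itemStepCode_eq_some_iff]
  constructor
  · rintro ⟨k, t, hk, ⟨htgt, hp⟩, rfl⟩
    obtain ⟨t, ht, rfl⟩ := List.mem_map.1 (List.mem_of_getElem? hk)
    simp only [itemCode, substCode_transition, properCode_code] at hp ⊢
    exact ⟨(t.src, _), ⟨t, ht, Fin.val_injective htgt, rfl, rfl, hp⟩, rfl⟩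
  · rintro ⟨⟨q, e'⟩, ⟨t, ht, htgt, rfl, rfl, hp⟩, rfl⟩
    obtain ⟨k, hk⟩ := List.mem_iff_getElem?.1 ht
    refine ⟨k, t.code, by simp [hk], ⟨congrArg Fin.val htgt, ?_⟩, ?_⟩
    · rw [itemCode, substCode_transition, properCode_code]
      exact hp
    · rw [itemCode, substCode_transition]
      rfl

/-- The item is one of those from which the guards are generated. -/
def baseCode (c : AutomatonCode) (b : ItemCode) : Bool :=
  c.2.2.2.1.any fun t => decide (t.1 = b.1) &&
    ((t.2.1.any fun φ => decide (constraintDiff φ = b.2)) ||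
      (List.range c.2.1).any fun x => decide (b.2 = nonnegCode t x) && properCode b.2)

@[fun_prop] theorem primrec_baseCode {α : Type*} [Primcodable α] {f : α → AutomatonCode}
    {g : α → ItemCode} (hf : Primrec f) (hg : Primrec g) :
    Primrec fun a => baseCode (f a) (g a) := by
  unfold baseCode
  fun_prop

theorem baseCode_iff (y : ItemCode) :
    baseCode A.code y = true ↔ ∃ b, A.BaseItem b ∧ itemCode b = y := by
  have hx : ∀ p : ℕ → Prop, (∃ x < m, p x) ↔ ∃ x : Fin m, p x := fun p => by
    rw [Fin.exists_iff]; simp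
  have h1 : baseCode A.code y = true ↔ ∃ t ∈ A.trans, (t.src : ℕ) = y.1 ∧
      ((∃ φ ∈ t.guard, Diff.code φ.diff = y.2) ∨
        ∃ x, y.2 = Diff.code (substDiff t.update (none, some x, .le, 0)) ∧
          properCode y.2 = true) := by
    simp only [baseCode, Automaton.code_trans, List.any_map, List.any_eq_true, Function.comp,
      Bool.and_eq_true, Transition.code_guard, Automaton.code_numClocks, List.mem_range,
      Bool.or_eq_true, hx, nonnegCode_code, constraintDiff_code, decide_eq_true_eq]
    rfl
  rw [h1]
  constructor
  · rintro ⟨t, ht, hsrc, ⟨φ, hφ, he⟩ | ⟨x, he, hp⟩⟩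
    · exact ⟨(t.src, φ.diff), ⟨t, ht, rfl, .inl ⟨φ, hφ, rfl⟩⟩, Prod.ext hsrc he⟩
    · rw [he, properCode_code] at hp
      exact ⟨(t.src, _), ⟨t, ht, rfl, .inr ⟨x, rfl, hp⟩⟩, Prod.ext hsrc he.symm⟩
  · rintro ⟨⟨q, e⟩, ⟨t, ht, rfl, ⟨φ, hφ, rfl⟩ | ⟨x, rfl, hp⟩⟩, rfl⟩
    · exact ⟨t, ht, rfl, .inl ⟨φ, hφ, rfl⟩⟩
    · exact ⟨t, ht, rfl, .inr ⟨x, rfl, (properCode_code _).2 hp⟩⟩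

def growsCode (e e' : ItemCode) : Bool :=
  decide (e'.1 = e.1) && (decide (e'.2.1 = e.2.1) && (decide (e'.2.2.1 = e.2.2.1) &&
    (decide (e'.2.2.2.1 = e.2.2.2.1) && (!decide (e'.2.2.2.2 = e.2.2.2.2) &&
      ((!decide (e.2.2.1 = 0) || decide (e.2.2.2.2 ≤ e'.2.2.2.2)) &&
        (!decide (e.2.1 = 0) || decide (e'.2.2.2.2 ≤ e.2.2.2.2)))))))

@[fun_prop] theorem primrec_growsCode {α : Type*} [Primcodable α] {f g : α → ItemCode}
    (hf : Primrec f) (hg : Primrec g) : Primrec fun a => growsCode (f a) (g a) := by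
  unfold growsCode
  fun_prop

theorem growsCode_iff (e e' : Fin n × Diff (Fin m)) :
    growsCode (itemCode e) (itemCode e') = true ↔ Grows e e' := by
  simp only [growsCode, Bool.and_eq_true, Bool.or_eq_true, Bool.not_eq_true',
    decide_eq_false_iff_not, decide_eq_true_eq, ← imp_iff_not_or]
  simp only [itemCode, Diff.code, Grows, clockCode_injective.eq_iff, clockCode_eq_zero,
    Cmp.code_injective.eq_iff, Fin.val_inj, ne_eq]

/-- A list that contains the base items and is closed under propagation contains everything
generated. It may contain more, also entries that code no item, which does no harm. -/
theorem finiteGuards_of_closedCode {S : List ItemCode} (h : closedCode A.code S = true) :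
    A.FiniteGuards ∧ ∀ e ∈ A.items, itemCode e ∈ S := by
  rw [closedCode_iff] at h
  have hS : ∀ e ∈ A.items, itemCode e ∈ S := by
    rintro e ⟨b, ⟨t, ht, hs, hb⟩, hbe⟩
    induction hbe with
    | refl =>
      obtain ⟨q, e⟩ := b
      subst hs
      rcases hb with ⟨φ, hφ, rfl⟩ | ⟨x, rfl, hp⟩
      · exact (h t ht).1 φ hφ
      · exact (h t ht).2.1 x hp
    | @tail e e' _ hstep ih =>
      obtain ⟨t, ht, htgt, hsrc, he, hp⟩ := hstep
      have := (h t ht).2.2 _ ih (congrArg Fin.val htgt)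
      rw [itemCode, substCode_transition, properCode_code, ← he, hsrc] at this
      exact this hp
  refine ⟨A.finiteGuards_iff_items.2 ?_, hS⟩
  exact ((List.finite_toSet S).preimage itemCode_injective.injOn).subset hS

theorem Automaton.FiniteGuards.closedCode (hA : A.FiniteGuards) :
    UTA.closedCode A.code ((A.finiteGuards_iff_items.1 hA).toFinset.toList.map itemCode) = true := by
  have hmem : ∀ e, itemCode e ∈ (A.finiteGuards_iff_items.1 hA).toFinset.toList.map itemCode ↔
      e ∈ A.items := fun e => by
    rw [List.mem_map_of_injective itemCode_injective, Finset.mem_toList, Set.Finite.mem_toFinset]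
  rw [closedCode_iff]
  simp only [hmem]
  refine fun t ht => ⟨fun φ hφ => mem_items_of_base ⟨t, ht, rfl, .inl ⟨φ, hφ, rfl⟩⟩,
    fun x hp => mem_items_of_base ⟨t, ht, rfl, .inr ⟨x, rfl, hp⟩⟩, fun y hy htgt hp => ?_⟩
  obtain ⟨e, he, rfl⟩ := List.mem_map.1 hy
  rw [Finset.mem_toList, Set.Finite.mem_toFinset] at he
  rw [itemCode, substCode_transition, properCode_code] at hp
  rw [itemCode, substCode_transition]
  exact (hmem (t.src, substDiff t.update e.2)).2
    (mem_items_of_step he ⟨t, ht, Fin.val_injective htgt, rfl, rfl, hp⟩)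

theorem finiteGuards_iff_closedCode : A.FiniteGuards ↔ ∃ S, closedCode A.code S = true :=
  ⟨fun h => ⟨_, h.closedCode⟩, fun ⟨_, h⟩ => (finiteGuards_of_closedCode h).1⟩

/-- Certificates of infinite state-based guards: the items at the start and at the end of a cycle,
the item from which the first one is generated, and the paths. -/
abbrev GrowthCode := ItemCode × ItemCode × ItemCode × List ℕ × List ℕ

def checkGrowth (c : AutomatonCode) (w : GrowthCode) : Bool :=
  baseCode c w.1 && (decide (walk (itemStepCode c) w.1 w.2.2.2.1 = some w.2.1) &&
    (decide (walk (itemStepCode c) w.2.1 w.2.2.2.2 = some w.2.2.1) && growsCode w.2.1 w.2.2.1))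

/-- The pumping criterion concerns finite paths only, and these are recorded by the indices of the
transitions taken. -/
theorem not_finiteGuards_iff_checkGrowth :
    ¬ A.FiniteGuards ↔ ∃ w, checkGrowth A.code w = true := by
  have hwalk : ∀ (e : Fin n × Diff (Fin m)) (y : ItemCode),
      (∃ l, walk (itemStepCode A.code) (itemCode e) l = some y) ↔
        ∃ e', ReflTransGen A.ItemStep e e' ∧ itemCode e' = y := fun e y => by
    rw [exists_walk_iff, reflTransGen_map_iff fun e y => itemStepCode_iff e y]
  rw [A.not_finiteGuards_iff]
  simp only [checkGrowth, Bool.and_eq_true, decide_eq_true_eq]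
  constructor
  · rintro ⟨b, e, e', hb, hbe, hee', hg⟩
    obtain ⟨l, hl⟩ := (hwalk b _).2 ⟨e, hbe, rfl⟩
    obtain ⟨l', hl'⟩ := (hwalk e _).2 ⟨e', hee', rfl⟩
    exact ⟨(itemCode b, itemCode e, itemCode e', l, l'), (baseCode_iff _).2 ⟨b, hb, rfl⟩, hl, hl',
      (growsCode_iff e e').2 hg⟩
  · rintro ⟨⟨y, e, e', l, l'⟩, hy, hl, hl', hg⟩
    obtain ⟨b, hb, rfl⟩ := (baseCode_iff _).1 hy
    obtain ⟨e, he, rfl⟩ := (hwalk b e).1 ⟨l, hl⟩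
    obtain ⟨e', he', rfl⟩ := (hwalk e e').1 ⟨l', hl'⟩
    exact ⟨b, e, e', hb, he, he', (growsCode_iff e e').1 hg⟩

@[fun_prop] theorem primrec_checkGrowth {α : Type*} [Primcodable α] {f : α → AutomatonCode}
    {g : α → GrowthCode} (hf : Primrec f) (hg : Primrec g) :
    Primrec fun a => checkGrowth (f a) (g a) := by
  have h : Primrec fun p : α × ItemCode × ℕ => itemStepCode (f p.1) p.2.1 p.2.2 := by fun_prop
  have h1 : Primrec fun a => walk (itemStepCode (f a)) (g a).1 (g a).2.2.2.1 :=
    Primrec.app_walk h (by fun_prop) (by fun_prop)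
  have h2 : Primrec fun a => walk (itemStepCode (f a)) (g a).2.1 (g a).2.2.2.2 :=
    Primrec.app_walk h (by fun_prop) (by fun_prop)
  unfold checkGrowth
  fun_prop

/-- It is decidable whether the state-based guards are finite. -/
theorem exists_computable_finiteGuards : ∃ f : AutomatonCode → Bool, Computable f ∧
    ∀ (n m : ℕ) (A : Automaton (Fin n) (Fin m)), f A.code = true ↔ A.FiniteGuards := by
  obtain ⟨f, hf, h⟩ := exists_computable_of_certificates (V := validCode)
    (T := fun c => ∃ S, closedCode c S = true) (p := closedCode) (n := checkGrowth)
    (primrec_validCode Primrec.id).to_comp (primrec_closedCode Primrec.fst Primrec.snd)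
    (primrec_checkGrowth Primrec.fst Primrec.snd) (fun _ _ => Iff.rfl) fun c hc => by
      obtain ⟨n, m, A, rfl⟩ := (validCode_iff c).1 hc
      rw [← finiteGuards_iff_closedCode, not_finiteGuards_iff_checkGrowth]
  refine ⟨f, hf, fun n m A => ?_⟩
  rw [h A.code ((validCode_iff _).2 ⟨n, m, A, rfl⟩), finiteGuards_iff_closedCode]

end FiniteGuards

end UTA

namespace UTA
variable {Q X : Type*}

/-! ### Runs on grids -/

section Grid

open Relation

/-- A denominator, a state, and the numerators of the values of the clocks. -/
abbrev GridCode := ℕ × ℕ × List ℕ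

/-- The valuation of a grid configuration. -/
noncomputable def gridValuation (m : ℕ) (s : GridCode) : Valuation (Fin m) :=
  fun x => (s.2.2.getD x 0 : ℝ≥0) / (s.1 : ℝ≥0)

/-- The numerator for the clock number `i`, multiplied by `c` and increased by `δ`. -/
def numerator (c : ℕ) (a : List ℕ) (δ i : ℕ) : ℕ :=
  bif decide (i = 0) then 0 else c * a.getD (i - 1) 0 + δ

@[fun_prop] theorem primrec_numerator {α : Type*} [Primcodable α] {c δ i : α → ℕ}
    {a : α → List ℕ} (hc : Primrec c) (ha : Primrec a) (hδ : Primrec δ) (hi : Primrec i) :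
    Primrec fun x => numerator (c x) (a x) (δ x) (i x) := by
  unfold numerator
  fun_prop

variable {m : ℕ}

/-- The factor 2 passes to the doubled denominator, at which the delay is `δ / (2 * s.1)`. -/
theorem numerator_two {s : GridCode} (hs : 0 < s.1) (δ : ℕ) (i : Option (Fin m)) :
    (numerator 2 s.2.2 δ (clockCode i) : ℝ) =
      point (delay (gridValuation m s) (δ / (2 * s.1 : ℕ))) i * (2 * s.1 : ℕ) := by
  have : (s.1 : ℝ) ≠ 0 := by exact_mod_cast hs.ne'
  cases i with
  | none => simp [numerator, clockCode]
  | some x =>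
    simp [numerator, clockCode, gridValuation]
    field_simp

theorem numerator_one {s : GridCode} (hs : 0 < s.1) (i : Option (Fin m)) :
    (numerator 1 s.2.2 0 (clockCode i) : ℝ) = point (gridValuation m s) i * s.1 := by
  have : (s.1 : ℝ) ≠ 0 := by exact_mod_cast hs.ne'
  cases i with
  | none => simp [numerator, clockCode]
  | some x =>
    simp [numerator, clockCode, gridValuation]
    field_simp

/-- Satisfaction of a difference constraint after the delay `δ`, at denominator `N`. -/
def satCode (N : ℕ) (a : List ℕ) (δ : ℕ) (e : DiffCode) : Bool :=
  bif e.2.2.1 then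
    decide ((numerator 2 a δ e.1 : ℤ) < (numerator 2 a δ e.2.1 : ℤ) + e.2.2.2 * (N : ℤ))
  else decide ((numerator 2 a δ e.1 : ℤ) ≤ (numerator 2 a δ e.2.1 : ℤ) + e.2.2.2 * (N : ℤ))

@[fun_prop] theorem primrec_satCode {α : Type*} [Primcodable α] {N δ : α → ℕ} {a : α → List ℕ}
    {e : α → DiffCode} (hN : Primrec N) (ha : Primrec a) (hδ : Primrec δ) (he : Primrec e) :
    Primrec fun x => satCode (N x) (a x) (δ x) (e x) := by
  unfold satCode
  fun_prop

theorem satCode_true {N : ℕ} {a : List ℕ} {δ i j : ℕ} {d : ℤ} :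
    satCode N a δ (i, j, true, d) = true ↔
      (numerator 2 a δ i : ℤ) < (numerator 2 a δ j : ℤ) + d * (N : ℤ) := by
  simp [satCode]

theorem satCode_false {N : ℕ} {a : List ℕ} {δ i j : ℕ} {d : ℤ} :
    satCode N a δ (i, j, false, d) = true ↔
      (numerator 2 a δ i : ℤ) ≤ (numerator 2 a δ j : ℤ) + d * (N : ℤ) := by
  simp [satCode]

theorem satCode_iff {s : GridCode} (hs : 0 < s.1) (δ : ℕ) (φ : Constraint (Fin m)) :
    satCode (2 * s.1) s.2.2 δ (constraintDiff φ.code) = true ↔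
      φ.sat (delay (gridValuation m s) (δ / (2 * s.1 : ℕ))) := by
  rw [constraintDiff_code, Constraint.sat_iff]
  have hpos : (0 : ℝ) < (2 * s.1 : ℕ) := by exact_mod_cast Nat.mul_pos two_pos hs
  obtain ⟨i, j, c, d⟩ := φ.diff
  set p := point (delay (gridValuation m s) (δ / (2 * s.1 : ℕ))) with hp
  cases c <;> simp only [Diff.code, Cmp.code, satCode_true, satCode_false, Cmp.holds]
  · rw [← @Int.cast_lt ℝ]
    push_cast only [Int.cast_natCast, Int.cast_add, Int.cast_mul]
    rw [numerator_two hs, numerator_two hs, ← hp, ← add_mul, mul_lt_mul_iff_left₀ hpos,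
      sub_lt_iff_lt_add']
  · rw [← @Int.cast_le ℝ]
    push_cast only [Int.cast_natCast, Int.cast_add, Int.cast_mul]
    rw [numerator_two hs, numerator_two hs, ← hp, ← add_mul, mul_le_mul_iff_left₀ hpos,
      sub_le_iff_le_add']

/-- The new numerator of a clock with the given source. -/
def updateNumerator (N : ℕ) (a : List ℕ) (δ : ℕ) (u : ℕ × ℤ) : ℤ :=
  (numerator 2 a δ u.1 : ℤ) + u.2 * (N : ℤ)

@[fun_prop] theorem primrec_updateNumerator {α : Type*} [Primcodable α] {N δ : α → ℕ}
    {a : α → List ℕ} {u : α → ℕ × ℤ} (hN : Primrec N) (ha : Primrec a) (hδ : Primrec δ)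
    (hu : Primrec u) : Primrec fun x => updateNumerator (N x) (a x) (δ x) (u x) := by
  unfold updateNumerator
  fun_prop

theorem updateNumerator_eq {s : GridCode} (hs : 0 < s.1) (δ : ℕ) (up : Update (Fin m)) (x : Fin m) :
    (updateNumerator (2 * s.1) s.2.2 δ (updateCodeSource (up x).code) : ℝ) =
      applyUpdate up (delay (gridValuation m s) (δ / (2 * s.1 : ℕ))) x * (2 * s.1 : ℕ) := by
  rw [updateCodeSource_code, applyUpdate, AtomicUpdate.eval_eq, add_mul, ← numerator_two hs]
  simp [updateNumerator]

/-- A step on a grid: a delay `δ` at the double denominator and the transition number `k`. -/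
def gridStep (c : AutomatonCode) (s : GridCode) (l : ℕ × ℕ) : Option GridCode :=
  (c.2.2.2.1[l.2]?).bind fun t =>
    bif decide (t.1 = s.2.1) &&
      ((t.2.1.all fun φ => satCode (2 * s.1) s.2.2 l.1 (constraintDiff φ)) &&
      t.2.2.1.all fun u => decide (0 ≤ updateNumerator (2 * s.1) s.2.2 l.1 (updateCodeSource u))) then
      some (2 * s.1, t.2.2.2,
        t.2.2.1.map fun u => (updateNumerator (2 * s.1) s.2.2 l.1 (updateCodeSource u)).toNat)
    else none

@[fun_prop] theorem primrec_gridStep {α : Type*} [Primcodable α] {c : α → AutomatonCode}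
    {s : α → GridCode} {l : α → ℕ × ℕ} (hc : Primrec c) (hs : Primrec s) (hl : Primrec l) :
    Primrec fun x => gridStep (c x) (s x) (l x) := by
  unfold gridStep
  fun_prop

theorem gridStep_eq_some_iff {c : AutomatonCode} {s y : GridCode} {l : ℕ × ℕ} :
    gridStep c s l = some y ↔ ∃ t, c.2.2.2.1[l.2]? = some t ∧
      (t.1 = s.2.1 ∧ (∀ φ ∈ t.2.1, satCode (2 * s.1) s.2.2 l.1 (constraintDiff φ) = true) ∧
        ∀ u ∈ t.2.2.1, 0 ≤ updateNumerator (2 * s.1) s.2.2 l.1 (updateCodeSource u)) ∧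
      (2 * s.1, t.2.2.2, t.2.2.1.map fun u =>
        (updateNumerator (2 * s.1) s.2.2 l.1 (updateCodeSource u)).toNat) = y := by
  simp only [gridStep, Option.bind_eq_some_iff, cond_eq_some_iff, Bool.and_eq_true,
    decide_eq_true_eq, List.all_eq_true]

variable {n : ℕ} {A : Automaton (Fin n) (Fin m)}

/-- The configuration that is reached on the grid. -/
theorem gridValuation_map {s : GridCode} (hs : 0 < s.1) (δ q : ℕ) (up : Update (Fin m))
    (h : ∀ x, 0 ≤ applyUpdate up (delay (gridValuation m s) (δ / (2 * s.1 : ℕ))) x) (x : Fin m) :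
    (gridValuation m (2 * s.1, q, (List.ofFn fun x => (up x).code).map fun u =>
      (updateNumerator (2 * s.1) s.2.2 δ (updateCodeSource u)).toNat) x : ℝ) =
        applyUpdate up (delay (gridValuation m s) (δ / (2 * s.1 : ℕ))) x := by
  have hpos : (0 : ℝ) < (2 * s.1 : ℕ) := by exact_mod_cast Nat.mul_pos two_pos hs
  have h1 := updateNumerator_eq hs δ up x
  have h2 : 0 ≤ updateNumerator (2 * s.1) s.2.2 δ (updateCodeSource (up x).code) := by
    have : (0 : ℝ) ≤ updateNumerator (2 * s.1) s.2.2 δ (updateCodeSource (up x).code) := by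
      rw [h1]
      exact mul_nonneg (h x) hpos.le
    exact_mod_cast this
  have h3 : ((updateNumerator (2 * s.1) s.2.2 δ (updateCodeSource (up x).code)).toNat : ℝ) =
      updateNumerator (2 * s.1) s.2.2 δ (updateCodeSource (up x).code) := by
    exact_mod_cast Int.toNat_of_nonneg h2
  have h4 : ((List.ofFn fun x => (up x).code).map fun u =>
      (updateNumerator (2 * s.1) s.2.2 δ (updateCodeSource u)).toNat).getD x 0 =
        (updateNumerator (2 * s.1) s.2.2 δ (updateCodeSource (up x).code)).toNat := by
    simp
  simp only [gridValuation, h4, NNReal.coe_div, NNReal.coe_natCast, h3, h1]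
  field_simp

theorem nonneg_iff {s : GridCode} (hs : 0 < s.1) (δ : ℕ) (up : Update (Fin m)) :
    (∀ u ∈ List.ofFn fun x => (up x).code,
        0 ≤ updateNumerator (2 * s.1) s.2.2 δ (updateCodeSource u)) ↔
      ∀ x, 0 ≤ applyUpdate up (delay (gridValuation m s) (δ / (2 * s.1 : ℕ))) x := by
  have hpos : (0 : ℝ) < (2 * s.1 : ℕ) := by exact_mod_cast Nat.mul_pos two_pos hs
  simp only [List.forall_mem_ofFn_iff]
  refine forall_congr' fun x => ?_
  rw [← @Int.cast_nonneg_iff ℝ, updateNumerator_eq hs]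
  exact ⟨fun h => nonneg_of_mul_nonneg_left h hpos, fun h => mul_nonneg h hpos.le⟩

theorem fires_of_gridStep {s y : GridCode} (hs : 0 < s.1) {l : ℕ × ℕ}
    (h : gridStep A.code s l = some y) :
    ∃ t ∈ A.trans, (t.src : ℕ) = s.2.1 ∧ y.1 = 2 * s.1 ∧ y.2.1 = t.tgt ∧
      t.Fires (delay (gridValuation m s) (l.1 / (2 * s.1 : ℕ))) (gridValuation m y) := by
  obtain ⟨t, ht, ⟨h1, h2, h3⟩, rfl⟩ := gridStep_eq_some_iff.1 h
  obtain ⟨t, htA, rfl⟩ := List.mem_map.1 (List.mem_of_getElem? ht)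
  have h4 := (nonneg_iff hs l.1 t.update).1 h3
  refine ⟨t, htA, h1, rfl, rfl, fun φ hφ => ?_, h4, gridValuation_map hs l.1 _ t.update h4⟩
  exact (satCode_iff hs l.1 φ).1 (h2 _ (List.mem_map_of_mem hφ))

theorem exists_gridStep {s : GridCode} (hs : 0 < s.1) {δ : ℕ} {t : Transition (Fin n) (Fin m)}
    (ht : t ∈ A.trans) (hsrc : (t.src : ℕ) = s.2.1) {v' : Valuation (Fin m)}
    (hf : t.Fires (delay (gridValuation m s) (δ / (2 * s.1 : ℕ))) v') :
    ∃ k < A.trans.length, ∃ y, gridStep A.code s (δ, k) = some y ∧ y.1 = 2 * s.1 ∧ y.2.1 = t.tgt ∧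
      gridValuation m y = v' := by
  obtain ⟨k, hk, hkt⟩ := List.mem_iff_getElem.1 ht
  refine ⟨k, hk, _, gridStep_eq_some_iff.2 ⟨t.code, by simp [hk, hkt], ⟨hsrc, ?_, ?_⟩, rfl⟩,
    rfl, rfl, ?_⟩
  · intro c hc
    obtain ⟨φ, hφ, rfl⟩ := List.mem_map.1 hc
    exact (satCode_iff hs δ φ).2 (hf.1 φ hφ)
  · exact (nonneg_iff hs δ t.update).2 hf.2.1
  · funext x
    apply NNReal.coe_injective
    rw [hf.2.2 x]
    exact gridValuation_map hs δ _ t.update hf.2.1 x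

/-- Every delay is region equivalent to one on the grid with the double denominator. -/
theorem exists_grid_delay {s : GridCode} (hs : 0 < s.1) {v : Valuation (Fin m)}
    (h : RegEq (point v) (point (gridValuation m s))) (δ : ℝ≥0) :
    ∃ j : ℕ, RegEq (point (delay v δ))
        (point (delay (gridValuation m s) (j / (2 * s.1 : ℕ)))) ∧
      ∀ M : ℕ, (δ : ℝ) ≤ M → j ≤ 2 * s.1 * M := by
  have hN : (0 : ℝ) < s.1 := by exact_mod_cast hs
  obtain ⟨δ', h1, h2, h3⟩ := h.delay δ
  -- The midpoint choice of the extension lemma puts twice the delay into every group containing 1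
  -- and the clock values. Applied to the multiples of `1 / s.1`, this shows that doubling the
  -- denominator suffices.
  obtain ⟨z, hz⟩ := AddSubgroup.mem_zmultiples_iff.1
    (h3 (AddSubgroup.zmultiples (1 / (s.1 : ℝ))) (fun x => by
      refine AddSubgroup.mem_zmultiples_iff.2 ⟨s.2.2.getD x 0, ?_⟩
      simp [gridValuation, div_eq_mul_inv])
    (AddSubgroup.mem_zmultiples_iff.2 ⟨s.1, by simp [hN.ne']⟩))
  have hz' : (z : ℝ) = δ' * (2 * s.1) := by
    rw [zsmul_eq_mul] at hz
    field_simp at hz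
    linarith
  have hz0 : 0 ≤ z := by
    have : (0 : ℝ) ≤ z := by rw [hz']; positivity
    exact_mod_cast this
  obtain ⟨j, rfl⟩ := Int.eq_ofNat_of_zero_le hz0
  have hδ : δ' = (j : ℝ≥0) / (2 * s.1 : ℕ) := by
    apply NNReal.coe_injective
    push_cast
    push_cast at hz'
    rw [hz']
    field_simp
  refine ⟨j, hδ ▸ h1, fun M hM => ?_⟩
  have := h2 M hM
  have h4 : (j : ℝ) ≤ 2 * s.1 * M := by
    push_cast at hz'
    rw [hz']
    nlinarith
  exact_mod_cast h4

/-- The start of runs. -/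
def gridInit (c : AutomatonCode) : GridCode := (1, c.2.2.1, [])

/-- The empty list of numerators stands for zero on every clock, by the default value of `getD`. -/
theorem gridValuation_init (A : Automaton (Fin n) (Fin m)) :
    gridValuation m (gridInit A.code) = fun _ => 0 := by
  funext x
  simp [gridValuation, gridInit]

/-- The run is copied step by step onto grids, staying region equivalent to the original; the
denominator of `s` doubles each time. -/
theorem exists_walk_of_accIn {k : ℕ} {q : Fin n} {v : Valuation (Fin m)} (h : A.AccIn k q v)
    {s : GridCode} (hs : 0 < s.1) (hq : s.2.1 = q)
    (hv : RegEq (point v) (point (gridValuation m s))) :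
    ∃ l y, walk (gridStep A.code) s l = some y ∧ ∃ q' ∈ A.accepting, y.2.1 = (q' : ℕ) := by
  induction k generalizing q v s with
  | zero => exact ⟨[], s, rfl, q, h, hq⟩
  | succ k ih =>
    obtain ⟨δ, t, ht, rfl, v', hf, hk⟩ := h
    obtain ⟨j, hj, -⟩ := exists_grid_delay hs hv δ
    obtain ⟨w', hw', he⟩ := hj.fires hf
    obtain ⟨i, -, y, hy, hy1, hy2, rfl⟩ := exists_gridStep hs ht hq.symm hw'
    obtain ⟨l, z, hl, hz⟩ := ih hk (s := y) (by omega) hy2 he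
    exact ⟨(j, i) :: l, z, by rw [walk_cons, hy]; exact hl, hz⟩

theorem exists_accIn_of_walk {l : List (ℕ × ℕ)} {s y : GridCode} (hs : 0 < s.1) {q : Fin n}
    (hq : s.2.1 = q) (h : walk (gridStep A.code) s l = some y)
    (hy : ∃ q' ∈ A.accepting, y.2.1 = (q' : ℕ)) : ∃ k, A.AccIn k q (gridValuation m s) := by
  induction l generalizing s q with
  | nil =>
    obtain rfl := Option.some.inj h
    obtain ⟨q', hq', he⟩ := hy
    exact ⟨0, Fin.val_injective (hq.symm.trans he) ▸ hq'⟩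
  | cons b l ih =>
    rw [walk_cons] at h
    obtain ⟨s', hs', hl⟩ := Option.bind_eq_some_iff.1 h
    obtain ⟨t, ht, hsrc, h1, h2, hf⟩ := fires_of_gridStep hs hs'
    obtain ⟨k, hk⟩ := ih (by omega) h2 hl
    exact ⟨k + 1, _, t, ht, Fin.val_injective (hsrc.trans hq), _, hf, hk⟩

/-- The coded state is accepting. -/
def acceptingCode (c : AutomatonCode) (q : ℕ) : Bool := c.2.2.2.2.any fun q' => decide (q' = q)

@[fun_prop] theorem primrec_acceptingCode {α : Type*} [Primcodable α] {c : α → AutomatonCode}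
    {q : α → ℕ} (hc : Primrec c) (hq : Primrec q) :
    Primrec fun x => acceptingCode (c x) (q x) := by
  unfold acceptingCode
  fun_prop

theorem acceptingCode_iff (q : ℕ) :
    acceptingCode A.code q = true ↔ ∃ q' ∈ A.accepting, q = (q' : ℕ) := by
  simp only [acceptingCode, Automaton.code_accepting, List.any_map, List.any_eq_true,
    Function.comp_apply, decide_eq_true_eq, @eq_comm _ q]

/-- Certificates of accepting runs: the labels of the steps, and the last configuration. -/
def checkRun (c : AutomatonCode) (w : List (ℕ × ℕ) × GridCode) : Bool :=
  decide (walk (gridStep c) (gridInit c) w.1 = some w.2) && acceptingCode c w.2.2.1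

theorem primrec_checkRun {α : Type*} [Primcodable α] {c : α → AutomatonCode}
    {w : α → List (ℕ × ℕ) × GridCode} (hc : Primrec c) (hw : Primrec w) :
    Primrec fun x => checkRun (c x) (w x) := by
  have h : Primrec fun p : α × GridCode × (ℕ × ℕ) => gridStep (c p.1) p.2.1 p.2.2 := by fun_prop
  have h1 : Primrec fun x => walk (gridStep (c x)) (gridInit (c x)) (w x).1 :=
    Primrec.app_walk h (by unfold gridInit; fun_prop) (by fun_prop)
  unfold checkRun
  fun_prop

theorem hasAcceptingRun_iff_checkRun : A.HasAcceptingRun ↔ ∃ w, checkRun A.code w = true := by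
  rw [A.hasAcceptingRun_iff, ← gridValuation_init A]
  simp only [checkRun, Bool.and_eq_true, decide_eq_true_eq, acceptingCode_iff]
  constructor
  · rintro ⟨k, hk⟩
    obtain ⟨l, y, h⟩ := exists_walk_of_accIn hk one_pos rfl (RegEq.refl _)
    exact ⟨(l, y), h⟩
  · rintro ⟨w, hw, hacc⟩
    exact exists_accIn_of_walk one_pos rfl hw hacc

/-! ### Certificates of the absence of accepting runs -/

/-- The two grid configurations have the same colour. -/
def colorEqCode (m M : ℕ) (s y : GridCode) : Bool :=
  (List.range (m + 1)).all fun i => (List.range (m + 1)).all fun j => (List.range (M + 1)).all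
    fun d =>
      decide (decide (numerator 1 s.2.2 0 i + d * s.1 < numerator 1 s.2.2 0 j) =
        decide (numerator 1 y.2.2 0 i + d * y.1 < numerator 1 y.2.2 0 j)) &&
      decide (decide (numerator 1 s.2.2 0 i < numerator 1 s.2.2 0 j + d * s.1) =
        decide (numerator 1 y.2.2 0 i < numerator 1 y.2.2 0 j + d * y.1))

@[fun_prop] theorem primrec_colorEqCode {α : Type*} [Primcodable α] {m M : α → ℕ}
    {s y : α → GridCode} (hm : Primrec m) (hM : Primrec M) (hs : Primrec s) (hy : Primrec y) :
    Primrec fun x => colorEqCode (m x) (M x) (s x) (y x) := by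
  unfold colorEqCode
  fun_prop

theorem numerator_add_lt_iff {s : GridCode} (hs : 0 < s.1) (i j : Option (Fin m)) (d : ℕ) :
    numerator 1 s.2.2 0 (clockCode i) + d * s.1 < numerator 1 s.2.2 0 (clockCode j) ↔
      point (gridValuation m s) i - point (gridValuation m s) j < (-d : ℤ) := by
  have hN : (0 : ℝ) < s.1 := by exact_mod_cast hs
  rw [← @Nat.cast_lt ℝ]
  push_cast
  rw [numerator_one hs, numerator_one hs, ← add_mul, mul_lt_mul_iff_left₀ hN]
  constructor <;> intro h <;> linarith

theorem numerator_lt_add_iff {s : GridCode} (hs : 0 < s.1) (i j : Option (Fin m)) (d : ℕ) :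
    numerator 1 s.2.2 0 (clockCode i) < numerator 1 s.2.2 0 (clockCode j) + d * s.1 ↔
      point (gridValuation m s) i - point (gridValuation m s) j < (d : ℤ) := by
  have hN : (0 : ℝ) < s.1 := by exact_mod_cast hs
  rw [← @Nat.cast_lt ℝ]
  push_cast
  rw [numerator_one hs, numerator_one hs, ← add_mul, mul_lt_mul_iff_left₀ hN]
  constructor <;> intro h <;> linarith

/-- The two comparisons for a natural `d` treat the constants `-d` and `d`, which together exhaust
the integers between `-M` and `M`. -/
theorem colorEqCode_iff {M : ℕ} {s y : GridCode} (hs : 0 < s.1) (hy : 0 < y.1) :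
    colorEqCode m M s y = true ↔ ColorEq M (gridValuation m s) (gridValuation m y) := by
  have hx : ∀ p : ℕ → Prop, (∀ x < m + 1, p x) ↔ ∀ i : Option (Fin m), p (clockCode i) := fun p =>
    ⟨fun h i => h _ (clockCode_le i), fun h x hx => by
      obtain ⟨i, rfl⟩ := exists_clockCode hx
      exact h i⟩
  simp only [colorEqCode, List.all_eq_true, List.mem_range, hx, Bool.and_eq_true,
    decide_eq_true_eq, decide_eq_decide, numerator_add_lt_iff hs, numerator_add_lt_iff hy,
    numerator_lt_add_iff hs, numerator_lt_add_iff hy]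
  constructor
  · intro h i j d hd
    rcases Int.eq_nat_or_neg d with ⟨k, rfl | rfl⟩
    · exact (h i j k (by simp at hd; omega)).2
    · exact (h i j k (by simp at hd; omega)).1
  · intro h i j d hd
    exact ⟨h i j (-d) (by simp; omega), h i j d (by simp; omega)⟩

/-- Certificates of the absence of accepting runs: a bound of the constants, the state-based
guards, and grid configurations that represent the reachable ones. -/
abbrev NoRunCode := ℕ × List ItemCode × List GridCode

/-- The successors of `s` are represented in `S`. -/
def coveredCode (c : AutomatonCode) (M : ℕ) (S : List GridCode) (s : GridCode) : Bool :=
  (List.range (2 * s.1 * (M + 1) + 1)).all fun δ => (List.range c.2.2.2.1.length).all fun k =>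
    ((gridStep c s (δ, k)).map fun y => S.any fun s' =>
      decide (s'.2.1 = y.2.1) && colorEqCode c.2.1 M y s').getD true

@[fun_prop] theorem primrec_coveredCode {α : Type*} [Primcodable α] {c : α → AutomatonCode}
    {M : α → ℕ} {S : α → List GridCode} {s : α → GridCode} (hc : Primrec c) (hM : Primrec M)
    (hS : Primrec S) (hs : Primrec s) :
    Primrec fun x => coveredCode (c x) (M x) (S x) (s x) := by
  unfold coveredCode
  fun_prop

theorem coveredCode_iff {M : ℕ} {S : List GridCode} {s : GridCode} :
    coveredCode A.code M S s = true ↔ ∀ δ ≤ 2 * s.1 * (M + 1), ∀ k < A.trans.length, ∀ y,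
      gridStep A.code s (δ, k) = some y →
        ∃ s' ∈ S, s'.2.1 = y.2.1 ∧ colorEqCode m M y s' = true := by
  simp only [coveredCode, List.all_eq_true, List.mem_range, Nat.lt_succ_iff, Automaton.code_trans,
    List.length_map, Automaton.code_numClocks]
  refine forall₄_congr fun δ _ k _ => ?_
  rcases gridStep A.code s (δ, k) with _ | y <;> simp

def checkNoRun (c : AutomatonCode) (w : NoRunCode) : Bool :=
  closedCode c w.2.1 && ((w.2.1.all fun e => decide (-(w.1 : ℤ) ≤ e.2.2.2.2) &&
    decide (e.2.2.2.2 ≤ (w.1 : ℤ))) && ((w.2.2.any fun s => decide (s = gridInit c)) &&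
      w.2.2.all fun s => decide (0 < s.1) && (!acceptingCode c s.2.1 && coveredCode c w.1 w.2.2 s)))

theorem primrec_checkNoRun {α : Type*} [Primcodable α] {c : α → AutomatonCode}
    {w : α → NoRunCode} (hc : Primrec c) (hw : Primrec w) :
    Primrec fun x => checkNoRun (c x) (w x) := by
  unfold checkNoRun gridInit
  fun_prop

theorem checkNoRun_iff {M : ℕ} {G : List ItemCode} {S : List GridCode} :
    checkNoRun A.code (M, G, S) = true ↔ closedCode A.code G = true ∧
      (∀ e ∈ G, |e.2.2.2.2| ≤ M) ∧ gridInit A.code ∈ S ∧ ∀ s ∈ S, 0 < s.1 ∧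
        (¬ ∃ q ∈ A.accepting, s.2.1 = (q : ℕ)) ∧ coveredCode A.code M S s = true := by
  simp only [checkNoRun, Bool.and_eq_true, List.all_eq_true, List.any_eq_true, decide_eq_true_eq,
    Bool.not_eq_true', ← Bool.not_eq_true, acceptingCode_iff, abs_le, exists_eq_right]

/-- An accepting run from a listed configuration is transported, step by step and with the same
number of steps left, to another listed one. Each transport is along the simulation, a region or a
colour, all of which preserve acceptance within `k` steps. -/
theorem not_accIn_of_checkNoRun {M : ℕ} {S : List GridCode} (hA : A.FiniteGuards)
    (hM : A.GuardBound M) (hS : ∀ s ∈ S, 0 < s.1 ∧ (¬ ∃ q ∈ A.accepting, s.2.1 = (q : ℕ)) ∧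
      coveredCode A.code M S s = true) (k : ℕ) :
    ∀ s ∈ S, ∀ q : Fin n, s.2.1 = q → ¬ A.AccIn k q (gridValuation m s) := by
  induction k with
  | zero => exact fun s hs q hq h => (hS s hs).2.1 ⟨q, h, hq⟩
  | succ k ih =>
    rintro s hs q hq ⟨δ, t, ht, rfl, v', hf, hk⟩
    obtain ⟨hpos, -, hcov⟩ := hS s hs
    rw [coveredCode_iff] at hcov
    -- After a delay of `M + 1` every clock exceeds `M`, and differences of clocks ignore delays, so
    -- longer delays give no new colour. This bounds the delays that the certificate must treat.
    obtain ⟨δ₁, hδ₁, hcol⟩ : ∃ δ₁ : ℝ≥0, (δ₁ : ℝ) ≤ (M + 1 : ℕ) ∧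
        ColorEq M (delay (gridValuation m s) δ) (delay (gridValuation m s) δ₁) := by
      by_cases hδ : (δ : ℝ) ≤ (M + 1 : ℕ)
      · exact ⟨δ, hδ, fun _ _ _ _ => Iff.rfl⟩
      · refine ⟨(M + 1 : ℕ), by simp, fun i j d hd => ?_⟩
        push_cast at hδ
        have hd1 : (d : ℝ) ≤ M := by exact_mod_cast (abs_le.1 hd).2
        have hd2 : -(M : ℝ) ≤ d := by exact_mod_cast (abs_le.1 hd).1
        rcases i with _ | i <;> rcases j with _ | j
        · simp
        · have := (gridValuation m s j).2
          simp only [point_none, point_some, delay_apply, NNReal.coe_add, NNReal.coe_natCast]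
          push_cast
          constructor <;> intro _ <;> linarith
        · have := (gridValuation m s i).2
          simp only [point_none, point_some, delay_apply, NNReal.coe_add, NNReal.coe_natCast]
          push_cast
          constructor <;> intro _ <;> linarith
        · simp
    obtain ⟨u, hu, hsim⟩ := hcol.exists_simLU hA hM t.src
    obtain ⟨v₁, hf₁, hsim₁⟩ := hA.simLU_fires ht hsim hf
    obtain ⟨v₂, hf₂, he₂⟩ := hu.fires hf₁
    -- The bounded delay is rounded to the grid inside its region; its numerator is at most `2 * s.1
    -- * (M + 1)`.
    obtain ⟨j, hj, hjM⟩ := exists_grid_delay hpos (RegEq.refl _) δ₁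
    obtain ⟨v₃, hf₃, he₃⟩ := hj.fires hf₂
    obtain ⟨i, hi, y, hy, hy1, hy2, rfl⟩ := exists_gridStep hpos ht hq.symm hf₃
    obtain ⟨s', hs', hq', hc⟩ := hcov j (hjM _ hδ₁) i hi y hy
    rw [colorEqCode_iff (by omega) (hS s' hs').1] at hc
    exact ih s' hs' t.tgt (hq'.trans hy2)
      ((((hk.simLU hA hsim₁).regEq he₂).regEq he₃).colorEq hA hM hc)

theorem not_hasAcceptingRun_of_checkNoRun {w : NoRunCode} (h : checkNoRun A.code w = true) :
    ¬ A.HasAcceptingRun := by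
  obtain ⟨M, G, S⟩ := w
  obtain ⟨h1, h2, h3, h4⟩ := checkNoRun_iff.1 h
  obtain ⟨hA, hG⟩ := finiteGuards_of_closedCode h1
  have hM : A.GuardBound M := fun q φ hφ =>
    h2 _ (hG (q, φ.diff) ((A.mem_items_iff _).2 ⟨φ, hφ, rfl⟩))
  rw [A.hasAcceptingRun_iff, ← gridValuation_init A]
  rintro ⟨k, hk⟩
  exact not_accIn_of_checkNoRun hA hM h4 k _ h3 A.init rfl hk

/-- The grid configuration is reachable in the automaton. -/
def ReachableGrid (A : Automaton (Fin n) (Fin m)) (s : GridCode) : Prop :=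
  0 < s.1 ∧ ∃ q : Fin n, s.2.1 = q ∧
    ReflTransGen A.DelayAction (A.init, fun _ => 0) (q, gridValuation m s)

theorem reachableGrid_init : ReachableGrid A (gridInit A.code) :=
  ⟨one_pos, A.init, rfl, by rw [gridValuation_init]⟩

theorem ReachableGrid.step {s y : GridCode} (hs : ReachableGrid A s) {l : ℕ × ℕ}
    (h : gridStep A.code s l = some y) : ReachableGrid A y := by
  obtain ⟨hpos, q, hq, hr⟩ := hs
  obtain ⟨t, ht, hsrc, h1, h2, hf⟩ := fires_of_gridStep hpos h
  exact ⟨by omega, t.tgt, h2,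
    hr.tail ⟨_, t, ht, Fin.val_injective (hsrc.trans hq), rfl, hf⟩⟩

/-- Denominators of reachable grid configurations are unbounded, but their pairs of state and colour
are finitely many. One representative of each pair suffices, since successors need to be covered
only up to colour. -/
theorem exists_checkNoRun (hA : A.FiniteGuards) (h : ¬ A.HasAcceptingRun) :
    ∃ w, checkNoRun A.code w = true := by
  obtain ⟨M, hM⟩ := hA.exists_guardBound
  let cl : GridCode → ℕ × Set (Option (Fin m) × Option (Fin m) × Set.Icc (-M : ℤ) M) := fun s =>
    (s.2.1, color M (gridValuation m s))
  have hfin : (cl '' {s | ReachableGrid A s}).Finite := by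
    refine ((Set.finite_lt_nat n).prod Set.finite_univ).subset ?_
    rintro _ ⟨s, ⟨-, q, hq, -⟩, rfl⟩
    exact ⟨hq ▸ q.2, trivial⟩
  -- `T` is a transversal of the classes. The initial configuration is added separately because the
  -- check asks for it literally.
  obtain ⟨T, hT, hbij⟩ := Set.exists_subset_bijOn {s | ReachableGrid A s} cl
  have hTfin : T.Finite := hbij.finite_iff_finite.2 hfin
  have hmem : ∀ s ∈ gridInit A.code :: hTfin.toFinset.toList, ReachableGrid A s := by
    intro s hs
    rcases List.mem_cons.1 hs with rfl | hs
    · exact reachableGrid_init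
    · exact hT (by simpa using hs)
  refine ⟨(M, (A.finiteGuards_iff_items.1 hA).toFinset.toList.map itemCode,
    gridInit A.code :: hTfin.toFinset.toList), checkNoRun_iff.2 ⟨hA.closedCode, ?_,
    List.mem_cons_self, fun s hs => ?_⟩⟩
  · intro c hc
    obtain ⟨e, he, rfl⟩ := List.mem_map.1 hc
    rw [Finset.mem_toList, Set.Finite.mem_toFinset, A.mem_items_iff] at he
    obtain ⟨φ, hφ, he⟩ := he
    have := hM e.1 φ hφ
    rw [he] at this
    exact this
  · have hs := hmem s hs
    refine ⟨hs.1, ?_, coveredCode_iff.2 fun δ _ k _ y hy => ?_⟩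
    · rintro ⟨q, hq, he⟩
      obtain ⟨-, q', he', hr⟩ := hs
      obtain rfl : q' = q := Fin.val_injective (he'.symm.trans he)
      exact h ⟨_, hr, hq⟩
    · have hy := hs.step hy
      obtain ⟨s', hs', heq⟩ := hbij.surjOn ⟨y, hy, rfl⟩
      obtain ⟨h1, h2⟩ := Prod.mk.inj heq
      exact ⟨s', List.mem_cons_of_mem _ (by simpa using hs'), h1,
        (colorEqCode_iff hy.1 (hT hs').1).2 (color_eq_iff.1 h2.symm)⟩

theorem exists_computable_hasAcceptingRun {V : AutomatonCode → Bool} (hV : Computable V)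
    (h : ∀ c, V c = true → ∃ (n m : ℕ) (A : Automaton (Fin n) (Fin m)),
      A.code = c ∧ A.FiniteGuards) :
    ∃ f : AutomatonCode → Bool, Computable f ∧ ∀ (n m : ℕ) (A : Automaton (Fin n) (Fin m)),
      V A.code = true → (f A.code = true ↔ A.HasAcceptingRun) := by
  obtain ⟨f, hf, hfT⟩ := exists_computable_of_certificates
    (T := fun c => ∃ w, checkRun c w = true) (p := checkRun) (n := checkNoRun) hV
    (primrec_checkRun Primrec.fst Primrec.snd) (primrec_checkNoRun Primrec.fst Primrec.snd)
    (fun _ _ => Iff.rfl) fun c hc => by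
      obtain ⟨n, m, A, rfl, hA⟩ := h c hc
      rw [← hasAcceptingRun_iff_checkRun]
      exact ⟨exists_checkNoRun hA, fun ⟨w, hw⟩ => not_hasAcceptingRun_of_checkNoRun hw⟩
  refine ⟨f, hf, fun n m A hA => ?_⟩
  rw [hfT A.code hA, hasAcceptingRun_iff_checkRun]

end Grid

end UTA

theorem mainTheorem7 :
    (∃ f : UTA.AutomatonCode → Bool, Computable f ∧
      ∀ (n m : ℕ) (A : UTA.Automaton (Fin n) (Fin m)), f A.code = true ↔ A.FiniteGuards) ∧
    (∀ (Q X : Type*) [Finite Q] [Finite X] (A : UTA.Automaton Q X), A.FiniteGuards →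
      A.EnumSound ∧ A.EnumComplete ∧ A.EnumTerminates) ∧
    (∃ f : UTA.AutomatonCode → Bool, Computable f ∧
      ∀ (n m : ℕ) (A : UTA.Automaton (Fin n) (Fin m)), A.FiniteGuards →
        A.EnumReaches (.answer (f A.code))) := by
  obtain ⟨f, hf, hfA⟩ := UTA.exists_computable_finiteGuards
  refine ⟨⟨f, hf, hfA⟩, fun Q X _ _ A hA => ⟨hA.enumSound, hA.enumComplete, hA.enumTerminates⟩, ?_⟩
  -- The values of `f` off the codes of automata are unknown, so validity of the code is tested as
  -- well.
  obtain ⟨g, hg, hgA⟩ := UTA.exists_computable_hasAcceptingRun (V := fun c => UTA.validCode c && f c)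
    (Primrec.and.to_comp.comp (UTA.primrec_validCode Primrec.id).to_comp hf) fun c hc => by
      rw [Bool.and_eq_true] at hc
      obtain ⟨n, m, A, rfl⟩ := (UTA.validCode_iff c).1 hc.1
      exact ⟨n, m, A, rfl, (hfA n m A).1 hc.2⟩
  refine ⟨g, hg, fun n m A hA => hA.enumReaches_answer (hgA n m A ?_)⟩
  rw [Bool.and_eq_true]
  exact ⟨(UTA.validCode_iff _).2 ⟨n, m, A, rfl⟩, (hfA n m A).2 hA⟩
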